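/- **Setting.** There are $m\ge 1$ machines and a finite set of $n$ jobs. Machine $i$ has speed $s_{i,j}\in\mathbb Z_{\ge 0}$ for job $j$, and for each job $j$ a function $f_j:\mathbb R_{\ge 0}\to\mathbb R_{\ge 0}$ is given such that $f_j(q)$ is non-increasing and $q f_j(q)$ is non-decreasing in $q$. For $p\ge 1$, a job $j$ that is run on a non-empty set $S$ of machines takes time $f_j(S):=f_j(\sigma_j^{(p)}(S))$, where $\sigma^{(p)}_j(S)=\left(\sum_{i\in S}s_{i,j}^p\right)^{1/p}$. A feasible schedule gives each job $j$ a non-empty set $S_j$ of machines and a start time $\tau_j\ge 0$; the job occupies all machines of $S_j$ during $[\tau_j,\tau_j+f_j(S_j)]$, and jobs that share a machine do not overlap in time. The makespan is $\max_j(\tau_j+f_j(S_j))$, and $\mathrm{OPT}$ is the optimal makespan. **The linear program.** Let $Q=\mathbb Z_{\ge0}$ or $Q=\mathbb R_{\ge0}$, and for a target $C$ let $\gamma_j=\gamma_j(C)=\inf\{q\in Q: f_j(q)\le C\}$ be the critical speed of $j$ over $Q$ (infinite if there is no such $q$). Let $J_i^+=\{j: f_j(s_{i,j})\le C\}$, and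 let $J_i^-$ be the set of the other jobs. The program $[\mathrm{LP}^{(p)}_Q(C)]$ is $$\sum_i x_{i,j}=1\ \ \forall j,\qquad \sum_{j\in J_i^+}f_j(s_{i,j})x_{i,j}+\sum_{j\in J_i^-}f_j(\gamma_j)\left(\frac{\gamma_j}{s_{i,j}}\right)^{p}x_{i,j}\le C\ \ \forall i,\qquad x_{i,j}\ge 0\ \ \forall i,j,$$ where for $j\in J_i^-$ with $s_{i,j}=0$ the coefficient is read as infinite, i.e. $x_{i,j}=0$ is required, and the program is infeasible if some $\gamma_j$ is infinite. **Computation.** Algorithms are uniform programs on a real random access machine with unit-cost real arithmetic ($+,-,\times,\div$, comparison, powers of non-negative reals, logarithm) and unit-cost queries to a value oracle for the functions $f_j$. The input consists of $m,n,p,C$, the speeds and $x$ (and $\beta$ in (1)); for $Q=\mathbb R_{\ge 0}$ it also contains the numbers $\gamma_j$, which are part of the linear program, while for $Q=\mathbb Z_{\ge 0}$ it does not contain them. Polynomial time means a number of steps that is polynomial in $m+n$ plus the total binary length of the speeds. **Theorem.** Let $Q$ be either of $\mathbb Z_{\ge0}$, $\mathbb R_{\ge0}$ in (1) and (2). 1.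 There is a polynomial-time algorithm that, for every $p\ge1$, every threshold $\beta\in(0,1)$ and every $C$, rounds any feasible solution $x$ of $[\mathrm{LP}_Q^{(p)}(C)]$ to a feasible schedule of makespan at most $\left(\frac1\beta+\frac1{(1-\beta)^{1/p}}\right)C$. 2. There is a polynomial-time algorithm that, for every $p\ge2$ and every $C$, rounds any feasible solution $x$ of $[\mathrm{LP}_Q^{(p)}(C)]$ to a feasible schedule of makespan at most $\left(\frac{p}{p-\ln p}+\sqrt[p]{\frac{p}{\ln p}}\right)C$. 3. For every $p\ge 1$ and every $C\ge\mathrm{OPT}$, the program $[\mathrm{LP}_Q^{(p)}(C)]$ with $Q=\mathbb R_{\ge0}$ has a feasible solution. -/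

import Mathlib

noncomputable section

namespace Malleable

/-! ### Malleable jobs on unrelated machines -/

/-- `m` machines and `n` jobs. Machine `i` has the non-negative integral speed `speed i j` for job
`j`; the processing time of `j` at total speed `q ≥ 0` is `time j q`. Values of `time j` at negative
arguments are never used. -/
structure Instance (m n : ℕ) where
  speed : Fin m → Fin n → ℕ
  time : Fin n → ℝ → ℝ
  time_nonneg : ∀ j q, 0 ≤ q → 0 ≤ time j q
  time_antitone : ∀ j, AntitoneOn (time j) (Set.Ici 0)
  work_monotone : ∀ j, MonotoneOn (fun q => time j q * q) (Set.Ici 0)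

variable {m n : ℕ}

namespace Instance

/-- Effective speed of a set of machines for job `j`: the `L_p` norm of the speeds. -/
def effSpeed (I : Instance m n) (p : ℝ) (S : Finset (Fin m)) (j : Fin n) : ℝ :=
  (∑ i ∈ S, (I.speed i j : ℝ) ^ p) ^ (1 / p)

/-- Processing time of job `j` on the set `S` of machines. -/
def procTime (I : Instance m n) (p : ℝ) (S : Finset (Fin m)) (j : Fin n) : ℝ :=
  I.time j (I.effSpeed p S j)

/-- Size of the integral part of the input: numbers of machines and jobs, and the total
binary length of the speeds. -/
def size (I : Instance m n) : ℕ :=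
  m + n + ∑ i, ∑ j, Nat.size (I.speed i j)

/-- The speeds `q ∈ Q` (with `q ≥ 0`) at which job `j` takes time at most `C`. -/
def fastEnough (I : Instance m n) (Q : Set ℝ) (C : ℝ) (j : Fin n) : Set ℝ :=
  {q | q ∈ Q ∧ 0 ≤ q ∧ I.time j q ≤ C}

/-- Critical speed of job `j` for the target makespan `C`, over the candidate speeds `Q`.
It is meaningful only if `fastEnough I Q C j` is non-empty. -/
def critSpeed (I : Instance m n) (Q : Set ℝ) (C : ℝ) (j : Fin n) : ℝ :=
  sInf (I.fastEnough Q C j)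

/-- Jobs that machine `i` alone can process within time `C`. -/
def jobsPlus (I : Instance m n) (C : ℝ) (i : Fin m) : Finset (Fin n) :=
  Finset.univ.filter fun j => I.time j (I.speed i j) ≤ C

/-- Jobs that machine `i` alone cannot process within time `C`. -/
def jobsMinus (I : Instance m n) (C : ℝ) (i : Fin m) : Finset (Fin n) :=
  Finset.univ.filter fun j => ¬ I.time j (I.speed i j) ≤ C

/-- `x` is a feasible solution of the assignment linear program with exponent `p` and target `C`,
critical speeds being taken over `Q`. The fields `critical` and `zero_speed` treat an infinite
critical speed, and a coefficient with denominator `speed i j = 0`, as an infinite coefficient. -/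
structure IsLPSolution (I : Instance m n) (Q : Set ℝ) (p C : ℝ) (x : Fin m → Fin n → ℝ) :
    Prop where
  critical : ∀ j, (I.fastEnough Q C j).Nonempty
  zero_speed : ∀ i, ∀ j ∈ I.jobsMinus C i, I.speed i j = 0 → x i j = 0
  assign : ∀ j, ∑ i, x i j = 1
  load : ∀ i,
    ∑ j ∈ I.jobsPlus C i, I.time j (I.speed i j) * x i j +
      ∑ j ∈ I.jobsMinus C i,
        I.time j (I.critSpeed Q C j) * (I.critSpeed Q C j / I.speed i j) ^ p * x i j ≤ C
  nonneg : ∀ i j, 0 ≤ x i j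

end Instance

/-- Every job gets a set of machines and a common starting time on all of them. -/
structure Schedule (m n : ℕ) where
  machines : Fin n → Finset (Fin m)
  start : Fin n → ℝ

namespace Schedule

/-- Completion time of job `j`. -/
def completion (S : Schedule m n) (I : Instance m n) (p : ℝ) (j : Fin n) : ℝ :=
  S.start j + I.procTime p (S.machines j) j

/-- Jobs run on non-empty sets of machines, without preemption and in unison, from time `0` on,
and two jobs that share a machine do not overlap in time. -/
structure IsFeasible (S : Schedule m n) (I : Instance m n) (p : ℝ) : Prop where
  machines_nonempty : ∀ j, (S.machines j).Nonempty
  start_nonneg : ∀ j, 0 ≤ S.start j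
  no_overlap : ∀ j k, j ≠ k → (S.machines j ∩ S.machines k).Nonempty →
    S.completion I p j ≤ S.start k ∨ S.completion I p k ≤ S.start j

/-- The makespan `max_j C_j` (it is `0` if there are no jobs). -/
def makespan (S : Schedule m n) (I : Instance m n) (p : ℝ) : ℝ :=
  ⨆ j, S.completion I p j

end Schedule

/-- The optimal makespan. -/
def Instance.opt (I : Instance m n) (p : ℝ) : ℝ :=
  sInf {v | ∃ S : Schedule m n, S.IsFeasible I p ∧ S.makespan I p = v}

/-! ### Programs over the real numbers, with an oracle and a step count

A real random access machine: index registers hold natural numbers, and two-dimensional arrays hold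
real numbers. Arithmetic, comparison and an oracle query cost one step each. -/

/-- Memory: `idx k` is the `k`-th index register, `arr a r c` the entry `(r, c)` of array `a`. -/
structure Store where
  idx : ℕ → ℕ
  arr : ℕ → ℕ → ℕ → ℝ

/-- A reference to the entry of array `name` whose row and column are the current contents of the
index registers `row` and `col`. -/
structure Cell where
  name : ℕ
  row : ℕ
  col : ℕ

def Store.get (σ : Store) (u : Cell) : ℝ :=
  σ.arr u.name (σ.idx u.row) (σ.idx u.col)

def Store.set (σ : Store) (u : Cell) (v : ℝ) : Store where
  idx := σ.idx
  arr := fun a r c =>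
    if a = u.name ∧ r = σ.idx u.row ∧ c = σ.idx u.col then v else σ.arr a r c

def Store.setIdx (σ : Store) (k v : ℕ) : Store where
  idx := Function.update σ.idx k v
  arr := σ.arr

inductive RealOp
  | add | sub | mul | div | pow

/-- Powers are available for non-negative bases only. -/
def RealOp.eval : RealOp → ℝ → ℝ → ℝ
  | .add, a, b => a + b
  | .sub, a, b => a - b
  | .mul, a, b => a * b
  | .div, a, b => a / b
  | .pow, a, b => if 0 ≤ a then a ^ b else 0

inductive Test
  | idxLe (k l : ℕ)
  | realLe (u v : Cell)

def Test.Holds (σ : Store) : Test → Prop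
  | .idxLe k l => σ.idx k ≤ σ.idx l
  | .realLe u v => σ.get u ≤ σ.get v

/-- Programs. Literals are natural numbers; `query d k u` asks the oracle for the processing time,
at speed `u`, of the job whose number is in index register `k`, and stores the answer in `d`. -/
inductive Cmd
  | skip
  | idxLit (k c : ℕ)
  | idxAdd (k a b : ℕ)
  | idxSub (k a b : ℕ)
  | realLit (d : Cell) (c : ℕ)
  | realOp (o : RealOp) (d u v : Cell)
  | realLog (d u : Cell)
  | query (d : Cell) (k : ℕ) (u : Cell)
  | seq (c₁ c₂ : Cmd)
  | ite (b : Test) (c₁ c₂ : Cmd)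
  | loop (b : Test) (c : Cmd)

/-- `Exec F c σ σ' t`: with oracle `F`, program `c` started in `σ` halts in `σ'` after exactly `t`
steps. -/
inductive Exec (F : ℕ → ℝ → ℝ) : Cmd → Store → Store → ℕ → Prop
  | skip (σ) : Exec F .skip σ σ 1
  | idxLit (σ k c) : Exec F (.idxLit k c) σ (σ.setIdx k c) 1
  | idxAdd (σ k a b) : Exec F (.idxAdd k a b) σ (σ.setIdx k (σ.idx a + σ.idx b)) 1
  | idxSub (σ k a b) : Exec F (.idxSub k a b) σ (σ.setIdx k (σ.idx a - σ.idx b)) 1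
  | realLit (σ d c) : Exec F (.realLit d c) σ (σ.set d (c : ℝ)) 1
  | realOp (σ o d u v) : Exec F (.realOp o d u v) σ (σ.set d (o.eval (σ.get u) (σ.get v))) 1
  | realLog (σ d u) : Exec F (.realLog d u) σ (σ.set d (Real.log (σ.get u))) 1
  | query (σ d k u) : Exec F (.query d k u) σ (σ.set d (F (σ.idx k) (σ.get u))) 1
  | seq {c₁ c₂ σ σ₁ σ₂ t₁ t₂} : Exec F c₁ σ σ₁ t₁ → Exec F c₂ σ₁ σ₂ t₂ →
      Exec F (.seq c₁ c₂) σ σ₂ (t₁ + t₂)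
  | ite_true {b c₁ c₂ σ σ₁ t} : b.Holds σ → Exec F c₁ σ σ₁ t →
      Exec F (.ite b c₁ c₂) σ σ₁ (t + 1)
  | ite_false {b c₁ c₂ σ σ₁ t} : ¬ b.Holds σ → Exec F c₂ σ σ₁ t →
      Exec F (.ite b c₁ c₂) σ σ₁ (t + 1)
  | loop_false {b c σ} : ¬ b.Holds σ → Exec F (.loop b c) σ σ 1
  | loop_true {b c σ σ₁ σ₂ t₁ t₂} : b.Holds σ → Exec F c σ σ₁ t₁ →
      Exec F (.loop b c) σ₁ σ₂ t₂ → Exec F (.loop b c) σ σ₂ (t₁ + t₂ + 1)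

/-- Programs are deterministic. -/
theorem Exec.unique {F : ℕ → ℝ → ℝ} {c : Cmd} {σ σ₁ σ₂ : Store} {t₁ t₂ : ℕ}
    (h₁ : Exec F c σ σ₁ t₁) (h₂ : Exec F c σ σ₂ t₂) : σ₁ = σ₂ ∧ t₁ = t₂ := by
  induction h₁ generalizing σ₂ t₂ with
  | seq _ _ ih₁ ih₂ =>
    cases h₂ with
    | seq k₁ k₂ =>
      obtain ⟨rfl, rfl⟩ := ih₁ k₁
      obtain ⟨rfl, rfl⟩ := ih₂ k₂
      exact ⟨rfl, rfl⟩
  | ite_true hb _ ih =>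
    cases h₂ with
    | ite_true _ k => obtain ⟨rfl, rfl⟩ := ih k; exact ⟨rfl, rfl⟩
    | ite_false kb _ => exact absurd hb kb
  | ite_false hb _ ih =>
    cases h₂ with
    | ite_true kb _ => exact absurd kb hb
    | ite_false _ k => obtain ⟨rfl, rfl⟩ := ih k; exact ⟨rfl, rfl⟩
  | loop_false hb =>
    cases h₂ with
    | loop_false _ => exact ⟨rfl, rfl⟩
    | loop_true kb _ _ => exact absurd kb hb
  | loop_true hb _ _ ih₁ ih₂ =>
    cases h₂ with
    | loop_false kb => exact absurd hb kb
    | loop_true _ k₁ k₂ =>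
      obtain ⟨rfl, rfl⟩ := ih₁ k₁
      obtain ⟨rfl, rfl⟩ := ih₂ k₂
      exact ⟨rfl, rfl⟩
  | _ => cases h₂; exact ⟨rfl, rfl⟩

/-! ### Rounding programs -/

/-- The value oracle for the processing times (`0` outside its domain). -/
def Instance.oracle (I : Instance m n) (k : ℕ) (q : ℝ) : ℝ :=
  if h : k < n then (if 0 ≤ q then I.time ⟨k, h⟩ q else 0) else 0

/-- Extension of a matrix by zeros. -/
def padMatrix (a : Fin m → Fin n → ℝ) (r c : ℕ) : ℝ :=
  if h : r < m ∧ c < n then a ⟨r, h.1⟩ ⟨c, h.2⟩ else 0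

/-- Initial memory. Index registers `0` and `1` hold `m` and `n`; array `0` holds the speeds, array
`1` the matrix `x`, row `0` of array `2` a list of real parameters, and row `0` of array `3` a
vector of one real per job. Everything else is `0`. -/
def inputStore (I : Instance m n) (x : Fin m → Fin n → ℝ) (params : List ℝ) (γ : Fin n → ℝ) :
    Store where
  idx := fun k => if k = 0 then m else if k = 1 then n else 0
  arr := fun a r c =>
    if a = 0 then padMatrix (fun i j => (I.speed i j : ℝ)) r c
    else if a = 1 then padMatrix x r c
    else if a = 2 then (if r = 0 then params.getD c 0 else 0)
    else if a = 3 then padMatrix (fun _ : Fin 1 => γ) r c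
    else 0

/-- The schedule left in memory: machine `i` belongs to the set of job `j` iff entry `(i, j)` of
array `4` is positive, and job `j` starts at the time in entry `(0, j)` of array `5`. -/
def outputSchedule (m n : ℕ) (σ : Store) : Schedule m n where
  machines := fun j => Finset.univ.filter fun i : Fin m => 0 < σ.arr 4 (i : ℕ) (j : ℕ)
  start := fun j => σ.arr 5 0 (j : ℕ)

/-- Started in `σ`, program `c` halts within `T` steps and leaves in memory a feasible schedule of
makespan at most `B`. -/
def Cmd.Schedules (c : Cmd) (I : Instance m n) (p : ℝ) (σ : Store) (T : ℕ) (B : ℝ) : Prop :=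
  ∃ σ' t, Exec I.oracle c σ σ' t ∧ t ≤ T ∧
    (outputSchedule m n σ').IsFeasible I p ∧ (outputSchedule m n σ').makespan I p ≤ B

/-- Candidate speeds: the non-negative integers. -/
def integralSpeeds : Set ℝ := Set.range ((↑) : ℕ → ℝ)

/-- Candidate speeds: the non-negative reals. -/
def realSpeeds : Set ℝ := Set.Ici 0

end Malleable

end

noncomputable section

namespace Malleable

section

/-! ### A program logic -/

/-! Rounding. Take the machines and jobs as the `m + n` vertices of a bipartite graph and the pairs
`(i, j)` as its edges. The load and assignment constraints give every edge a column that vanishes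
away from its two ends: the coefficient `a i j` at the machine and `1` at the job. Moving `x` along
kernel directions inside its support produces `y ≥ 0` with the same row sums, so still a solution,
whose support has linearly independent columns (`Tableau`). Independence yields Hall's condition: a
set `F` of support edges consists of `|F|` independent vectors that live on the vertices touched by
`F`, so it touches at least `|F|` vertices (`hall_of_independent`). Hence every support edge can be
charged to one of its ends with no vertex charged twice. A greedy rule finds the charging: an edge
at a vertex of minimal positive degree can always be charged to that vertex (`Hall.erase`).

So a machine is charged with at most one edge, and a job has at most one edge that is not charged to
a machine, namely the one charged to the job. A job with some `y i j ≥ β` runs on one such machine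
alone; its time is at most `a i j ≤ a i j * y i j / β`, so these jobs add up to at most `C / β` on
each machine. Any other job runs on the machines charged with its edges. The missing edge carries
less than `β`, so these machines carry at least `1 - β`. If none of them alone meets the target `C`,
then summing `f(γ) (γ / s_i)^p y_i ≤ C` gives `f(γ) γ^p (1 - β) ≤ C σ^p`, and monotonicity of the
work `q f(q)` turns this into `f(σ)^p (1 - β) ≤ C^p` (`Instance.procTime_le_of_isCoeff`). These jobs
share no machine and all run from time `0`; the single-machine jobs follow from `C / (1 - β)^(1/p)`
on (`schedule_of_rounding`). For `p ≥ 2` the threshold is `β = 1 - log p / p`.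

Integral critical speeds are found by doubling and bisection. Feasibility bounds them: some machine
holds a share of at least `1 / m`, which forces `γ ≤ 2 m s_i` unless the job is already easy
(`Instance.IsLPSolution.time_two_pow_le`), so polynomially many queries suffice.

Feasibility for `C ≥ OPT`. Makespan bounds machine loads, and only finitely many assignments exist,
so some assignment has all loads at most `C`. Splitting job `j` in proportions `(s_i / σ(S_j))^p`
solves the program, since each machine of `S_j` is then loaded by at most `f_j(S_j)`.

Computation. All of this is written as explicit programs. `Runs` is a total-correctness judgement
whose step count is a polynomial in one common bound `L` on the rounds of each loop; finally `L =
(size + 2) ^ 2`. -/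

/-- A bound on the number of steps of a program, if each of its loops does at most `X` rounds
whenever it is started. -/
def Cmd.costPoly : Cmd → Polynomial ℕ
  | .seq c₁ c₂ => c₁.costPoly + c₂.costPoly
  | .ite _ c₁ c₂ => c₁.costPoly + c₂.costPoly + 1
  | .loop _ c => Polynomial.X * (c.costPoly + 1) + 1
  | _ => 1

/-- Program `c` halts from `σ` in a store that satisfies `Q`, within the cost bound for loops of at
most `L` rounds. -/
def Runs (F : ℕ → ℝ → ℝ) (L : ℕ) (c : Cmd) (σ : Store) (Q : Store → Prop) : Prop :=
  ∃ σ' t, Exec F c σ σ' t ∧ t ≤ c.costPoly.eval L ∧ Q σ'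

/-! ### Rules for the single instructions -/

section Rules

variable {F : ℕ → ℝ → ℝ} {L : ℕ} {σ : Store} {Q : Store → Prop}

theorem Runs.mono {c : Cmd} {Q' : Store → Prop} (h : Runs F L c σ Q')
    (hQ : ∀ σ', Q' σ' → Q σ') : Runs F L c σ Q := by
  obtain ⟨σ', t, h₁, h₂, h₃⟩ := h
  exact ⟨σ', t, h₁, h₂, hQ _ h₃⟩

theorem runs_skip (h : Q σ) : Runs F L .skip σ Q :=
  ⟨_, _, .skip σ, by simp [Cmd.costPoly], h⟩

theorem runs_idxLit {k c : ℕ} (h : Q (σ.setIdx k c)) : Runs F L (.idxLit k c) σ Q :=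
  ⟨_, _, .idxLit σ k c, by simp [Cmd.costPoly], h⟩

theorem runs_idxAdd {k a b : ℕ} (h : Q (σ.setIdx k (σ.idx a + σ.idx b))) :
    Runs F L (.idxAdd k a b) σ Q :=
  ⟨_, _, .idxAdd σ k a b, by simp [Cmd.costPoly], h⟩

theorem runs_idxSub {k a b : ℕ} (h : Q (σ.setIdx k (σ.idx a - σ.idx b))) :
    Runs F L (.idxSub k a b) σ Q :=
  ⟨_, _, .idxSub σ k a b, by simp [Cmd.costPoly], h⟩

theorem runs_realLit {d : Cell} {c : ℕ} (h : Q (σ.set d c)) : Runs F L (.realLit d c) σ Q :=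
  ⟨_, _, .realLit σ d c, by simp [Cmd.costPoly], h⟩

theorem runs_realOp {o : RealOp} {d u v : Cell} (h : Q (σ.set d (o.eval (σ.get u) (σ.get v)))) :
    Runs F L (.realOp o d u v) σ Q :=
  ⟨_, _, .realOp σ o d u v, by simp [Cmd.costPoly], h⟩

theorem runs_realLog {d u : Cell} (h : Q (σ.set d (Real.log (σ.get u)))) :
    Runs F L (.realLog d u) σ Q :=
  ⟨_, _, .realLog σ d u, by simp [Cmd.costPoly], h⟩

theorem runs_query {d u : Cell} {k : ℕ} (h : Q (σ.set d (F (σ.idx k) (σ.get u)))) :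
    Runs F L (.query d k u) σ Q :=
  ⟨_, _, .query σ d k u, by simp [Cmd.costPoly], h⟩

/-- The postcondition of the first command is that the second one runs. A proof therefore walks
forwards through a program with explicit intermediate stores, and no intermediate assertion has to
be stated. -/
theorem runs_seq {c₁ c₂ : Cmd} (h : Runs F L c₁ σ fun σ₁ => Runs F L c₂ σ₁ Q) :
    Runs F L (.seq c₁ c₂) σ Q := by
  obtain ⟨σ₁, t₁, h₁, h₂, σ₂, t₂, h₃, h₄, h₅⟩ := h
  exact ⟨σ₂, _, .seq h₁ h₃, by simpa [Cmd.costPoly] using add_le_add h₂ h₄, h₅⟩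

theorem runs_ite {b : Test} {c₁ c₂ : Cmd} (h₁ : b.Holds σ → Runs F L c₁ σ Q)
    (h₂ : ¬ b.Holds σ → Runs F L c₂ σ Q) : Runs F L (.ite b c₁ c₂) σ Q := by
  by_cases hb : b.Holds σ
  · obtain ⟨σ', t, h, ht, hQ⟩ := h₁ hb
    exact ⟨σ', _, .ite_true hb h, by simp [Cmd.costPoly]; omega, hQ⟩
  · obtain ⟨σ', t, h, ht, hQ⟩ := h₂ hb
    exact ⟨σ', _, .ite_false hb h, by simp [Cmd.costPoly]; omega, hQ⟩

/-- The rule for loops, with a bound `k` on the number of rounds that are left. -/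
theorem runs_loop {b : Test} {c : Cmd} (Inv : ℕ → Store → Prop) {k : ℕ} (hk : k ≤ L)
    (h₀ : Inv k σ)
    (hc : ∀ k σ₁, Inv k σ₁ → b.Holds σ₁ → ∃ l, k = l + 1 ∧ Runs F L c σ₁ (Inv l))
    (hQ : ∀ k σ₁, Inv k σ₁ → ¬ b.Holds σ₁ → Q σ₁) : Runs F L (.loop b c) σ Q := by
  have main : ∀ k σ, Inv k σ →
      ∃ σ' t, Exec F (.loop b c) σ σ' t ∧ t ≤ k * (c.costPoly.eval L + 1) + 1 ∧ Q σ' := by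
    intro k
    induction k with
    | zero =>
      intro σ h
      by_cases hb : b.Holds σ
      · obtain ⟨l, hl, -⟩ := hc _ _ h hb
        omega
      · exact ⟨σ, 1, .loop_false hb, by simp, hQ _ _ h hb⟩
    | succ k ih =>
      intro σ h
      by_cases hb : b.Holds σ
      · obtain ⟨l, hl, σ₁, t₁, e₁, ht₁, h₁⟩ := hc _ _ h hb
        obtain rfl : k = l := by omega
        obtain ⟨σ₂, t₂, e₂, ht₂, h₂⟩ := ih _ h₁
        exact ⟨σ₂, _, .loop_true hb e₁ e₂, by rw [Nat.succ_mul]; omega, h₂⟩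
      · exact ⟨σ, 1, .loop_false hb, by simp, hQ _ _ h hb⟩
  obtain ⟨σ', t, e, ht, h⟩ := main k σ h₀
  refine ⟨σ', t, e, ht.trans ?_, h⟩
  simp only [Cmd.costPoly, Polynomial.eval_add, Polynomial.eval_mul, Polynomial.eval_X,
    Polynomial.eval_one]
  gcongr

end Rules

/-! ### Reading a store after an update -/

section Simp

@[simp] theorem Store.set_idx (σ : Store) (u : Cell) (v : ℝ) : (σ.set u v).idx = σ.idx := rfl

@[simp] theorem Store.setIdx_arr (σ : Store) (k v : ℕ) : (σ.setIdx k v).arr = σ.arr := rfl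

@[simp] theorem Store.setIdx_idx (σ : Store) (k v l : ℕ) :
    (σ.setIdx k v).idx l = if l = k then v else σ.idx l := by
  simp [Store.setIdx, Function.update_apply]

@[simp] theorem Store.set_arr (σ : Store) (u : Cell) (v : ℝ) (a r c : ℕ) :
    (σ.set u v).arr a r c =
      if a = u.name ∧ r = σ.idx u.row ∧ c = σ.idx u.col then v else σ.arr a r c := rfl

@[simp] theorem Store.get_def (σ : Store) (a r c : ℕ) :
    σ.get ⟨a, r, c⟩ = σ.arr a (σ.idx r) (σ.idx c) := rfl

theorem Store.set_arr_ne (σ : Store) (u : Cell) (v : ℝ) {a : ℕ} (h : a ≠ u.name) :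
    (σ.set u v).arr a = σ.arr a := by
  funext r c
  simp [h]

end Simp

/-! ### Frames: the registers and arrays a command may change -/

/-- The second store agrees with the first one except for index registers in `I` and arrays
in `A`. -/
structure Fr (I A : Set ℕ) (σ σ' : Store) : Prop where
  idx : ∀ k, k ∉ I → σ'.idx k = σ.idx k
  arr : ∀ a, a ∉ A → σ'.arr a = σ.arr a

namespace Fr

variable {I A I' A' : Set ℕ} {σ σ₁ σ₂ : Store}

theorem refl : Fr I A σ σ := ⟨fun _ _ => rfl, fun _ _ => rfl⟩

theorem trans (h : Fr I A σ σ₁) (h' : Fr I A σ₁ σ₂) : Fr I A σ σ₂ :=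
  ⟨fun k hk => (h'.idx k hk).trans (h.idx k hk), fun a ha => (h'.arr a ha).trans (h.arr a ha)⟩

theorem mono (h : Fr I A σ σ₁) (hI : I ⊆ I') (hA : A ⊆ A') : Fr I' A' σ σ₁ :=
  ⟨fun k hk => h.idx k fun h' => hk (hI h'), fun a ha => h.arr a fun h' => ha (hA h')⟩

theorem set (h : Fr I A σ σ₁) {u : Cell} {v : ℝ} (hu : u.name ∈ A) : Fr I A σ (σ₁.set u v) :=
  ⟨h.idx, fun a ha => (Store.set_arr_ne _ _ _ fun h' => ha (by rw [h']; exact hu)).trans (h.arr a ha)⟩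

theorem setIdx (h : Fr I A σ σ₁) {k v : ℕ} (hk : k ∈ I) : Fr I A σ (σ₁.setIdx k v) :=
  ⟨fun l hl => by
    have : l ≠ k := fun h' => hl (h' ▸ hk)
    simp [this, h.idx l hl], h.arr⟩

end Fr

/-! ### Loops that count down -/

/-- `for k` from `idx lim - 1` down to `0`; register `2` holds `0` and register `3` holds `1`. -/
def Cmd.for (k lim : ℕ) (c : Cmd) : Cmd :=
  .seq (.idxAdd k lim 2) (.loop (.idxLe 3 k) (.seq (.idxSub k k 3) c))

/-- Because the loop counts down, the loop variable is also the number of rounds left, and the bound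
required by `runs_loop` comes for free. `Inv v` describes the store when the indices from `v` on
have been treated. The invariant must ignore writes to the loop register (`hs`), and the body must
leave that register alone (`k ∉ I'`). -/
theorem runs_for {F : ℕ → ℝ → ℝ} {L : ℕ} {σ : Store} {Q : Store → Prop} {k lim : ℕ} {c : Cmd}
    (I A I' : Set ℕ) (Inv : ℕ → Store → Prop)
    (hk : k ∈ I) (h3 : 3 ∉ I) (hI : I' ⊆ I) (hk' : k ∉ I')
    (z : σ.idx 2 = 0) (o : σ.idx 3 = 1) (hL : σ.idx lim ≤ L)
    (hs : ∀ v w σ', Inv v σ' → Inv v (σ'.setIdx k w))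
    (h0 : Inv (σ.idx lim) σ)
    (hb : ∀ v σ₁, v < σ.idx lim → Fr I A σ σ₁ → σ₁.idx k = v → Inv (v + 1) σ₁ →
      Runs F L c σ₁ fun σ₂ => Fr I' A σ₁ σ₂ ∧ Inv v σ₂)
    (hQ : ∀ σ', Fr I A σ σ' → Inv 0 σ' → Q σ') : Runs F L (.for k lim c) σ Q := by
  refine runs_seq (runs_idxAdd (runs_loop (fun v σ₁ => Fr I A σ σ₁ ∧ v ≤ σ.idx lim ∧
    σ₁.idx k = v ∧ Inv v σ₁) hL ⟨Fr.refl.setIdx hk, le_rfl, by simp [z], hs _ _ _ h0⟩ ?_ ?_))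
  · rintro v σ₁ ⟨hF, hv, hkv, hI1⟩ ht
    have h31 : σ₁.idx 3 = 1 := (hF.idx 3 h3).trans o
    have hv1 : 1 ≤ v := by
      have : σ₁.idx 3 ≤ σ₁.idx k := ht
      omega
    obtain ⟨w, rfl⟩ : ∃ w, v = w + 1 := ⟨v - 1, by omega⟩
    refine ⟨w, rfl, runs_seq (runs_idxSub ?_)⟩
    refine (hb w (σ₁.setIdx k (σ₁.idx k - σ₁.idx 3)) (by omega) (hF.setIdx hk)
      (by simp [hkv, h31]) (hs _ _ _ hI1)).mono ?_
    rintro σ₂ ⟨hF2, hI2⟩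
    refine ⟨(hF.setIdx hk).trans (hF2.mono hI subset_rfl), by omega, ?_, hI2⟩
    rw [hF2.idx k hk']
    simp [hkv, h31]
  · rintro v σ₁ ⟨hF, hv, hkv, hI1⟩ ht
    have h31 : σ₁.idx 3 = 1 := (hF.idx 3 h3).trans o
    have hv0 : v = 0 := by
      have : ¬ σ₁.idx 3 ≤ σ₁.idx k := ht
      omega
    subst hv0
    exact hQ _ hF hI1

/-- A loop that fills row `0` of array `d` with the values of `g`. -/
theorem runs_map1 {F : ℕ → ℝ → ℝ} {L : ℕ} {σ : Store} {Q : Store → Prop} {k lim : ℕ} {c : Cmd}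
    (I A I' : Set ℕ) (d : ℕ) (g : ℕ → ℝ)
    (hk : k ∈ I) (h3 : 3 ∉ I) (hI : I' ⊆ I) (hk' : k ∉ I')
    (z : σ.idx 2 = 0) (o : σ.idx 3 = 1) (hL : σ.idx lim ≤ L)
    (hb : ∀ v σ₁, v < σ.idx lim → Fr I A σ σ₁ → σ₁.idx k = v → σ₁.arr d 0 v = σ.arr d 0 v →
      Runs F L c σ₁ fun σ₂ => Fr I' A σ₁ σ₂ ∧
        ∀ r l, σ₂.arr d r l = if r = 0 ∧ l = v then g v else σ₁.arr d r l)
    (hQ : ∀ σ', Fr I A σ σ' → (∀ r l, σ'.arr d r l =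
      if r = 0 ∧ l < σ.idx lim then g l else σ.arr d r l) → Q σ') :
    Runs F L (.for k lim c) σ Q := by
  refine runs_for I A I' (fun v σ₁ => ∀ r l, σ₁.arr d r l =
      if r = 0 ∧ v ≤ l ∧ l < σ.idx lim then g l else σ.arr d r l) hk h3 hI hk' z o hL
      (fun _ _ _ h => h) ?_ ?_ ?_
  · intro r l
    rw [if_neg (by omega)]
  · intro v σ₁ hv hF hkv hInv
    refine (hb v σ₁ hv hF hkv ?_).mono ?_
    · rw [hInv, if_neg (by omega)]
    · rintro σ₂ ⟨hF2, h⟩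
      refine ⟨hF2, fun r l => ?_⟩
      rw [h, hInv]
      split_ifs with h1 h2 h3 h4 <;> first | rfl | (exfalso; omega) | skip
      rw [h1.2]
  · intro σ' hF h
    refine hQ σ' hF fun r l => ?_
    rw [h]
    simp

/-- Nested loops that fill array `d` with the values of `g`. -/
theorem runs_map2 {F : ℕ → ℝ → ℝ} {L : ℕ} {σ : Store} {Q : Store → Prop} {k k' lim lim' : ℕ}
    {c : Cmd} (I A I' : Set ℕ) (d : ℕ) (g : ℕ → ℕ → ℝ)
    (hk : k ∈ I) (hkk : k' ∈ I) (h2 : 2 ∉ I) (h3 : 3 ∉ I) (hl : lim' ∉ I) (hne : k ≠ k')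
    (hI : I' ⊆ I) (hk' : k ∉ I') (hkk' : k' ∉ I')
    (z : σ.idx 2 = 0) (o : σ.idx 3 = 1) (hL : σ.idx lim ≤ L) (hL' : σ.idx lim' ≤ L)
    (hb : ∀ v w σ₁, v < σ.idx lim → w < σ.idx lim' → Fr I A σ σ₁ → σ₁.idx k = v →
      σ₁.idx k' = w → σ₁.arr d v w = σ.arr d v w →
      Runs F L c σ₁ fun σ₂ => Fr I' A σ₁ σ₂ ∧
        ∀ r l, σ₂.arr d r l = if r = v ∧ l = w then g v w else σ₁.arr d r l)
    (hQ : ∀ σ', Fr I A σ σ' → (∀ r l, σ'.arr d r l =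
      if r < σ.idx lim ∧ l < σ.idx lim' then g r l else σ.arr d r l) → Q σ') :
    Runs F L (.for k lim (.for k' lim' c)) σ Q := by
  refine runs_for I A (I \ {k}) (fun v σ₁ => ∀ r l, σ₁.arr d r l =
      if v ≤ r ∧ r < σ.idx lim ∧ l < σ.idx lim' then g r l else σ.arr d r l)
      hk h3 Set.sdiff_subset (by simp) z o hL (fun _ _ _ h => h) ?_ ?_ ?_
  · intro r l
    rw [if_neg (by omega)]
  · intro v σ₁ hv hF hkv hInv
    have e' : σ₁.idx lim' = σ.idx lim' := hF.idx _ hl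
    refine runs_for (I \ {k}) A I' (fun w σ₂ => ∀ r l, σ₂.arr d r l =
      if r = v ∧ w ≤ l ∧ l < σ.idx lim' then g r l else σ₁.arr d r l)
      ⟨hkk, fun h => hne h.symm⟩ (fun h => h3 h.1)
      (fun q hq => ⟨hI hq, fun h => hk' (h ▸ hq)⟩) hkk' ((hF.idx 2 h2).trans z)
      ((hF.idx 3 h3).trans o) (e' ▸ hL') (fun _ _ _ h => h) ?_ ?_ ?_
    · intro r l
      rw [if_neg (by omega)]
    · intro w σ₂ hw hF2 hkw hInv2
      rw [e'] at hw
      refine (hb v w σ₂ hv hw (hF.trans (hF2.mono Set.sdiff_subset subset_rfl))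
        ((hF2.idx k (by simp)).trans hkv) hkw ?_).mono ?_
      · rw [hInv2, if_neg (by omega), hInv, if_neg (by omega)]
      · rintro σ₃ ⟨hF3, h⟩
        refine ⟨hF3, fun r l => ?_⟩
        rw [h, hInv2]
        split_ifs with h1 h2 h3 h4 <;> first | rfl | (exfalso; omega) | skip
        rw [h1.1, h1.2]
    · intro σ' hF' h
      refine ⟨hF', fun r l => ?_⟩
      rw [h, hInv]
      split_ifs <;> first | rfl | (exfalso; omega)
  · intro σ' hF h
    refine hQ σ' hF fun r l => ?_
    rw [h]
    simp

/-- A loop that adds up the values of `g` in entry `(0, 0)` of array `d`. -/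
theorem runs_sum {F : ℕ → ℝ → ℝ} {L : ℕ} {σ : Store} {Q : Store → Prop} {k lim : ℕ} {c : Cmd}
    (I A I' : Set ℕ) (d : ℕ) (g : ℕ → ℝ)
    (hk : k ∈ I) (h3 : 3 ∉ I) (hI : I' ⊆ I) (hk' : k ∉ I')
    (hd : d ∈ A)
    (z : σ.idx 2 = 0) (o : σ.idx 3 = 1) (hL : σ.idx lim ≤ L)
    (hb : ∀ v σ₁, v < σ.idx lim → Fr I A σ σ₁ → σ₁.idx k = v →
      Runs F L c σ₁ fun σ₂ => Fr I' A σ₁ σ₂ ∧ σ₂.arr d 0 0 = σ₁.arr d 0 0 + g v)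
    (hQ : ∀ σ', Fr I A σ σ' → σ'.arr d 0 0 = ∑ v ∈ Finset.range (σ.idx lim), g v → Q σ') :
    Runs F L (.seq (.realLit ⟨d, 2, 2⟩ 0) (.for k lim c)) σ Q := by
  refine runs_seq (runs_realLit ?_)
  have hF0 : Fr I A σ (σ.set ⟨d, 2, 2⟩ (0 : ℕ)) := Fr.refl.set hd
  -- The summands arrive from the top index downwards, so the partial sums run over `Ico v lim`.
  refine runs_for I A I' (fun v σ₁ => σ₁.arr d 0 0 = ∑ w ∈ Finset.Ico v (σ.idx lim), g w)
    hk h3 hI hk' z o hL (fun _ _ _ h => h) ?_ ?_ ?_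
  · simp [z]
  · intro v σ₁ hv hF hkv hInv
    refine (hb v σ₁ hv (hF0.trans hF) hkv).mono ?_
    rintro σ₂ ⟨hF2, h⟩
    refine ⟨hF2, ?_⟩
    have hv' : v < σ.idx lim := hv
    rw [h, hInv, Finset.sum_eq_sum_Ico_succ_bot hv', add_comm]
  · intro σ' hF h
    exact hQ σ' (hF0.trans hF) (by rw [h, Finset.range_eq_Ico])

end

section

/-! ### Feasibility of the linear program -/

namespace Instance

variable {m n : ℕ} (I : Instance m n)

theorem effSpeed_nonneg (p : ℝ) (S : Finset (Fin m)) (j : Fin n) : 0 ≤ I.effSpeed p S j :=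
  Real.rpow_nonneg (Finset.sum_nonneg fun _ _ => Real.rpow_nonneg (Nat.cast_nonneg _) _) _

theorem procTime_nonneg (p : ℝ) (S : Finset (Fin m)) (j : Fin n) : 0 ≤ I.procTime p S j :=
  I.time_nonneg _ _ (I.effSpeed_nonneg p S j)

theorem effSpeed_rpow {p : ℝ} (hp : 1 ≤ p) (S : Finset (Fin m)) (j : Fin n) :
    I.effSpeed p S j ^ p = ∑ i ∈ S, (I.speed i j : ℝ) ^ p := by
  rw [effSpeed, ← Real.rpow_mul (Finset.sum_nonneg fun _ _ => Real.rpow_nonneg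
    (Nat.cast_nonneg _) _), one_div_mul_cancel (by positivity), Real.rpow_one]

theorem speed_le_effSpeed {p : ℝ} (hp : 1 ≤ p) {S : Finset (Fin m)} {i : Fin m} (hi : i ∈ S)
    (j : Fin n) : (I.speed i j : ℝ) ≤ I.effSpeed p S j := by
  rw [← Real.rpow_le_rpow_iff (Nat.cast_nonneg _) (I.effSpeed_nonneg p S j)
    (zero_lt_one.trans_le hp), I.effSpeed_rpow hp]
  exact Finset.single_le_sum (f := fun i => (I.speed i j : ℝ) ^ p)
    (fun _ _ => Real.rpow_nonneg (Nat.cast_nonneg _) _) hi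

theorem effSpeed_singleton {p : ℝ} (hp : 1 ≤ p) (i : Fin m) (j : Fin n) :
    I.effSpeed p {i} j = I.speed i j := by
  rw [effSpeed, Finset.sum_singleton, ← Real.rpow_mul (Nat.cast_nonneg _),
    mul_one_div_cancel (by positivity), Real.rpow_one]

/-- As `q / r ≤ 1` and `p ≥ 1`, the power is at most `q / r`, and what remains is monotonicity of
the work. It is what bounds the load of a machine that receives the share `(s / σ)^p` of a job. -/
theorem mul_rpow_le {p : ℝ} (hp : 1 ≤ p) (j : Fin n) {q r : ℝ} (hq : 0 ≤ q) (hqr : q ≤ r)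
    (hr : 0 < r) : I.time j q * (q / r) ^ p ≤ I.time j r := by
  have h1 : (q / r) ^ p ≤ q / r :=
    Real.rpow_le_self_of_le_one (by positivity) ((div_le_one hr).2 hqr) hp
  have h2 : I.time j q * q ≤ I.time j r * r := I.work_monotone j hq hr.le hqr
  calc I.time j q * (q / r) ^ p ≤ I.time j q * (q / r) :=
        mul_le_mul_of_nonneg_left h1 (I.time_nonneg j q hq)
    _ = I.time j q * q / r := by ring
    _ ≤ I.time j r := (div_le_iff₀ hr).2 h2

end Instance

variable {m n : ℕ}

/-- The jobs on one machine occupy disjoint intervals inside `[0, makespan)`, so their lengths add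
up to at most its Lebesgue measure. Half-open intervals make back-to-back jobs disjoint. -/
theorem Schedule.IsFeasible.load_le_makespan {S : Schedule m n} {I : Instance m n} {p : ℝ}
    (h : S.IsFeasible I p) (i : Fin m) :
    ∑ j with i ∈ S.machines j, I.procTime p (S.machines j) j ≤ S.makespan I p := by
  have hle : ∀ j, S.completion I p j ≤ S.makespan I p := fun j =>
    le_ciSup (f := fun j => S.completion I p j) (Set.finite_range _).bddAbove j
  have hnn : 0 ≤ S.makespan I p := Real.iSup_nonneg fun j =>
    add_nonneg (h.start_nonneg j) (I.procTime_nonneg p _ j)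
  have hd : Set.PairwiseDisjoint
      (↑(Finset.univ.filter fun j => i ∈ S.machines j) : Set (Fin n))
      (fun j => Set.Ico (S.start j) (S.completion I p j)) := by
    intro j hj k hk hjk
    simp only [Finset.coe_filter, Finset.mem_univ, true_and, Set.mem_ofPred_eq] at hj hk
    refine Set.disjoint_left.2 fun t ht ht' => ?_
    rcases h.no_overlap j k hjk ⟨i, Finset.mem_inter.2 ⟨hj, hk⟩⟩ with h' | h'
    · exact absurd (ht.2.trans_le h') (not_lt.2 ht'.1)
    · exact absurd (ht'.2.trans_le h') (not_lt.2 ht.1)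
  have key := MeasureTheory.measure_biUnion_finset (μ := MeasureTheory.volume) hd
    (fun _ _ => measurableSet_Ico)
  have hsub : (⋃ j ∈ Finset.univ.filter fun j => i ∈ S.machines j,
      Set.Ico (S.start j) (S.completion I p j)) ⊆ Set.Ico 0 (S.makespan I p) := by
    intro t ht
    simp only [Set.mem_iUnion] at ht
    obtain ⟨j, -, ht⟩ := ht
    exact ⟨(h.start_nonneg j).trans ht.1, ht.2.trans_le (hle j)⟩
  have := MeasureTheory.measure_mono (μ := MeasureTheory.volume) hsub
  rw [key, Real.volume_Ico, sub_zero] at this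
  simp only [Real.volume_Ico, Schedule.completion, add_sub_cancel_left] at this
  rwa [← ENNReal.ofReal_sum_of_nonneg fun j _ => I.procTime_nonneg p _ j,
    ENNReal.ofReal_le_ofReal_iff hnn] at this

/-- All jobs one after the other on machine `0`. A feasible schedule is needed so that `opt` is the
infimum of a non-empty set and not the default value of `sInf ∅`. -/
theorem exists_isFeasible (I : Instance m n) (p : ℝ) (hm : 0 < m) :
    ∃ S : Schedule m n, S.IsFeasible I p := by
  let i₀ : Fin m := ⟨0, hm⟩
  let S : Schedule m n :=
    ⟨fun _ => {i₀}, fun j => ∑ k with k < j, I.procTime p {i₀} k⟩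
  have aux : ∀ j k, j < k → S.completion I p j ≤ S.start k := by
    intro j k hjk
    change ∑ l with l < j, I.procTime p {i₀} l + I.procTime p {i₀} j
      ≤ ∑ l with l < k, I.procTime p {i₀} l
    rw [add_comm, ← Finset.sum_insert (by simp)]
    refine Finset.sum_le_sum_of_subset_of_nonneg ?_ fun _ _ _ => I.procTime_nonneg p _ _
    intro l hl
    simp only [Finset.mem_insert, Finset.mem_filter, Finset.mem_univ, true_and] at hl ⊢
    rcases hl with rfl | hl
    · exact hjk
    · exact hl.trans hjk
  refine ⟨S, fun j => Finset.singleton_nonempty _,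
    fun j => (Finset.sum_nonneg fun k _ => I.procTime_nonneg p {i₀} k :
      0 ≤ ∑ k with k < j, I.procTime p {i₀} k), fun j k hjk _ => ?_⟩
  rcases lt_or_gt_of_ne hjk with h | h
  · exact Or.inl (aux j k h)
  · exact Or.inr (aux k j h)

/-- No optimal schedule is needed: loads depend on the assignment of machine sets only, and there
are finitely many of those, so an infimum over schedules still yields a good assignment. -/
theorem exists_assignment_load_le (I : Instance m n) {p C : ℝ} (hm : 0 < m) (hC : I.opt p ≤ C) :
    ∃ A : Fin n → Finset (Fin m), (∀ j, (A j).Nonempty) ∧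
      ∀ i, ∑ j with i ∈ A j, I.procTime p (A j) j ≤ C := by
  classical
  by_contra! hcon
  obtain ⟨S₀, hS₀⟩ := exists_isFeasible I p hm
  have hT : ∀ A : {A : Fin n → Finset (Fin m) // ∀ j, (A j).Nonempty},
      ∃ i, C < ∑ j with i ∈ A.1 j, I.procTime p (A.1 j) j := fun A => hcon A.1 A.2
  choose i hi using hT
  let g : {A : Fin n → Finset (Fin m) // ∀ j, (A j).Nonempty} → ℝ :=
    fun A => ∑ j with i A ∈ A.1 j, I.procTime p (A.1 j) j
  have : Nonempty {A : Fin n → Finset (Fin m) // ∀ j, (A j).Nonempty} :=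
    ⟨⟨S₀.machines, hS₀.machines_nonempty⟩⟩
  -- If every assignment overloads some machine, the smallest of the chosen overloads exceeds `C`
  -- and yet bounds every makespan from below, hence also `opt ≤ C`.
  obtain ⟨A, hA⟩ := Finite.exists_min g
  have : g A ≤ I.opt p := by
    refine le_csInf ⟨_, S₀, hS₀, rfl⟩ ?_
    rintro v ⟨S, hS, rfl⟩
    exact (hA ⟨S.machines, hS.machines_nonempty⟩).trans (hS.load_le_makespan _)
  exact absurd (this.trans hC) (not_le.2 (hi A))

theorem Instance.bddBelow_fastEnough (I : Instance m n) (Q : Set ℝ) (C : ℝ) (j : Fin n) :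
    BddBelow (I.fastEnough Q C j) := ⟨0, fun _ h => h.2.1⟩

theorem Instance.critSpeed_nonneg (I : Instance m n) (Q : Set ℝ) (C : ℝ) (j : Fin n) :
    0 ≤ I.critSpeed Q C j := Real.sInf_nonneg fun _ h => h.2.1

theorem exists_isLPSolution (I : Instance m n) {p C : ℝ} (hm : 0 < m) (hp : 1 ≤ p)
    (hC : I.opt p ≤ C) : ∃ x : Fin m → Fin n → ℝ, I.IsLPSolution realSpeeds p C x := by
  classical
  obtain ⟨A, hA, hload⟩ := exists_assignment_load_le I hm hC
  have hp0 : 0 < p := by linarith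
  have htime : ∀ j, I.time j (I.effSpeed p (A j) j) ≤ C := by
    intro j
    obtain ⟨i, hi⟩ := hA j
    refine le_trans ?_ (hload i)
    exact Finset.single_le_sum (f := fun j => I.procTime p (A j) j)
      (fun j _ => I.procTime_nonneg p _ j) (by simpa using hi)
  have hfast : ∀ j, I.effSpeed p (A j) j ∈ I.fastEnough realSpeeds C j := fun j =>
    ⟨I.effSpeed_nonneg p _ j, I.effSpeed_nonneg p _ j, htime j⟩
  have hcrit : ∀ j, I.critSpeed realSpeeds C j ≤ I.effSpeed p (A j) j := fun j =>
    csInf_le (I.bddBelow_fastEnough _ _ _) (hfast j)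
  choose i₀ hi₀ using hA
  -- The `p`-th powers of the speeds in `A j` sum to the `p`-th power of the effective speed, so the
  -- proportions sum to `1`. If the effective speed is `0`, they are undefined and one machine of `A
  -- j` gets the whole job; then that machine has speed `0` and the job is still in its plus set.
  let x : Fin m → Fin n → ℝ := fun i j =>
    if i ∈ A j then
      if I.effSpeed p (A j) j = 0 then (if i = i₀ j then 1 else 0)
      else (I.speed i j / I.effSpeed p (A j) j) ^ p
    else 0
  have hx0 : ∀ i j, 0 ≤ x i j := by
    intro i j
    have := I.effSpeed_nonneg p (A j) j
    simp only [x]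
    split_ifs <;> positivity
  have hzero : ∀ i j, i ∈ A j → I.effSpeed p (A j) j = 0 → (I.speed i j : ℝ) = 0 :=
    fun i j hi h => le_antisymm (h ▸ I.speed_le_effSpeed hp hi j) (Nat.cast_nonneg _)
  have hplus : ∀ i, ∀ j ∈ I.jobsPlus C i, I.time j (I.speed i j) * x i j ≤
      if i ∈ A j then I.procTime p (A j) j else 0 := by
    intro i j hj
    by_cases hi : i ∈ A j
    · rw [if_pos hi]
      by_cases h : I.effSpeed p (A j) j = 0
      · have hx : x i j ≤ 1 := by
          simp only [x, hi, h, if_true]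
          split_ifs <;> norm_num
        have hs := hzero i j hi h
        rw [Instance.procTime, h, hs]
        exact mul_le_of_le_one_right (I.time_nonneg j 0 le_rfl) hx
      · simp only [x, hi, h, if_true, if_false]
        exact I.mul_rpow_le hp j (Nat.cast_nonneg _) (I.speed_le_effSpeed hp hi j)
          (lt_of_le_of_ne (I.effSpeed_nonneg _ _ _) (Ne.symm h))
    · simp [x, hi]
  have hminus : ∀ i, ∀ j ∈ I.jobsMinus C i, I.time j (I.critSpeed realSpeeds C j) *
      (I.critSpeed realSpeeds C j / I.speed i j) ^ p * x i j ≤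
      if i ∈ A j then I.procTime p (A j) j else 0 := by
    intro i j hj
    by_cases hi : i ∈ A j
    · rw [if_pos hi]
      have hj' : ¬ I.time j (I.speed i j) ≤ C := by simpa [Instance.jobsMinus] using hj
      have h : I.effSpeed p (A j) j ≠ 0 := by
        intro h
        apply hj'
        rw [hzero i j hi h, ← h]
        exact htime j
      have hpos : 0 < I.effSpeed p (A j) j :=
        lt_of_le_of_ne (I.effSpeed_nonneg _ _ _) (Ne.symm h)
      have hc := I.critSpeed_nonneg realSpeeds C j
      refine le_trans ?_ (I.mul_rpow_le hp j hc (hcrit j) hpos)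
      simp only [x, hi, h, if_true, if_false]
      rw [mul_assoc, ← Real.mul_rpow (by positivity) (by positivity)]
      refine mul_le_mul_of_nonneg_left ?_ (I.time_nonneg j _ hc)
      -- For positive speed the factors combine, `(γ / s) (s / σ) = γ / σ`. For speed `0` division
      -- by zero gives `0` on the left.
      by_cases hs : (I.speed i j : ℝ) = 0
      · rw [hs]
        simp only [div_zero, zero_div, mul_zero, Real.zero_rpow hp0.ne']
        positivity
      · rw [div_mul_div_cancel₀ hs]
    · simp [x, hi]
  refine ⟨x, fun j => ⟨_, hfast j⟩, ?_, ?_, ?_, hx0⟩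
  · intro i j hj hs
    have hj' : ¬ I.time j (I.speed i j) ≤ C := by simpa [Instance.jobsMinus] using hj
    by_cases hi : i ∈ A j
    · have h : I.effSpeed p (A j) j ≠ 0 := by
        intro h
        apply hj'
        rw [hzero i j hi h, ← h]
        exact htime j
      simp [x, hi, h, hs, Real.zero_rpow hp0.ne']
    · simp [x, hi]
  · intro j
    by_cases h : I.effSpeed p (A j) j = 0
    · simp only [x, h, if_true, ← ite_and]
      rw [Finset.sum_eq_single (i₀ j)]
      · simp [hi₀]
      · intro i _ hi
        simp [hi]
      · simp
    · have : ∀ i, x i j = if i ∈ A j then (I.speed i j : ℝ) ^ p / I.effSpeed p (A j) j ^ p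
          else 0 := by
        intro i
        simp only [x, h, if_false]
        rw [Real.div_rpow (Nat.cast_nonneg _) (I.effSpeed_nonneg _ _ _)]
      simp only [this]
      rw [Finset.sum_ite_mem, Finset.univ_inter, ← Finset.sum_div, ← I.effSpeed_rpow hp, div_self]
      have hpos : 0 < I.effSpeed p (A j) j :=
        lt_of_le_of_ne (I.effSpeed_nonneg _ _ _) (Ne.symm h)
      positivity
  · intro i
    refine le_trans (add_le_add (Finset.sum_le_sum (hplus i)) (Finset.sum_le_sum (hminus i))) ?_
    rw [Instance.jobsPlus, Instance.jobsMinus, Finset.sum_filter_add_sum_filter_not,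
      ← Finset.sum_filter]
    exact hload i

end

section

variable {m n : ℕ}

/-! ### From a fractional assignment with a sparse support to a schedule -/

/-- `a i j` is the coefficient of the linear program with critical speeds `γ`, for a machine `i`
that may be used by job `j`. -/
def Instance.IsCoeff (I : Instance m n) (p C : ℝ) (γ : Fin n → ℝ) (i : Fin m) (j : Fin n) (a : ℝ) :
    Prop :=
  (I.time j (I.speed i j) ≤ C ∧ a = I.time j (I.speed i j)) ∨
    (0 < I.speed i j ∧ (I.speed i j : ℝ) ≤ γ j ∧ I.time j (γ j) ≤ C ∧
      a = I.time j (γ j) * (γ j / I.speed i j) ^ p)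

/-- On a slow machine monotone work gives `f(s) ≤ f(γ) γ / s`, and since `γ / s ≥ 1` its `p`-th
power is only larger. Thus a coefficient pays for running the job on that machine alone. -/
theorem Instance.IsCoeff.time_le {I : Instance m n} {p C : ℝ} (hp : 1 ≤ p) {γ : Fin n → ℝ}
    {i : Fin m} {j : Fin n} {a : ℝ} (h : I.IsCoeff p C γ i j a) : I.time j (I.speed i j) ≤ a := by
  rcases h with ⟨-, rfl⟩ | ⟨h0, h1, h2, rfl⟩
  · exact le_rfl
  · have hs : (0 : ℝ) < I.speed i j := by exact_mod_cast h0
    have hw : I.time j (I.speed i j) * I.speed i j ≤ I.time j (γ j) * γ j :=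
      I.work_monotone j hs.le (hs.le.trans h1) h1
    have h3 : γ j / I.speed i j ≤ (γ j / I.speed i j) ^ p :=
      Real.self_le_rpow_of_one_le ((one_le_div hs).2 h1) hp
    calc I.time j (I.speed i j) ≤ I.time j (γ j) * γ j / I.speed i j := (le_div_iff₀ hs).2 hw
      _ = I.time j (γ j) * (γ j / I.speed i j) := by ring
      _ ≤ _ := mul_le_mul_of_nonneg_left h3 (I.time_nonneg j _ (hs.le.trans h1))

/-- A set of machines that holds a fraction `1 - β` of a job, none of them with a load above `C`,
processes the job quickly. -/
theorem Instance.procTime_le_of_isCoeff {I : Instance m n} {p C β : ℝ} (hp : 1 ≤ p) (hβ : 0 < β)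
    (hβ1 : β < 1) (hC : 0 ≤ C) {γ : Fin n → ℝ} {j : Fin n} {S : Finset (Fin m)} (hS : S.Nonempty)
    {a y : Fin m → ℝ} (ha : ∀ i ∈ S, I.IsCoeff p C γ i j (a i))
    (hload : ∀ i ∈ S, a i * y i ≤ C) (hy : 1 - β ≤ ∑ i ∈ S, y i) :
    I.procTime p S j ≤ C / (1 - β) ^ (1 / p) := by
  have hp0 : 0 < p := by linarith
  have hb : 0 < 1 - β := by linarith
  have hbp : 0 < (1 - β) ^ (1 / p) := Real.rpow_pos_of_pos hb _
  have hCle : C ≤ C / (1 - β) ^ (1 / p) := by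
    rw [le_div_iff₀ hbp]
    exact mul_le_of_le_one_right hC (Real.rpow_le_one hb.le (by linarith) (by positivity))
  have hnn := I.effSpeed_nonneg p S j
  by_cases hex : ∃ i ∈ S, I.time j (I.speed i j) ≤ C
  · obtain ⟨i, hi, h⟩ := hex
    refine le_trans (le_trans ?_ h) hCle
    exact I.time_antitone j (Nat.cast_nonneg (α := ℝ) _) hnn (I.speed_le_effSpeed hp hi j)
  · push Not at hex
    have hm : ∀ i ∈ S, 0 < I.speed i j ∧ (I.speed i j : ℝ) ≤ γ j ∧ I.time j (γ j) ≤ C ∧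
        a i = I.time j (γ j) * (γ j / I.speed i j) ^ p := by
      intro i hi
      rcases ha i hi with h | h
      · exact absurd h.1 (not_le.2 (hex i hi))
      · exact h
    obtain ⟨i₀, hi₀⟩ := hS
    obtain ⟨h0, h1, h2, -⟩ := hm i₀ hi₀
    have hs0 : (0 : ℝ) < I.speed i₀ j := by exact_mod_cast h0
    have hγ : 0 < γ j := hs0.trans_le h1
    have hσ : 0 < I.effSpeed p S j := hs0.trans_le (I.speed_le_effSpeed hp hi₀ j)
    have hf := I.time_nonneg j _ hγ.le
    set f := I.time j (γ j)
    set σ := I.effSpeed p S j with hσd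
    have hg : 0 ≤ I.time j σ := I.time_nonneg j _ hnn
    rw [Instance.procTime, ← hσd]
    rcases le_total (γ j) σ with hle | hle
    · exact ((I.time_antitone j hγ.le hnn hle).trans h2).trans hCle
    have hw : I.time j σ * σ ≤ f * γ j := I.work_monotone j hnn hγ.le hle
    -- The main computation cancels `f`; if `f = 0`, monotone work already gives processing time `0`
    -- at `σ`.
    rcases hf.eq_or_lt with hf0 | hf0
    · rw [← hf0, zero_mul] at hw
      exact (nonpos_of_mul_nonpos_left hw hσ).trans (hC.trans hCle)
    have hsum : f * γ j ^ p * (1 - β) ≤ C * σ ^ p := by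
      calc f * γ j ^ p * (1 - β) ≤ f * γ j ^ p * ∑ i ∈ S, y i :=
            mul_le_mul_of_nonneg_left hy (by positivity)
        _ = ∑ i ∈ S, f * γ j ^ p * y i := Finset.mul_sum _ _ _
        _ ≤ ∑ i ∈ S, C * (I.speed i j : ℝ) ^ p := by
            refine Finset.sum_le_sum fun i hi => ?_
            obtain ⟨k0, k1, k2, k3⟩ := hm i hi
            have hs : (0 : ℝ) < I.speed i j := by exact_mod_cast k0
            have hl := hload i hi
            rw [k3, Real.div_rpow hγ.le hs.le] at hl
            have hsp : 0 < (I.speed i j : ℝ) ^ p := Real.rpow_pos_of_pos hs _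
            calc f * γ j ^ p * y i
                = f * (γ j ^ p / (I.speed i j : ℝ) ^ p) * y i * (I.speed i j : ℝ) ^ p := by
                  field_simp
              _ ≤ _ := mul_le_mul_of_nonneg_right hl hsp.le
        _ = C * σ ^ p := by rw [← Finset.mul_sum, hσd, I.effSpeed_rpow hp]
    have hwp : I.time j σ ^ p * σ ^ p ≤ f ^ p * γ j ^ p := by
      rw [← Real.mul_rpow hg hnn, ← Real.mul_rpow hf hγ.le]
      exact Real.rpow_le_rpow (by positivity) hw hp0.le
    have hγp : 0 < γ j ^ p := Real.rpow_pos_of_pos hγ _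
    have hfp : f ^ p ≤ f * C ^ (p - 1) := by
      have : f ^ p = f * f ^ (p - 1) := by
        rw [Real.rpow_sub_one hf0.ne']
        field_simp
      rw [this]
      exact mul_le_mul_of_nonneg_left (Real.rpow_le_rpow hf h2 (by linarith)) hf
    have hCpos : 0 < C := hf0.trans_le h2
    have hCp : C * C ^ (p - 1) = C ^ p := by
      rw [Real.rpow_sub_one hCpos.ne']
      field_simp
    have hfin : I.time j σ ^ p * (1 - β) ≤ C ^ p := by
      -- After multiplication by `f γ^p`, the summed loads trade `f γ^p (1 - β)` for `C σ^p`,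
      -- monotone work trades `f(σ)^p σ^p` for `f^p γ^p`, and `f ≤ C` trades `f^(p-1)` for
      -- `C^(p-1)`.
      have h3 : (I.time j σ ^ p * (1 - β)) * (f * γ j ^ p) ≤ C ^ p * (f * γ j ^ p) := by
        calc (I.time j σ ^ p * (1 - β)) * (f * γ j ^ p)
            = I.time j σ ^ p * (f * γ j ^ p * (1 - β)) := by ring
          _ ≤ I.time j σ ^ p * (C * σ ^ p) :=
            mul_le_mul_of_nonneg_left hsum (Real.rpow_nonneg hg _)
          _ = C * (I.time j σ ^ p * σ ^ p) := by ring
          _ ≤ C * (f ^ p * γ j ^ p) := mul_le_mul_of_nonneg_left hwp hC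
          _ ≤ C * (f * C ^ (p - 1) * γ j ^ p) := by gcongr
          _ = C ^ p * (f * γ j ^ p) := by rw [← hCp]; ring
      exact le_of_mul_le_mul_right h3 (by positivity)
    rw [le_div_iff₀ hbp, ← Real.rpow_le_rpow_iff (by positivity) hC hp0,
      Real.mul_rpow hg hbp.le, ← Real.rpow_mul hb.le, one_div_mul_cancel hp0.ne', Real.rpow_one]
    exact hfin

open Classical in
/-- Rounding: job `j` runs on the machine `i` with `sgl i j` if there is one, and otherwise on all
machines `i` with `asg i j`. -/
theorem schedule_of_rounding {I : Instance m n} {p C β : ℝ} (hp : 1 ≤ p) (hβ : 0 < β)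
    (hβ1 : β < 1) (hC : 0 ≤ C) {γ : Fin n → ℝ} {a y : Fin m → Fin n → ℝ}
    (hy0 : ∀ i j, 0 ≤ y i j) (ha0 : ∀ i j, 0 ≤ a i j)
    (hcoeff : ∀ i j, 0 < y i j → I.IsCoeff p C γ i j (a i j))
    (hassign : ∀ j, ∑ i, y i j = 1) (hload : ∀ i, ∑ j, a i j * y i j ≤ C)
    {sgl asg : Fin m → Fin n → Prop}
    (hsgl : ∀ i j, sgl i j → β ≤ y i j)
    (hsgl2 : ∀ i j, β ≤ y i j → ∃ i', sgl i' j)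
    (hasg : ∀ i j, asg i j → 0 < y i j)
    (hasg1 : ∀ i j j', asg i j → asg i j' → j = j')
    (hasg2 : ∀ i i' j, 0 < y i j → ¬ asg i j → 0 < y i' j → ¬ asg i' j → i = i')
    {S : Schedule m n}
    (hS1 : ∀ i j, sgl i j → S.machines j = {i} ∧
      S.start j = C / (1 - β) ^ (1 / p) + ∑ k with j < k ∧ sgl i k, a i k)
    (hS2 : ∀ j, (∀ i, ¬ sgl i j) → (∀ i, i ∈ S.machines j ↔ asg i j) ∧ S.start j = 0) :
    S.IsFeasible I p ∧ S.makespan I p ≤ (1 / β + 1 / (1 - β) ^ (1 / p)) * C := by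
  have hb : 0 < 1 - β := by linarith
  have hbp : 0 < (1 - β) ^ (1 / p) := Real.rpow_pos_of_pos hb _
  set D := C / (1 - β) ^ (1 / p) with hD
  have hD0 : 0 ≤ D := by positivity
  have hmulti : ∀ j, (∀ i, ¬ sgl i j) →
      (S.machines j).Nonempty ∧ S.completion I p j ≤ D := by
    intro j hj
    obtain ⟨hmem, hst⟩ := hS2 j hj
    have hlt : ∀ i, y i j < β := by
      intro i
      by_contra! h
      obtain ⟨i', h'⟩ := hsgl2 i j h
      exact hj i' h'
    have hsum : 1 - β ≤ ∑ i ∈ S.machines j, y i j := by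
      -- Outside the chosen machines at most one fraction is positive, by `hasg2`, and it is below
      -- `β` because the job has no selected machine.
      have hrest : ∑ i ∈ (S.machines j)ᶜ, y i j ≤ β := by
        by_cases hex : ∃ i, 0 < y i j ∧ ¬ asg i j
        · obtain ⟨i, hi, hi'⟩ := hex
          rw [Finset.sum_eq_single i]
          · exact (hlt i).le
          · intro i' hi1 hne
            by_contra hne0
            exact hne (hasg2 i' i j (lt_of_le_of_ne (hy0 _ _) (Ne.symm hne0))
              (fun h => (Finset.mem_compl.1 hi1) ((hmem i').2 h)) hi hi')
          · intro h
            exact absurd (Finset.mem_compl.2 fun h' => hi' ((hmem i).1 h')) h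
        · push Not at hex
          rw [Finset.sum_eq_zero]
          · exact hβ.le
          · intro i hi
            by_contra hne0
            exact (Finset.mem_compl.1 hi) ((hmem i).2 (hex i (lt_of_le_of_ne (hy0 _ _)
              (Ne.symm hne0))))
      have := Finset.sum_add_sum_compl (S.machines j) fun i => y i j
      rw [hassign] at this
      linarith
    have hne : (S.machines j).Nonempty := by
      by_contra h
      rw [Finset.not_nonempty_iff_eq_empty] at h
      rw [h, Finset.sum_empty] at hsum
      linarith
    refine ⟨hne, ?_⟩
    rw [Schedule.completion, hst, zero_add]
    refine I.procTime_le_of_isCoeff hp hβ hβ1 hC hne (a := fun i => a i j) (y := fun i => y i j)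
      (γ := γ) ?_ ?_ hsum
    · intro i hi
      exact hcoeff i j (hasg i j ((hmem i).1 hi))
    · intro i _
      exact (Finset.single_le_sum (f := fun j => a i j * y i j)
        (fun j _ => mul_nonneg (ha0 i j) (hy0 i j)) (Finset.mem_univ j)).trans (hload i)
  have htime : ∀ i j, sgl i j → I.procTime p (S.machines j) j ≤ a i j := by
    intro i j h
    rw [(hS1 i j h).1, Instance.procTime, I.effSpeed_singleton hp]
    exact (hcoeff i j (hβ.trans_le (hsgl i j h))).time_le hp
  have hcompl : ∀ i j, sgl i j →
      S.completion I p j ≤ D + ∑ k with j ≤ k ∧ sgl i k, a i k := by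
    intro i j h
    have : (Finset.univ.filter fun k => j ≤ k ∧ sgl i k) =
        insert j (Finset.univ.filter fun k => j < k ∧ sgl i k) := by
      ext k
      simp only [Finset.mem_filter, Finset.mem_univ, true_and, Finset.mem_insert]
      constructor
      · rintro ⟨h1, h2⟩
        rcases h1.eq_or_lt with h3 | h3
        · exact Or.inl h3.symm
        · exact Or.inr ⟨h3, h2⟩
      · rintro (rfl | ⟨h1, h2⟩)
        · exact ⟨le_rfl, h⟩
        · exact ⟨h1.le, h2⟩
    rw [this, Finset.sum_insert (by simp), Schedule.completion, (hS1 i j h).2]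
    linarith [htime i j h]
  have hstart : ∀ i j, sgl i j → D ≤ S.start j := by
    intro i j h
    rw [(hS1 i j h).2]
    have : 0 ≤ ∑ k with j < k ∧ sgl i k, a i k := Finset.sum_nonneg fun k _ => ha0 i k
    linarith
  -- On each machine the selected jobs run in decreasing order of their numbers, as prescribed by
  -- `hS1`.
  have horder : ∀ i j k, sgl i j → sgl i k → j < k → S.completion I p k ≤ S.start j := by
    intro i j k hj hk hjk
    refine (hcompl i k hk).trans ?_
    rw [(hS1 i j hj).2]
    refine add_le_add le_rfl (Finset.sum_le_sum_of_subset_of_nonneg ?_ fun _ _ _ => ha0 _ _)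
    intro l hl
    simp only [Finset.mem_filter, Finset.mem_univ, true_and] at hl ⊢
    exact ⟨hjk.trans_le hl.1, hl.2⟩
  have htotal : ∀ i, ∑ k with sgl i k, a i k ≤ C / β := by
    intro i
    rw [le_div_iff₀ hβ, Finset.sum_mul]
    refine le_trans ?_ (hload i)
    calc ∑ k with sgl i k, a i k * β ≤ ∑ k with sgl i k, a i k * y i k := by
          refine Finset.sum_le_sum fun k hk => ?_
          exact mul_le_mul_of_nonneg_left (hsgl i k (Finset.mem_filter.1 hk).2) (ha0 i k)
      _ ≤ _ := Finset.sum_le_sum_of_subset_of_nonneg (Finset.subset_univ _)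
          fun k _ _ => mul_nonneg (ha0 i k) (hy0 i k)
  refine ⟨⟨?_, ?_, ?_⟩, ?_⟩
  · intro j
    by_cases h : ∃ i, sgl i j
    · obtain ⟨i, hi⟩ := h
      rw [(hS1 i j hi).1]
      exact Finset.singleton_nonempty i
    · push Not at h
      exact (hmulti j h).1
  · intro j
    by_cases h : ∃ i, sgl i j
    · obtain ⟨i, hi⟩ := h
      exact hD0.trans (hstart i j hi)
    · push Not at h
      exact (hS2 j h).2.ge
  · rintro j k hjk ⟨i, hi⟩
    rw [Finset.mem_inter] at hi
    by_cases hj : ∃ i, sgl i j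
    · obtain ⟨i₁, hj⟩ := hj
      by_cases hk : ∃ i, sgl i k
      · obtain ⟨i₂, hk⟩ := hk
        rw [(hS1 i₁ j hj).1, (hS1 i₂ k hk).1, Finset.mem_singleton, Finset.mem_singleton] at hi
        obtain ⟨rfl, rfl⟩ := hi
        rcases lt_or_gt_of_ne hjk with h | h
        · exact Or.inr (horder _ _ _ hj hk h)
        · exact Or.inl (horder _ _ _ hk hj h)
      · push Not at hk
        exact Or.inr ((hmulti k hk).2.trans (hstart i₁ j hj))
    · push Not at hj
      by_cases hk : ∃ i, sgl i k
      · obtain ⟨i₂, hk⟩ := hk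
        exact Or.inl ((hmulti j hj).2.trans (hstart i₂ k hk))
      · push Not at hk
        -- Two jobs without a selected machine cannot meet: a machine is assigned at most one edge.
        exact absurd (hasg1 i j k (((hS2 j hj).1 i).1 hi.1) (((hS2 k hk).1 i).1 hi.2)) hjk
  · have e : (1 / β + 1 / (1 - β) ^ (1 / p)) * C = D + C / β := by
      rw [hD]
      ring
    rw [e]
    have hCb : 0 ≤ C / β := by positivity
    refine Real.iSup_le (fun j => ?_) (by positivity)
    by_cases h : ∃ i, sgl i j
    · obtain ⟨i, hi⟩ := h
      refine (hcompl i j hi).trans (add_le_add le_rfl (le_trans ?_ (htotal i)))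
      refine Finset.sum_le_sum_of_subset_of_nonneg ?_ fun _ _ _ => ha0 _ _
      intro l hl
      simp only [Finset.mem_filter, Finset.mem_univ, true_and] at hl ⊢
      exact hl.2
    · push Not at h
      linarith [(hmulti j h).2]

end

section

variable {m n : ℕ}

/-! ### The coefficients of the linear program -/

open Classical in
/-- The coefficient of the linear program with critical speeds `γ`. -/
def Instance.weight (I : Instance m n) (p C : ℝ) (γ : Fin n → ℝ) (i : Fin m) (j : Fin n) : ℝ :=
  if I.time j (I.speed i j) ≤ C then I.time j (I.speed i j)
  else I.time j (γ j) * (γ j / I.speed i j) ^ p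

/-- What the rounding algorithm needs to know about `x`. -/
structure Instance.IsFractional (I : Instance m n) (p C : ℝ) (γ : Fin n → ℝ)
    (x : Fin m → Fin n → ℝ) : Prop where
  speed_nonneg : ∀ j, 0 ≤ γ j
  coeff : ∀ i j, 0 < x i j → I.IsCoeff p C γ i j (I.weight p C γ i j)
  assign : ∀ j, ∑ i, x i j = 1
  load : ∀ i, ∑ j, I.weight p C γ i j * x i j ≤ C
  nonneg : ∀ i j, 0 ≤ x i j

theorem Instance.weight_nonneg (I : Instance m n) {p C : ℝ} {γ : Fin n → ℝ} (hγ : ∀ j, 0 ≤ γ j)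
    (i : Fin m) (j : Fin n) : 0 ≤ I.weight p C γ i j := by
  have h1 := I.time_nonneg j _ (Nat.cast_nonneg (α := ℝ) (I.speed i j))
  have h2 := I.time_nonneg j _ (hγ j)
  have h3 := hγ j
  rw [Instance.weight]
  split_ifs <;> positivity

theorem Instance.IsFractional.target_nonneg {I : Instance m n} {p C : ℝ} {γ : Fin n → ℝ}
    {x : Fin m → Fin n → ℝ} (h : I.IsFractional p C γ x) (hm : 0 < m) : 0 ≤ C :=
  (Finset.sum_nonneg fun j _ => mul_nonneg (I.weight_nonneg h.speed_nonneg _ j)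
    (h.nonneg _ j)).trans (h.load ⟨0, hm⟩)

/-- The set of candidate speeds enters only through `hcrit`: the critical speed must itself meet the
target and dominate the speed of every machine that is too slow. The two choices of `Q` are then
treated by checking this. -/
theorem Instance.IsLPSolution.isFractional_of {I : Instance m n} {Q : Set ℝ} {p C : ℝ}
    {x : Fin m → Fin n → ℝ} (h : I.IsLPSolution Q p C x)
    (hcrit : ∀ i j, 0 < I.speed i j → ¬ I.time j (I.speed i j) ≤ C →
      (I.speed i j : ℝ) ≤ I.critSpeed Q C j ∧ I.time j (I.critSpeed Q C j) ≤ C) :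
    I.IsFractional p C (I.critSpeed Q C) x := by
  refine ⟨I.critSpeed_nonneg Q C, ?_, h.assign, ?_, h.nonneg⟩
  · intro i j hx
    rw [Instance.weight]
    split_ifs with hle
    · exact Or.inl ⟨hle, rfl⟩
    · have hs : 0 < I.speed i j := by
        rw [Nat.pos_iff_ne_zero]
        intro h0
        exact hx.ne' (h.zero_speed i j (by simpa [Instance.jobsMinus] using hle) h0)
      exact Or.inr ⟨hs, (hcrit i j hs hle).1, (hcrit i j hs hle).2, rfl⟩
  · intro i
    refine le_trans (le_of_eq ?_) (h.load i)
    rw [← Finset.sum_filter_add_sum_filter_not Finset.univ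
      (fun j => I.time j (I.speed i j) ≤ C), Instance.jobsPlus, Instance.jobsMinus]
    congr 1
    · refine Finset.sum_congr rfl fun j hj => ?_
      rw [Instance.weight, if_pos (Finset.mem_filter.1 hj).2]
    · refine Finset.sum_congr rfl fun j hj => ?_
      rw [Instance.weight, if_neg (Finset.mem_filter.1 hj).2]

theorem Instance.speed_le_of_mem_fastEnough {I : Instance m n} {Q : Set ℝ} {C : ℝ} {i : Fin m}
    {j : Fin n} (h : ¬ I.time j (I.speed i j) ≤ C) {q : ℝ} (hq : q ∈ I.fastEnough Q C j) :
    (I.speed i j : ℝ) ≤ q := by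
  by_contra! hlt
  exact h ((I.time_antitone j hq.2.1 (Nat.cast_nonneg (α := ℝ) _) hlt.le).trans hq.2.2)

/-- The point is that the infimum `γ` meets the target, although continuity is not assumed. If `f(γ)
> C`, then every fast enough `q` has `f(γ) γ ≤ f(q) q ≤ C q`, so `q ≥ f(γ) γ / C > γ`, against the
choice of `γ`. Only `γ > 0` matters, and this holds because `γ` is at least a positive speed. -/
theorem Instance.IsLPSolution.isFractional_real {I : Instance m n} {p C : ℝ}
    {x : Fin m → Fin n → ℝ} (h : I.IsLPSolution realSpeeds p C x) (hC : 0 ≤ C) :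
    I.IsFractional p C (I.critSpeed realSpeeds C) x := by
  refine h.isFractional_of fun i j hs hle => ?_
  have h1 : (I.speed i j : ℝ) ≤ I.critSpeed realSpeeds C j :=
    le_csInf (h.critical j) fun q hq => I.speed_le_of_mem_fastEnough hle hq
  have hpos : 0 < I.critSpeed realSpeeds C j := lt_of_lt_of_le (by exact_mod_cast hs) h1
  refine ⟨h1, ?_⟩
  set γ := I.critSpeed realSpeeds C j
  by_contra! hlt
  have hf : 0 < I.time j γ := hC.trans_lt hlt
  have h2 : ∀ q ∈ I.fastEnough realSpeeds C j, I.time j γ * γ / I.time j γ ≤ q ∧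
      I.time j γ * γ ≤ C * q := by
    intro q hq
    have hγq : γ ≤ q := csInf_le (I.bddBelow_fastEnough _ _ _) hq
    have h3 : I.time j γ * γ ≤ I.time j q * q :=
      I.work_monotone j hpos.le (hpos.le.trans hγq) hγq
    refine ⟨by rwa [mul_div_cancel_left₀ _ hf.ne'], h3.trans ?_⟩
    exact mul_le_mul_of_nonneg_right hq.2.2 (hpos.le.trans hγq)
  obtain ⟨q₀, hq₀⟩ := h.critical j
  -- For `C = 0` the same inequality would make `f(γ) γ` non-positive.
  have hCpos : 0 < C := by
    rcases hC.eq_or_lt with h0 | h0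
    · have := (h2 q₀ hq₀).2
      rw [← h0, zero_mul] at this
      exact absurd this (not_le.2 (by positivity))
    · exact h0
  have h4 : I.time j γ * γ / C ≤ γ :=
    le_csInf (h.critical j) fun q hq => (div_le_iff₀' hCpos).2 (h2 q hq).2
  rw [div_le_iff₀ hCpos, mul_comm] at h4
  exact absurd (le_of_mul_le_mul_left h4 hpos) (not_le.2 hlt)

/-- By monotonicity it suffices that the predecessor of `g` is too slow. Writing the predecessor as
`k + 1 = g` makes the condition vacuous at `g = 0`. -/
theorem Instance.critSpeed_integral_eq {I : Instance m n} {C : ℝ} {j : Fin n} {g : ℕ}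
    (h1 : I.time j g ≤ C) (h2 : ∀ k : ℕ, k + 1 = g → ¬ I.time j k ≤ C) :
    I.critSpeed integralSpeeds C j = g := by
  refine IsLeast.csInf_eq ⟨⟨⟨g, rfl⟩, Nat.cast_nonneg _, h1⟩, ?_⟩
  rintro _ ⟨⟨k, rfl⟩, -, hk⟩
  by_contra! hlt
  have hlt' : k < g := by exact_mod_cast hlt
  obtain ⟨l, rfl⟩ : ∃ l, g = l + 1 := ⟨g - 1, by omega⟩
  refine h2 l rfl ((I.time_antitone j (Nat.cast_nonneg (α := ℝ) _) (Nat.cast_nonneg (α := ℝ) _)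
    ?_).trans hk)
  exact_mod_cast Nat.lt_succ_iff.1 hlt'

theorem Instance.IsLPSolution.exists_critSpeed_eq {I : Instance m n} {p C : ℝ}
    {x : Fin m → Fin n → ℝ} (h : I.IsLPSolution integralSpeeds p C x) (j : Fin n) :
    ∃ g : ℕ, I.critSpeed integralSpeeds C j = g ∧ I.time j g ≤ C ∧
      ∀ k : ℕ, k + 1 = g → ¬ I.time j k ≤ C := by
  classical
  have hex : ∃ g : ℕ, I.time j g ≤ C := by
    obtain ⟨_, ⟨g, rfl⟩, -, hg⟩ := h.critical j
    exact ⟨g, hg⟩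
  have h2 : ∀ k : ℕ, k + 1 = Nat.find hex → ¬ I.time j k ≤ C := fun k hk =>
    Nat.find_min hex (by omega)
  exact ⟨_, I.critSpeed_integral_eq (Nat.find_spec hex) h2, Nat.find_spec hex, h2⟩

theorem Instance.IsLPSolution.isFractional_integral {I : Instance m n} {p C : ℝ}
    {x : Fin m → Fin n → ℝ} (h : I.IsLPSolution integralSpeeds p C x) :
    I.IsFractional p C (I.critSpeed integralSpeeds C) x := by
  refine h.isFractional_of fun i j _ hle => ?_
  refine ⟨le_csInf (h.critical j) fun q hq => I.speed_le_of_mem_fastEnough hle hq, ?_⟩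
  obtain ⟨g, hg, h1, -⟩ := h.exists_critSpeed_eq j
  rwa [hg]

theorem Instance.speed_lt_two_pow (I : Instance m n) (i : Fin m) (j : Fin n) :
    m * I.speed i j < 2 ^ I.size ∧ I.speed i j < 2 ^ I.size := by
  have h1 : m + Nat.size (I.speed i j) ≤ I.size := by
    have h2 : Nat.size (I.speed i j) ≤ ∑ j, Nat.size (I.speed i j) :=
      Finset.single_le_sum (f := fun j => Nat.size (I.speed i j)) (fun _ _ => Nat.zero_le _)
        (Finset.mem_univ j)
    have h3 : ∑ j, Nat.size (I.speed i j) ≤ ∑ i, ∑ j, Nat.size (I.speed i j) :=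
      Finset.single_le_sum (f := fun i => ∑ j, Nat.size (I.speed i j)) (fun _ _ => Nat.zero_le _)
        (Finset.mem_univ i)
    rw [Instance.size]
    omega
  have h2 := Nat.lt_size_self (I.speed i j)
  have h3 : m ≤ 2 ^ m := Nat.lt_two_pow_self.le
  constructor
  · calc m * I.speed i j < 2 ^ m * 2 ^ Nat.size (I.speed i j) :=
          Nat.mul_lt_mul_of_le_of_lt h3 h2 (by positivity)
      _ = 2 ^ (m + Nat.size (I.speed i j)) := (pow_add _ _ _).symm
      _ ≤ _ := Nat.pow_le_pow_right (by norm_num) h1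
  · exact h2.trans_le (Nat.pow_le_pow_right (by norm_num) (by omega))

/-- A feasible solution bounds the integral critical speeds in terms of the speeds. -/
theorem Instance.IsLPSolution.time_two_pow_le {I : Instance m n} {p C : ℝ}
    {x : Fin m → Fin n → ℝ} (h : I.IsLPSolution integralSpeeds p C x) (hm : 0 < m) (hp : 1 ≤ p)
    (j : Fin n) : I.time j (2 ^ (I.size + 1)) ≤ C := by
  have hfr := h.isFractional_integral
  have hm0 : (0 : ℝ) < m := by exact_mod_cast hm
  -- The shares of a job sum to `1`, so some machine holds `1 / m`; its load constraint bounds the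
  -- coefficient by `m C`.
  obtain ⟨i, hi⟩ : ∃ i, 1 / (m : ℝ) ≤ x i j := by
    by_contra! hlt
    have : ∑ i, x i j < ∑ _i : Fin m, 1 / (m : ℝ) :=
      Finset.sum_lt_sum_of_nonempty ⟨⟨0, hm⟩, Finset.mem_univ _⟩ fun i _ => hlt i
    rw [h.assign, Finset.sum_const, Finset.card_univ, Fintype.card_fin, nsmul_eq_mul,
      mul_one_div_cancel hm0.ne'] at this
    exact lt_irrefl _ this
  have hx : 0 < x i j := lt_of_lt_of_le (by positivity) hi
  have hbig : ∀ q : ℝ, 0 ≤ q → I.time j q ≤ C → q ≤ 2 ^ (I.size + 1) →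
      I.time j (2 ^ (I.size + 1)) ≤ C := fun q hq hle hq2 =>
    (I.time_antitone j hq (by simp) hq2).trans hle
  obtain ⟨hb1, hb2⟩ := I.speed_lt_two_pow i j
  have hb1' : (m : ℝ) * I.speed i j < 2 ^ I.size := by exact_mod_cast hb1
  have hb2' : (I.speed i j : ℝ) < 2 ^ I.size := by exact_mod_cast hb2
  have hpow : (2 : ℝ) ^ (I.size + 1) = 2 * 2 ^ I.size := pow_succ' _ _
  have hone : (1 : ℝ) ≤ 2 ^ I.size := one_le_pow₀ (by norm_num)
  rcases hfr.coeff i j hx with ⟨hle, -⟩ | ⟨hs, hsγ, hγC, hw⟩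
  · exact hbig _ (Nat.cast_nonneg _) hle (by rw [hpow]; linarith)
  obtain ⟨g, hg, -, hg2⟩ := h.exists_critSpeed_eq j
  rw [hg] at hsγ hγC hw
  refine hbig g (Nat.cast_nonneg _) hγC ?_
  rcases Nat.lt_or_ge g 2 with hg1 | hg1
  · have : (g : ℝ) ≤ 1 := by exact_mod_cast Nat.lt_succ_iff.1 hg1
    rw [hpow]
    linarith
  obtain ⟨k, rfl⟩ : ∃ k, g = k + 1 := ⟨g - 1, by omega⟩
  have hk1 : (1 : ℝ) ≤ k := by exact_mod_cast (by omega : 1 ≤ k)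
  have hk := hg2 k rfl
  push Not at hk
  -- The predecessor `k` of the critical speed takes longer than `C`. Since `k ≥ 1`, one has `k + 1
  -- ≤ 2 k`, and monotone work yields `C < 2 f`; this is why critical speeds below `2` were split
  -- off.
  have hwork : I.time j k * k ≤ I.time j ((k + 1 : ℕ) : ℝ) * ((k + 1 : ℕ) : ℝ) :=
    I.work_monotone j (Nat.cast_nonneg (α := ℝ) _) (Nat.cast_nonneg (α := ℝ) _)
      (by push_cast; linarith)
  have hC0 : 0 ≤ C := hfr.target_nonneg hm
  set f := I.time j ((k + 1 : ℕ) : ℝ) with hf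
  have hfC : C < 2 * f := by
    push_cast at hwork
    by_contra! hcon
    nlinarith
  have hs' : (0 : ℝ) < I.speed i j := by exact_mod_cast hs
  set r := ((k + 1 : ℕ) : ℝ) / I.speed i j with hr
  have hr1 : 1 ≤ r := (one_le_div hs').2 hsγ
  have hrp : r ≤ r ^ p := Real.self_le_rpow_of_one_le hr1 hp
  have hwx : I.weight p C (I.critSpeed integralSpeeds C) i j * x i j ≤ C :=
    (Finset.single_le_sum (f := fun j => I.weight p C (I.critSpeed integralSpeeds C) i j * x i j)
      (fun j _ => mul_nonneg (I.weight_nonneg hfr.speed_nonneg i j) (hfr.nonneg i j))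
      (Finset.mem_univ j)).trans (hfr.load i)
  rw [hw] at hwx
  have hf0 : 0 < f := by linarith
  have h1 : f * r * (1 / m) ≤ C :=
    le_trans (mul_le_mul (mul_le_mul_of_nonneg_left hrp hf0.le) hi (by positivity)
      (by positivity)) hwx
  have h2 : f * r ≤ C * m := by
    rwa [mul_one_div, div_le_iff₀ hm0] at h1
  -- From `f r ≤ C m < 2 f m`. Hence the critical speed is at most `2 m s`, which is below `2 ^
  -- (size + 1)`.
  have h3 : r ≤ 2 * m := by
    by_contra! hcon
    nlinarith
  rw [hr, div_le_iff₀ hs'] at h3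
  rw [hpow]
  linarith

end

section

/-! ### Basic solutions -/

open Finset in
/-- A tableau `T` that is row equivalent to `V`, with a partial basis `bas` of columns, recorded in
the matrix `B`; the columns of the support of `x` from `v` on are in the basis. -/
structure Tableau (R N v : ℕ) (V : ℕ → ℕ → ℝ) (x₀ : ℕ → ℝ) (T B : ℕ → ℕ → ℝ) (x : ℕ → ℝ)
    (bas : ℕ → Option ℕ) : Prop where
  ker : ∀ d : ℕ → ℝ, (∀ r < R, ∑ e ∈ range N, T r e * d e = 0) ↔
    ∀ r < R, ∑ e ∈ range N, V r e * d e = 0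
  entry : ∀ r < R, ∀ e < N, B r e = if bas r = some e then 1 else 0
  col : ∀ r < R, ∀ e, bas r = some e → e < N ∧ v ≤ e ∧ x₀ e ≠ 0 ∧
    ∀ r' < R, T r' e = if r' = r then 1 else 0
  proc : ∀ e, v ≤ e → e < N → x e ≠ 0 → ∃ r < R, bas r = some e
  sol : ∀ r < R, ∑ e ∈ range N, V r e * x e = ∑ e ∈ range N, V r e * x₀ e
  nonneg : ∀ e < N, 0 ≤ x e
  supp : ∀ e < N, x₀ e = 0 → x e = 0

namespace Tableau

open Finset

variable {R N v : ℕ} {V : ℕ → ℕ → ℝ} {x₀ : ℕ → ℝ} {T B : ℕ → ℕ → ℝ} {x : ℕ → ℝ}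
  {bas : ℕ → Option ℕ}

/-- Columns are treated from the last one downwards, so `v = N` means that none has been treated and
the basis is empty. -/
theorem init {V : ℕ → ℕ → ℝ} {T B : ℕ → ℕ → ℝ} {x : ℕ → ℝ}
    (hT : ∀ r < R, ∀ e < N, T r e = V r e) (hB : ∀ r < R, ∀ e < N, B r e = 0)
    (hx : ∀ e < N, 0 ≤ x e) : Tableau R N N V x T B x fun _ => none where
  ker d := forall₂_congr fun r hr => by
    rw [sum_congr rfl fun e he => by rw [hT r hr e (mem_range.1 he)]]
  entry r hr e he := by simp [hB r hr e he]
  col := by simp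
  proc e h h' := by omega
  sol _ _ := rfl
  nonneg := hx
  supp _ _ h := h

/-- The program does not store `bas`; a row sum of `B` is its test for whether a row already carries
a basic column. -/
theorem sum_entry (h : Tableau R N v V x₀ T B x bas) {r : ℕ} (hr : r < R) :
    ∑ e ∈ range N, B r e = if bas r = none then 0 else 1 := by
  rw [sum_congr rfl fun e he => h.entry r hr e (mem_range.1 he)]
  cases hb : bas r with
  | none => simp
  | some e =>
    have := (h.col r hr e hb).1
    simp [this]

/-- Columns outside the support of `x` may leave the basis. -/
theorem clear (h : Tableau R N v V x₀ T B x bas) {B' : ℕ → ℕ → ℝ}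
    (hB : ∀ r < R, ∀ e < N, B' r e = if x e ≤ 0 then 0 else B r e) :
    ∃ bas', Tableau R N v V x₀ T B' x bas' ∧
      ∀ r < R, ∀ e, bas' r = some e ↔ bas r = some e ∧ x e ≠ 0 := by
  classical
  have key : ∀ r e, (bas r).filter (fun e => decide (x e ≠ 0)) = some e ↔
      bas r = some e ∧ x e ≠ 0 := by
    intro r e
    rw [Option.filter_eq_some_iff]
    simp
  refine ⟨fun r => (bas r).filter fun e => decide (x e ≠ 0), ?_, fun r _ e => key r e⟩
  refine ⟨h.ker, ?_, ?_, ?_, h.sol, h.nonneg, h.supp⟩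
  · intro r hr e he
    rw [hB r hr e he, h.entry r hr e he]
    simp only [key]
    have := h.nonneg e he
    by_cases hx : x e = 0
    · simp [hx]
    · have : ¬ x e ≤ 0 := fun h' => hx (le_antisymm h' this)
      simp [hx, this]
  · intro r hr e he
    exact h.col r hr e ((key r e).1 he).1
  · intro e h1 h2 h3
    obtain ⟨r, hr, hb⟩ := h.proc e h1 h2 h3
    exact ⟨r, hr, (key r e).2 ⟨hb, h3⟩⟩

theorem skip (h : Tableau R N (v + 1) V x₀ T B x bas) (hx : x v = 0) :
    Tableau R N v V x₀ T B x bas :=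
  { h with
    col := fun r hr e he => ⟨(h.col r hr e he).1, by have := (h.col r hr e he).2.1; omega,
      (h.col r hr e he).2.2⟩
    proc := fun e h1 h2 h3 => by
      rcases h1.eq_or_lt with rfl | h1
      · exact absurd hx h3
      · exact h.proc e h1 h2 h3 }

/-- The direction that trades column `v` for the basis. -/
theorem sum_mul_direction (h : Tableau R N (v + 1) V x₀ T B x bas) (hv : v < N)
    (hfree : ∀ r < R, bas r = none → T r v = 0) {d : ℕ → ℝ}
    (hd : ∀ e < N, d e = ∑ r ∈ range R, B r e * T r v - if e = v then 1 else 0) :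
    ∀ r < R, ∑ e ∈ range N, V r e * d e = 0 := by
  rw [← h.ker d]
  intro r hr
  -- Basic columns of `T` are unit vectors, so `T` times the transposed basis matrix is diagonal,
  -- with a `1` exactly at the occupied rows. Column `v` vanishes on the free rows, so the basis
  -- reproduces it.
  have h1 : ∀ r' ∈ range R, ∑ e ∈ range N, T r e * B r' e =
      if r' = r then (if bas r = none then 0 else 1) else 0 := by
    intro r' hr'
    rw [mem_range] at hr'
    have h2 : ∀ e ∈ range N, T r e * B r' e = if r' = r then B r' e else 0 := by
      intro e he
      rw [h.entry r' hr' e (mem_range.1 he)]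
      by_cases hb : bas r' = some e
      · rw [(h.col r' hr' e hb).2.2.2 r hr]
        simp [hb, eq_comm]
      · simp [hb]
    rw [sum_congr rfl h2]
    by_cases hrr : r' = r
    · subst hrr
      simp only [if_true]
      exact h.sum_entry hr
    · simp [hrr]
  calc ∑ e ∈ range N, T r e * d e
      = ∑ e ∈ range N, (∑ r' ∈ range R, (T r e * B r' e) * T r' v
          - T r e * if e = v then 1 else 0) := by
        refine sum_congr rfl fun e he => ?_
        rw [hd e (mem_range.1 he), mul_sub, mul_sum]
        simp only [mul_assoc]
    _ = ∑ r' ∈ range R, (∑ e ∈ range N, T r e * B r' e) * T r' v - T r v := by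
        rw [sum_sub_distrib, sum_comm]
        simp [sum_mul, hv]
    _ = 0 := by
        rw [sum_congr rfl fun r' hr' => by rw [h1 r' hr']]
        by_cases hb : bas r = none
        · simp [hb, hfree r hr hb]
        · simp [hb, hr]

/-- Basic columns have numbers above `v`, so only the subtracted unit vector contributes. -/
theorem direction_self (h : Tableau R N (v + 1) V x₀ T B x bas) (hv : v < N) {d : ℕ → ℝ}
    (hd : ∀ e < N, d e = ∑ r ∈ range R, B r e * T r v - if e = v then 1 else 0) : d v = -1 := by
  rw [hd v hv, sum_eq_zero]
  · simp
  · intro r hr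
    rw [h.entry r (mem_range.1 hr) v hv, if_neg, zero_mul]
    intro hb
    have := (h.col r (mem_range.1 hr) v hb).2.1
    omega

theorem exists_bas_of_direction (h : Tableau R N (v + 1) V x₀ T B x bas) {d : ℕ → ℝ}
    (hd : ∀ e < N, d e = ∑ r ∈ range R, B r e * T r v - if e = v then 1 else 0) {e : ℕ}
    (he : e < N) (hev : e ≠ v) (hde : d e ≠ 0) : ∃ r < R, bas r = some e ∧ T r v ≠ 0 := by
  rw [hd e he, if_neg hev, sub_zero] at hde
  obtain ⟨r, hr, hne⟩ := exists_ne_zero_of_sum_ne_zero hde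
  rw [mem_range] at hr
  rw [h.entry r hr e he] at hne
  refine ⟨r, hr, ?_, right_ne_zero_of_mul hne⟩
  by_contra hb
  simp [hb] at hne

/-- A kernel direction keeps all row sums. It is supported on `v` and on basic columns, all of which
lie in the support of `x₀`; so the support stays inside that of `x₀`, and any entry above `v` that
becomes nonzero belongs to the basis already. -/
theorem move (h : Tableau R N (v + 1) V x₀ T B x bas) (hv : v < N) (hxv : x v ≠ 0)
    (hfree : ∀ r < R, bas r = none → T r v = 0) {d : ℕ → ℝ}
    (hd : ∀ e < N, d e = ∑ r ∈ range R, B r e * T r v - if e = v then 1 else 0)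
    {t : ℝ} {x' : ℕ → ℝ} (hx' : ∀ e < N, x' e = x e + t * d e) (hx0 : ∀ e < N, 0 ≤ x' e) :
    Tableau R N (v + 1) V x₀ T B x' bas := by
  refine ⟨h.ker, h.entry, h.col, ?_, ?_, hx0, ?_⟩
  · intro e h1 h2 h3
    by_cases hx : x e = 0
    · have hde : d e ≠ 0 := by
        intro h0
        rw [hx' e h2, hx, h0] at h3
        simp at h3
      obtain ⟨r, hr, hb, -⟩ := h.exists_bas_of_direction hd h2 (by omega) hde
      exact ⟨r, hr, hb⟩
    · exact h.proc e h1 h2 hx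
  · intro r hr
    rw [← h.sol r hr]
    calc ∑ e ∈ range N, V r e * x' e
        = ∑ e ∈ range N, V r e * x e + t * ∑ e ∈ range N, V r e * d e := by
          rw [mul_sum, ← sum_add_distrib]
          refine sum_congr rfl fun e he => ?_
          rw [hx' e (mem_range.1 he)]
          ring
      _ = _ := by rw [h.sum_mul_direction hv hfree hd r hr, mul_zero, add_zero]
  · intro e he h0
    have hev : e ≠ v := by
      rintro rfl
      exact hxv (h.supp _ he h0)
    have hde : d e = 0 := by
      by_contra hne
      obtain ⟨r, hr, hb, -⟩ := h.exists_bas_of_direction hd he hev hne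
      exact (h.col r hr e hb).2.2.1 h0
    rw [hx' e he, h.supp e he h0, hde]
    simp

/-- One Gauss-Jordan step. Row `s` carries no basic column, so it vanishes on all basic columns and
the elimination leaves them untouched; the row operations are invertible, so the kernel is the same.
-/
theorem pivot (h : Tableau R N (v + 1) V x₀ T B x bas) (hv : v < N) {s : ℕ} (hs : s < R)
    (hx₀ : x₀ v ≠ 0) (hb : bas s = none) (hT : T s v ≠ 0) {T' B' : ℕ → ℕ → ℝ}
    (hT' : ∀ r < R, ∀ e < N, T' r e =
      if r = s then T s e / T s v else T r e - T r v * (T s e / T s v))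
    (hB' : ∀ r < R, ∀ e < N, B' r e = if r = s ∧ e = v then 1 else B r e) :
    Tableau R N v V x₀ T' B' x (Function.update bas s (some v)) := by
  have hcol : ∀ r < R, ∀ e, r ≠ s → bas r = some e → T s e = 0 := by
    intro r hr e hrs hbr
    rw [(h.col r hr e hbr).2.2.2 s hs, if_neg hrs.symm]
  refine ⟨?_, ?_, ?_, ?_, h.sol, h.nonneg, h.supp⟩
  · intro d
    rw [← h.ker d]
    have e1 : ∑ e ∈ range N, T' s e * d e = (∑ e ∈ range N, T s e * d e) / T s v := by
      rw [sum_div]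
      refine sum_congr rfl fun e he => ?_
      rw [hT' s hs e (mem_range.1 he), if_pos rfl]
      ring
    have e2 : ∀ r < R, r ≠ s → ∑ e ∈ range N, T' r e * d e =
        ∑ e ∈ range N, T r e * d e - T r v * ∑ e ∈ range N, T' s e * d e := by
      intro r hr hrs
      rw [mul_sum, ← sum_sub_distrib]
      refine sum_congr rfl fun e he => ?_
      rw [hT' r hr e (mem_range.1 he), if_neg hrs, hT' s hs e (mem_range.1 he), if_pos rfl]
      ring
    constructor
    · intro h' r hr
      have h0 := h' s hs
      by_cases hrs : r = s
      · subst hrs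
        rw [e1, div_eq_zero_iff] at h0
        exact h0.resolve_right hT
      · have := h' r hr
        rw [e2 r hr hrs, h0] at this
        simpa using this
    · intro h' r hr
      have h0 : ∑ e ∈ range N, T' s e * d e = 0 := by rw [e1, h' s hs, zero_div]
      by_cases hrs : r = s
      · subst hrs
        exact h0
      · rw [e2 r hr hrs, h0, h' r hr]
        simp
  · intro r hr e he
    rw [hB' r hr e he, h.entry r hr e he]
    by_cases hrs : r = s
    · subst hrs
      simp [hb, eq_comm]
    · simp [hrs]
  · intro r hr e hbe
    by_cases hrs : r = s
    · subst hrs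
      rw [Function.update_self, Option.some_inj] at hbe
      subst hbe
      refine ⟨hv, le_rfl, hx₀, fun r' hr' => ?_⟩
      rw [hT' r' hr' _ hv]
      split_ifs
      · exact div_self hT
      · rw [div_self hT]
        ring
    · rw [Function.update_of_ne hrs] at hbe
      obtain ⟨c1, c2, c3, c4⟩ := h.col r hr e hbe
      refine ⟨c1, by omega, c3, fun r' hr' => ?_⟩
      rw [hT' r' hr' _ c1, hcol r hr e hrs hbe, zero_div, mul_zero, sub_zero, c4 r' hr']
      split_ifs with h1 h2 <;> first | rfl | skip
      exact absurd (h2.symm.trans h1) hrs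
  · intro e h1 h2 h3
    rcases h1.eq_or_lt with rfl | h1
    · exact ⟨s, hs, Function.update_self ..⟩
    · obtain ⟨r, hr, hbr⟩ := h.proc e h1 h2 h3
      refine ⟨r, hr, ?_⟩
      rw [Function.update_of_ne, hbr]
      rintro rfl
      rw [hb] at hbr
      cases hbr

/-- Once all columns are treated, every support column is a unit vector of the tableau with a row of
its own. In that row the kernel equation reads `d e = 0`. -/
theorem eq_zero_of_sum_eq_zero (h : Tableau R N 0 V x₀ T B x bas) {d : ℕ → ℝ}
    (hd : ∀ e < N, x e = 0 → d e = 0) (hV : ∀ r < R, ∑ e ∈ range N, V r e * d e = 0) :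
    ∀ e < N, d e = 0 := by
  intro e he
  by_contra hne
  obtain ⟨r, hr, hb⟩ := h.proc e (Nat.zero_le _) he fun h0 => hne (hd e he h0)
  have h1 := (h.ker d).2 hV r hr
  rw [sum_eq_single e, (h.col r hr e hb).2.2.2 r hr, if_pos rfl, one_mul] at h1
  · exact hne h1
  · intro e' he' hee
    rw [mem_range] at he'
    by_cases hx : x e' = 0
    · rw [hd e' he' hx, mul_zero]
    · obtain ⟨r', hr', hb'⟩ := h.proc e' (Nat.zero_le _) he' hx
      rw [(h.col r' hr' e' hb').2.2.2 r hr, if_neg, zero_mul]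
      rintro rfl
      rw [hb] at hb'
      exact hee (Option.some_inj.1 hb').symm
  · intro h'
    exact absurd (mem_range.2 he) h'

end Tableau

/-! ### Orientations -/

/-- Hall's condition for matching the edges in `E` with incident vertices in `U`. -/
def Hall (inc : ℕ → ℕ → Prop) [∀ r e, Decidable (inc r e)] (E U : Finset ℕ) : Prop :=
  ∀ F ⊆ E, F.card ≤ (U.filter fun r => ∃ e ∈ F, inc r e).card

section Hall

open Finset

variable {inc : ℕ → ℕ → Prop} [∀ r e, Decidable (inc r e)] {E U : Finset ℕ}

/-- The columns in `F` vanish outside the set `W` of incident vertices, so they stay independent as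
vectors in `ℝ^W`. Their number is then at most the dimension. -/
theorem hall_of_independent {R N : ℕ} {V : ℕ → ℕ → ℝ} (hV : ∀ r < R, ∀ e < N, V r e ≠ 0 → inc r e)
    (hE : E ⊆ range N)
    (hind : ∀ d : ℕ → ℝ, (∀ e, e ∉ E → d e = 0) →
      (∀ r < R, ∑ e ∈ range N, V r e * d e = 0) → ∀ e < N, d e = 0) :
    Hall inc E (range R) := by
  intro F hF
  set W := (range R).filter fun r => ∃ e ∈ F, inc r e with hW
  have hli : LinearIndependent ℝ fun e : F => fun r : W => V r e := by
    rw [Fintype.linearIndependent_iff]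
    intro g hg e
    let d : ℕ → ℝ := fun e => if h : e ∈ F then g ⟨e, h⟩ else 0
    have hsum : ∀ r, ∑ e ∈ range N, V r e * d e = ∑ e : F, V r e * g e := by
      intro r
      rw [← sum_subset (hF.trans hE), ← sum_coe_sort F]
      · refine sum_congr rfl fun e _ => ?_
        simp [d]
      · intro e _ he
        simp [d, he]
    have := hind d (fun e he => by
      have : e ∉ F := fun h => he (hF h)
      simp [d, this]) (fun r hr => by
      rw [hsum]
      by_cases hrW : r ∈ W
      · have h1 := congrFun hg ⟨r, hrW⟩
        simp only [Finset.sum_apply, Pi.smul_apply, smul_eq_mul, Pi.zero_apply] at h1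
        rw [← h1]
        exact sum_congr rfl fun e _ => mul_comm _ _
      · refine sum_eq_zero fun e _ => ?_
        have : V r e = 0 := by
          by_contra hne
          exact hrW (mem_filter.2 ⟨mem_range.2 hr, e, e.2,
            hV r hr e (mem_range.1 (hE (hF e.2))) hne⟩)
        rw [this, zero_mul]) e (mem_range.1 (hE (hF e.2)))
    simpa [d] using this
  have := hli.fintype_card_le_finrank
  simpa using this

theorem Hall.exists_inc (h : Hall inc E U) {e : ℕ} (he : e ∈ E) : ∃ r ∈ U, inc r e := by
  have := h {e} (by simpa using he)
  rw [card_singleton] at this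
  obtain ⟨r, hr⟩ := card_pos.1 (zero_lt_one.trans_le this)
  simp only [mem_singleton, exists_eq_left, mem_filter] at hr
  exact ⟨r, hr⟩

/-- An edge may be matched with an incident vertex of minimal degree. -/
theorem Hall.erase (h : Hall inc E U) (h2 : ∀ e ∈ E, (U.filter fun r => inc r e).card ≤ 2)
    {r e : ℕ} (hr : r ∈ U) (he : e ∈ E) (hre : inc r e)
    (hmin : ∀ r' ∈ U, ∀ e' ∈ E, inc r' e' →
      (E.filter fun e => inc r e).card ≤ (E.filter fun e => inc r' e).card) :
    Hall inc (E.erase e) (U.erase r) := by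
  intro F hF
  have hFE : F ⊆ E := hF.trans (erase_subset _ _)
  have heF : e ∉ F := fun h' => by simpa using hF h'
  rw [filter_erase]
  by_cases hrF : ∃ e' ∈ F, inc r e'
  swap
  · rw [erase_eq_of_notMem (by simp [hrF])]
    exact h F hFE
  rw [card_erase_of_mem (by simp [hr, hrF])]
  obtain ⟨e', he', hre'⟩ := hrF
  -- Only sets `F` that touch `r` could lose a vertex. In that case `r` has degree at least two,
  -- through `e` and an edge of `F`, and by minimality so has every touched vertex.
  have hdeg : ∀ r' ∈ U, (∃ e ∈ E, inc r' e) → 2 ≤ (E.filter fun e => inc r' e).card := by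
    rintro r' hr' ⟨f, hf, hrf⟩
    refine le_trans ?_ (hmin r' hr' f hf hrf)
    refine one_lt_card.2 ⟨e, by simp [he, hre], e', by simp [hFE he', hre'], ?_⟩
    rintro rfl
    exact heF he'
  have hdouble : ∀ G : Finset ℕ, G ⊆ E →
      ∑ f ∈ G, (U.filter fun r => inc r f).card =
        ∑ r ∈ U.filter (fun r => ∃ e ∈ G, inc r e), (G.filter fun e => inc r e).card := by
    intro G _
    rw [sum_filter_of_ne]
    · exact (sum_card_bipartiteAbove_eq_sum_card_bipartiteBelow (s := U) (t := G) inc).symm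
    · intro r _ hne
      obtain ⟨f, hf⟩ := card_pos.1 (Nat.pos_of_ne_zero hne)
      exact ⟨f, mem_filter.1 hf⟩
  have hE := h E subset_rfl
  have hdE := hdouble E subset_rfl
  have hlow : ∑ r ∈ U.filter (fun r => ∃ e ∈ E, inc r e), 2 ≤
      ∑ r ∈ U.filter (fun r => ∃ e ∈ E, inc r e), (E.filter fun e => inc r e).card :=
    sum_le_sum fun r' hr' => hdeg r' (mem_filter.1 hr').1 (mem_filter.1 hr').2
  have hup : ∑ f ∈ E, (U.filter fun r => inc r f).card ≤ ∑ f ∈ E, 2 := sum_le_sum h2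
  rw [sum_const, smul_eq_mul] at hlow hup
  -- Counting incidences twice: `2 |V(E)| ≤ ∑ deg ≤ 2 |E|`, while Hall's condition for `E` gives
  -- `|E| ≤ |V(E)|`. Equality holds throughout, so every edge has two ends in `U` and every touched
  -- vertex has degree two.
  have htwo : ∀ f ∈ E, (U.filter fun r => inc r f).card = 2 := by
    refine (sum_eq_sum_iff_of_le h2).1 ?_
    rw [sum_const, smul_eq_mul]
    omega
  have hdeg2 : ∀ r' ∈ U.filter (fun r => ∃ e ∈ E, inc r e),
      2 = (E.filter fun e => inc r' e).card := by
    refine (sum_eq_sum_iff_of_le fun r' hr' =>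
      hdeg r' (mem_filter.1 hr').1 (mem_filter.1 hr').2).1 ?_
    rw [sum_const, smul_eq_mul]
    omega
  -- Within `F` the vertex `r` misses the edge `e`, so the incidences of `F` number fewer than `2
  -- |V(F)|`. As they number `2 |F|`, there is a vertex to spare for the removal of `r`.
  have hlt : ∑ r' ∈ U.filter (fun r => ∃ e ∈ F, inc r e), (F.filter fun e => inc r' e).card <
      ∑ r' ∈ U.filter (fun r => ∃ e ∈ F, inc r e), 2 := by
    have hmem : ∀ r' ∈ U.filter (fun r => ∃ e ∈ F, inc r e),
        r' ∈ U.filter (fun r => ∃ e ∈ E, inc r e) := by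
      intro r' hr'
      obtain ⟨h1, f, hf, hf'⟩ := mem_filter.1 hr'
      exact mem_filter.2 ⟨h1, f, hFE hf, hf'⟩
    refine sum_lt_sum (fun r' hr' => ?_) ⟨r, mem_filter.2 ⟨hr, e', he', hre'⟩, ?_⟩
    · rw [hdeg2 r' (hmem r' hr')]
      exact card_le_card (filter_subset_filter _ hFE)
    · rw [hdeg2 r (hmem r (mem_filter.2 ⟨hr, e', he', hre'⟩))]
      refine card_lt_card ⟨filter_subset_filter _ hFE, fun hsub => heF ?_⟩
      exact (mem_filter.1 (hsub (mem_filter.2 ⟨he, hre⟩))).1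
  rw [← hdouble F hFE, sum_congr rfl fun f hf => htwo f (hFE hf), sum_const, sum_const,
    smul_eq_mul, smul_eq_mul] at hlt
  omega

end Hall

end

section

/-! ### The parts of the rounding program

Index registers `0`, …, `6` hold `m`, `n`, `0`, `1`, `m + n`, `m * n` and `2`. Vectors are kept in
row `0` of an array and scalars in the entry `(0, 0)`. -/

/-- The contents of the constant registers, and the bound `L` on numbers of rounds. -/
structure Base (m n L : ℕ) (σ : Store) : Prop where
  i0 : σ.idx 0 = m
  i1 : σ.idx 1 = n
  i2 : σ.idx 2 = 0
  i3 : σ.idx 3 = 1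
  i4 : σ.idx 4 = m + n
  i5 : σ.idx 5 = m * n
  i6 : σ.idx 6 = 2
  add_le : m + n ≤ L
  mul_le : m * n ≤ L

/-- The constants sit in registers below `7`, and the routines after the set-up write only to
registers from `7` on. -/
theorem Base.fr {m n L : ℕ} {σ σ' : Store} {I A : Set ℕ} (h : Base m n L σ) (hF : Fr I A σ σ')
    (hI : ∀ k ∈ I, 7 ≤ k) : Base m n L σ' := by
  have key : ∀ k < 7, σ'.idx k = σ.idx k := fun k hk =>
    hF.idx k fun h' => absurd (hI k h') (not_le.2 hk)
  exact ⟨(key 0 (by norm_num)).trans h.i0, (key 1 (by norm_num)).trans h.i1,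
    (key 2 (by norm_num)).trans h.i2, (key 3 (by norm_num)).trans h.i3,
    (key 4 (by norm_num)).trans h.i4, (key 5 (by norm_num)).trans h.i5,
    (key 6 (by norm_num)).trans h.i6, h.add_le, h.mul_le⟩

/-- A scalar. -/
abbrev sc (a : ℕ) : Cell := ⟨a, 2, 2⟩

/-- An entry of a vector. -/
abbrev ve (a k : ℕ) : Cell := ⟨a, 2, k⟩

namespace Cmd

/-- There is no move instruction; the value is added to a zero in array `21`. That array is scratch
space and has to appear in the frame of every routine that copies. -/
def copy (d u : Cell) : Cmd := .seq (.realLit (sc 21) 0) (.realOp .add d u (sc 21))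

def ifEq (k l : ℕ) (c : Cmd) : Cmd := .ite (.idxLe k l) (.ite (.idxLe l k) c .skip) .skip

/-- Runs `c` if `u ≤ 0`. -/
def ifNonpos (u : Cell) (c₁ c₂ : Cmd) : Cmd :=
  .seq (.realLit (sc 21) 0) (.ite (.realLe u (sc 21)) c₁ c₂)

end Cmd

section

variable {m n : ℕ} {F : ℕ → ℝ → ℝ} {L : ℕ} {σ : Store} {Q : Store → Prop}

theorem runs_copy {d u : Cell} (hu : u.name ≠ 21) (z : σ.idx 2 = 0)
    (h : Q ((σ.set (sc 21) 0).set d (σ.get u))) : Runs F L (.copy d u) σ Q := by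
  refine runs_seq (runs_realLit (runs_realOp ?_))
  have : RealOp.eval .add ((σ.set (sc 21) (0 : ℕ)).get u) ((σ.set (sc 21) (0 : ℕ)).get (sc 21)) =
      σ.get u := by
    simp [RealOp.eval, Store.get, hu, z]
  rw [this]
  simpa using h

theorem runs_ifEq {k l : ℕ} {c : Cmd} (h₁ : σ.idx k = σ.idx l → Runs F L c σ Q)
    (h₂ : σ.idx k ≠ σ.idx l → Q σ) : Runs F L (.ifEq k l c) σ Q := by
  refine runs_ite (fun h => runs_ite (fun h' => h₁ (le_antisymm h h')) fun h' => runs_skip ?_)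
    fun h => runs_skip ?_
  · exact h₂ fun e => h' (le_of_eq e.symm)
  · exact h₂ fun e => h (le_of_eq e)

theorem runs_ifNonpos {u : Cell} {c₁ c₂ : Cmd} (hu : u.name ≠ 21) (z : σ.idx 2 = 0)
    (h₁ : σ.get u ≤ 0 → Runs F L c₁ (σ.set (sc 21) 0) Q)
    (h₂ : 0 < σ.get u → Runs F L c₂ (σ.set (sc 21) 0) Q) : Runs F L (.ifNonpos u c₁ c₂) σ Q := by
  refine runs_seq (runs_realLit ?_)
  rw [Nat.cast_zero]
  have : ((Test.realLe u (sc 21)).Holds (σ.set (sc 21) 0)) ↔ σ.get u ≤ 0 := by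
    simp [Test.Holds, Store.get, hu, z]
  refine runs_ite (fun h => h₁ (this.1 h)) fun h => h₂ ?_
  rw [this] at h
  exact not_le.1 h

/-! #### Constants -/

/-- Index registers can only be added and subtracted, so `m * n` is obtained by `m` additions of
`n`. -/
def setupCmd : Cmd :=
  .seq (.idxLit 3 1) <| .seq (.idxLit 6 2) <| .seq (.idxAdd 4 0 1) <| .seq (.idxLit 5 0) <|
    .for 10 0 (.idxAdd 5 5 1)

theorem runs_setup (h0 : σ.idx 0 = m) (h1 : σ.idx 1 = n) (h2 : σ.idx 2 = 0) (hL : m + n ≤ L)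
    (hL' : m * n ≤ L)
    (hQ : ∀ σ', σ'.arr = σ.arr → Base m n L σ' → Q σ') : Runs F L setupCmd σ Q := by
  refine runs_seq (runs_idxLit (runs_seq (runs_idxLit (runs_seq (runs_idxAdd (runs_seq
    (runs_idxLit ?_)))))))
  refine runs_for {5, 10} ∅ {5} (fun v σ₁ => σ₁.idx 5 + v * n = m * n) (by simp) (by simp)
    (by simp) (by simp) (by simp [h2]) (by simp) (by simp [h0]; omega) ?_ ?_ ?_ ?_
  · intro v w σ' hI
    simpa using hI
  · simp [h0]
  · intro v σ₁ hv hF hk hI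
    refine runs_idxAdd ⟨Fr.refl.setIdx (by simp), ?_⟩
    have e1 : σ₁.idx 1 = n := by
      rw [hF.idx 1 (by simp)]
      simp [h1]
    simp only [Store.setIdx_idx, if_true, e1]
    rw [← hI]
    ring
  · intro σ' hF hI
    refine hQ σ' (funext fun a => hF.arr a (by simp)) ⟨?_, ?_, ?_, ?_, ?_, ?_, ?_, hL, hL'⟩
    · rw [hF.idx 0 (by simp)]
      simp [h0]
    · rw [hF.idx 1 (by simp)]
      simp [h1]
    · rw [hF.idx 2 (by simp)]
      simp [h2]
    · rw [hF.idx 3 (by simp)]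
      simp
    · rw [hF.idx 4 (by simp)]
      simp [h0, h1]
    · simpa using hI
    · rw [hF.idx 6 (by simp)]
      simp

/-! #### Coefficients -/

/-- Row `0` of array `2` holds `p`, `C`, `β`. The constant registers `2`, `3`, `6` contain `0`, `1`,
`2`, so `sc 2`, `⟨2, 2, 3⟩` and `⟨2, 2, 6⟩` address these parameters. -/
def weightCmd : Cmd :=
  .for 10 0 <| .for 11 1 <| .seq (.query ⟨6, 10, 11⟩ 11 ⟨0, 10, 11⟩) <|
    .ite (.realLe ⟨6, 10, 11⟩ ⟨2, 2, 3⟩) .skip <|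
      .seq (.query ⟨6, 10, 11⟩ 11 (ve 3 11)) <|
      .seq (.realOp .div (sc 20) (ve 3 11) ⟨0, 10, 11⟩) <|
      .seq (.realOp .pow (sc 20) (sc 20) (sc 2)) <|
      .realOp .mul ⟨6, 10, 11⟩ ⟨6, 10, 11⟩ (sc 20)

theorem runs_weight {I : Instance m n} {p C : ℝ} {γ : Fin n → ℝ} (hB : Base m n L σ)
    (hγ : ∀ j, 0 ≤ γ j) (hs : ∀ i j, σ.arr 0 (i : Fin m) (j : Fin n) = I.speed i j)
    (hp : σ.arr 2 0 0 = p) (hC : σ.arr 2 0 1 = C) (h3 : ∀ j : Fin n, σ.arr 3 0 j = γ j)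
    (hQ : ∀ σ', Fr (Set.Ici 10) {6, 20} σ σ' →
      (∀ i j, σ'.arr 6 (i : Fin m) (j : Fin n) = I.weight p C γ i j) → Q σ') :
    Runs I.oracle L weightCmd σ Q := by
  have hadd := hB.add_le
  let g : ℕ → ℕ → ℝ := fun r l =>
    if h : r < m ∧ l < n then I.weight p C γ ⟨r, h.1⟩ ⟨l, h.2⟩ else 0
  refine runs_map2 (Set.Ici 10) {6, 20} (Set.Ici 12) 6 g (by simp) (by simp) (by simp) (by simp)
    (by simp) (by simp) (Set.Ici_subset_Ici.2 (by norm_num)) (by simp) (by simp) hB.i2 hB.i3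
    (by rw [hB.i0]; omega) (by rw [hB.i1]; omega) ?_ ?_
  · intro v w σ₁ hv hw hF hkv hkw _
    rw [hB.i0] at hv
    rw [hB.i1] at hw
    have hB₁ := hB.fr hF fun k hk => le_trans (by norm_num) (Set.mem_Ici.1 hk)
    have e0 : σ₁.arr 0 v w = I.speed ⟨v, hv⟩ ⟨w, hw⟩ := by
      rw [hF.arr 0 (by simp)]
      exact hs ⟨v, hv⟩ ⟨w, hw⟩
    have e2 : σ₁.arr 2 = σ.arr 2 := hF.arr 2 (by simp)
    have e3 : σ₁.arr 3 0 w = γ ⟨w, hw⟩ := by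
      rw [hF.arr 3 (by simp)]
      exact h3 ⟨w, hw⟩
    have hγw := hγ ⟨w, hw⟩
    have hg : g v w = I.weight p C γ ⟨v, hv⟩ ⟨w, hw⟩ := dif_pos ⟨hv, hw⟩
    have hq0 : I.oracle w (I.speed ⟨v, hv⟩ ⟨w, hw⟩) =
        I.time ⟨w, hw⟩ (I.speed ⟨v, hv⟩ ⟨w, hw⟩) := by
      simp [Instance.oracle, hw]
    have hq1 : I.oracle w (γ ⟨w, hw⟩) = I.time ⟨w, hw⟩ (γ ⟨w, hw⟩) := by
      simp [Instance.oracle, hw, hγw]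
    have hdiv : 0 ≤ γ ⟨w, hw⟩ / I.speed ⟨v, hv⟩ ⟨w, hw⟩ := by positivity
    refine runs_seq (runs_query (runs_ite (fun h => runs_skip ?_) fun h => runs_seq (runs_query
      (runs_seq (runs_realOp (runs_seq (runs_realOp (runs_realOp ?_)))))))) <;>
    simp only [Test.Holds, Store.get_def, Store.set_arr, Store.set_idx, hkv, hkw, hB₁.i2, hB₁.i3,
      e0, e2, hq0, hC, and_self, if_true, Nat.reduceEqDiff, false_and,
      if_false] at h
    · refine ⟨Fr.refl.set (by simp), fun r l => ?_⟩
      simp only [Store.get_def, Store.set_arr, hkv, hkw, e0, hq0, hg, Instance.weight, h]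
      simp
    · refine ⟨(((Fr.refl.set (by simp)).set (by simp)).set (by simp)).set (by simp) |>.set
        (by simp), fun r l => ?_⟩
      simp only [Store.get_def, Store.set_arr, Store.set_idx, hkv, hkw, e0, e2, e3, hq0, hg,
        hp, Instance.weight, h, hB₁.i2, RealOp.eval]
      simp only [Nat.reduceEqDiff, false_and, if_false, and_self, if_true, hdiv, true_and,
        hq1]
      split_ifs <;> rfl
  · intro σ' hF h
    refine hQ σ' hF fun i j => ?_
    rw [h, hB.i0, hB.i1, if_pos ⟨i.2, j.2⟩]
    exact dif_pos ⟨i.2, j.2⟩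

/-! #### Edges: the pair `(i, j)` has the number `i * n + j` -/

def divModCmd (e : ℕ) : Cmd :=
  .seq (.idxAdd 12 e 2) <| .seq (.idxLit 13 0) <|
    .loop (.idxLe 1 12) (.seq (.idxSub 12 12 1) (.idxAdd 13 13 3))

theorem runs_divMod {e : ℕ} (hB : Base m n L σ)
    (hlt : σ.idx e < m * n)
    (hQ : ∀ σ', Fr {12, 13} ∅ σ σ' → σ'.idx 13 = σ.idx e / n → σ'.idx 12 = σ.idx e % n → Q σ') :
    Runs F L (divModCmd e) σ Q := by
  have hmn : 0 < m * n := (Nat.zero_le _).trans_lt hlt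
  have hn : 0 < n := Nat.pos_of_mul_pos_left hmn
  -- Division is repeated subtraction. An edge number is below `m * n`, so the quotient stays below
  -- `m`, and `m` minus the current quotient bounds the remaining rounds.
  refine runs_seq (runs_idxAdd (runs_seq (runs_idxLit (runs_loop (fun k σ₁ =>
    Fr {12, 13} ∅ σ σ₁ ∧ σ₁.idx 12 + σ₁.idx 13 * n = σ.idx e ∧ k + σ₁.idx 13 = m)
    (k := m) (by have := hB.add_le; omega) ?_ ?_ ?_))))
  · exact ⟨(Fr.refl.setIdx (by simp)).setIdx (by simp), by simp [hB.i2], by simp⟩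
  · rintro k σ₁ ⟨hF, h1, h2⟩ ht
    have hB₁ := hB.fr hF (by simp)
    have ht' : n ≤ σ₁.idx 12 := by rw [← hB₁.i1]; exact ht
    have hk : 0 < k := by
      by_contra! h0
      have : σ₁.idx 13 = m := by omega
      rw [this] at h1
      omega
    refine ⟨k - 1, by omega, runs_seq (runs_idxSub (runs_idxAdd
      ⟨(hF.setIdx (by simp)).setIdx (by simp), ?_, ?_⟩))⟩
    · simp only [Store.setIdx_idx, hB₁.i1, hB₁.i3]
      simp only [Nat.reduceEqDiff, if_false, if_true, Nat.add_mul]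
      omega
    · simp [hB₁.i3]
      omega
  · rintro k σ₁ ⟨hF, h1, h2⟩ ht
    have hB₁ := hB.fr hF (by simp)
    have ht' : σ₁.idx 12 < n := by rw [← hB₁.i1]; exact not_le.1 ht
    have := (Nat.div_mod_unique (a := σ.idx e) (b := n) (c := σ₁.idx 12) (d := σ₁.idx 13) hn).2
      ⟨by rw [← h1, mul_comm], ht'⟩
    exact hQ σ₁ hF this.1.symm this.2.symm

/-- The column of the linear system that belongs to an edge. -/
def colEntry (m n : ℕ) (a : ℕ → ℕ → ℝ) (r e : ℕ) : ℝ :=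
  if r = m + e % n then 1 else if r = e / n then a (e / n) (e % n) else 0

/-- Incidence of vertices and edges. -/
def IsEnd (m n r e : ℕ) : Prop := r = m + e % n ∨ r = e / n

instance (m n r e : ℕ) : Decidable (IsEnd m n r e) := instDecidableOr

/-- Array `10` receives the solution as a vector over edges, `7` the matrix of the linear system
(rows below `m` for machines, the others for jobs), `9` the incidence matrix and `11` the empty
basis. -/
def buildCmd : Cmd :=
  .seq (.for 10 5 <| .seq (divModCmd 10) (.copy (ve 10 10) ⟨1, 13, 12⟩)) <|
  .seq (.for 10 4 <| .for 11 5 <| .seq (divModCmd 11) <| .seq (.idxAdd 14 0 12) <|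
    .seq (.realLit ⟨7, 10, 11⟩ 0) <| .seq (.ifEq 10 13 (.copy ⟨7, 10, 11⟩ ⟨6, 13, 12⟩)) <|
    .ifEq 10 14 (.realLit ⟨7, 10, 11⟩ 1)) <|
  .seq (.for 10 4 <| .for 11 5 <| .seq (divModCmd 11) <| .seq (.idxAdd 14 0 12) <|
    .seq (.realLit ⟨9, 10, 11⟩ 0) <| .seq (.ifEq 10 13 (.realLit ⟨9, 10, 11⟩ 1)) <|
    .ifEq 10 14 (.realLit ⟨9, 10, 11⟩ 1)) <|
  .for 10 4 <| .for 11 5 <| .realLit ⟨11, 10, 11⟩ 0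

theorem runs_build (hB : Base m n L σ)
    (hQ : ∀ σ', Fr (Set.Ici 10) {7, 9, 10, 11, 21} σ σ' →
      (∀ e < m * n, σ'.arr 10 0 e = σ.arr 1 (e / n) (e % n)) →
      (∀ r < m + n, ∀ e < m * n, σ'.arr 7 r e = colEntry m n (σ.arr 6) r e) →
      (∀ r < m + n, ∀ e < m * n, σ'.arr 9 r e = if IsEnd m n r e then 1 else 0) →
      (∀ r < m + n, ∀ e < m * n, σ'.arr 11 r e = 0) → Q σ') :
    Runs F L buildCmd σ Q := by
  have hadd := hB.add_le
  have hmul := hB.mul_le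
  have h7 : ∀ k ∈ Set.Ici 10, 7 ≤ k := fun k hk => le_trans (by norm_num) (Set.mem_Ici.1 hk)
  have h1213 : ({12, 13} : Set ℕ) ⊆ Set.Ici 12 := by
    intro k hk
    rcases hk with rfl | rfl <;> simp
  refine runs_seq (runs_map1 (Set.Ici 10) {10, 21} (Set.Ici 12) 10
    (fun e => σ.arr 1 (e / n) (e % n)) (by simp) (by simp) (Set.Ici_subset_Ici.2 (by norm_num))
    (by simp) hB.i2 hB.i3 (by rw [hB.i5]; omega) ?_ ?_)
  · intro e σ₁ he hF hk _
    have hB₁ := hB.fr hF h7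
    rw [hB.i5] at he
    refine runs_seq (runs_divMod hB₁ (by rw [hk]; exact he) ?_)
    intro σ₂ hF₂ h13 h12
    have hB₂ := hB₁.fr hF₂ (by simp)
    have hk₂ : σ₂.idx 10 = e := (hF₂.idx 10 (by simp)).trans hk
    refine runs_copy (by simp) hB₂.i2 ⟨((hF₂.mono h1213 (by simp)).set (by simp)).set (by simp),
      fun r l => ?_⟩
    simp only [Store.set_arr, Store.set_idx, hB₂.i2, Store.get_def, h13, h12, hk, hk₂,
      hF₂.arr 1 (by simp), hF₂.arr 10 (by simp), hF.arr 1 (by simp), true_and, Nat.reduceEqDiff,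
      false_and, if_false]
  intro σ₁ hF₁ hx
  have hB₁ := hB.fr hF₁ h7
  refine runs_seq (runs_map2 (Set.Ici 10) {7, 21} (Set.Ici 12) 7 (colEntry m n (σ.arr 6))
    (by simp) (by simp) (by simp) (by simp) (by simp) (by simp)
    (Set.Ici_subset_Ici.2 (by norm_num)) (by simp) (by simp) hB₁.i2 hB₁.i3
    (by rw [hB₁.i4]; omega) (by rw [hB₁.i5]; omega) ?_ ?_)
  · intro r e σ₂ hr he hF hkr hke _
    have hB₂ := hB₁.fr hF h7
    rw [hB₁.i5] at he
    refine runs_seq (runs_divMod hB₂ (by rw [hke]; exact he) ?_)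
    intro σ₃ hF₃ h13 h12
    have hB₃ := hB₂.fr hF₃ (by simp)
    have hkr₃ : σ₃.idx 10 = r := (hF₃.idx 10 (by simp)).trans hkr
    have hke₃ : σ₃.idx 11 = e := (hF₃.idx 11 (by simp)).trans hke
    have h6 : σ₃.arr 6 = σ.arr 6 := (hF₃.arr 6 (by simp)).trans
      ((hF.arr 6 (by simp)).trans (hF₁.arr 6 (by simp)))
    have h70 : σ₃.arr 7 = σ₂.arr 7 := hF₃.arr 7 (by simp)
    rw [hke] at h13 h12
    have hF₃' : Fr (Set.Ici 12) {7, 21} σ₂ σ₃ := hF₃.mono h1213 (by simp)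
    refine runs_seq (runs_idxAdd (runs_seq (runs_realLit (runs_seq (runs_ifEq (fun h =>
      runs_copy (by simp) (by simp [hB₃.i2]) (runs_ifEq (fun h' => runs_realLit ?_) fun h' => ?_))
      fun h => (runs_ifEq (fun h' => runs_realLit ?_) fun h' => ?_))))))
    all_goals
      refine ⟨by repeat' first
          | exact hF₃' | refine Fr.set ?_ (by simp) | refine Fr.setIdx ?_ (by simp), ?_⟩
      intro r' l
      simp only [Store.set_idx, Store.setIdx_idx, Nat.reduceEqDiff, if_false, if_true, hkr₃, h13,
        hB₃.i0, h12] at h h'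
      simp [hkr₃, hke₃, h6, h70, colEntry, h, h', h13, h12, hB₃.i2]
      try grind
  intro σ₂ hF₂ hT
  have hB₂ := hB₁.fr hF₂ h7
  refine runs_seq (runs_map2 (Set.Ici 10) {9} (Set.Ici 12) 9
    (fun r e => if IsEnd m n r e then 1 else 0)
    (by simp) (by simp) (by simp) (by simp) (by simp) (by simp)
    (Set.Ici_subset_Ici.2 (by norm_num)) (by simp) (by simp) hB₂.i2 hB₂.i3
    (by rw [hB₂.i4]; omega) (by rw [hB₂.i5]; omega) ?_ ?_)
  · intro r e σ₃ hr he hF hkr hke _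
    have hB₃ := hB₂.fr hF h7
    rw [hB₂.i5] at he
    refine runs_seq (runs_divMod hB₃ (by rw [hke]; exact he) ?_)
    intro σ₄ hF₄ h13 h12
    have hB₄ := hB₃.fr hF₄ (by simp)
    have hkr₄ : σ₄.idx 10 = r := (hF₄.idx 10 (by simp)).trans hkr
    have hke₄ : σ₄.idx 11 = e := (hF₄.idx 11 (by simp)).trans hke
    have h90 : σ₄.arr 9 = σ₃.arr 9 := hF₄.arr 9 (by simp)
    rw [hke] at h13 h12
    have hF₄' : Fr (Set.Ici 12) {9} σ₃ σ₄ := hF₄.mono h1213 (by simp)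
    refine runs_seq (runs_idxAdd (runs_seq (runs_realLit (runs_seq (runs_ifEq (fun h =>
      runs_realLit (runs_ifEq (fun h' => runs_realLit ?_) fun h' => ?_))
      fun h => (runs_ifEq (fun h' => runs_realLit ?_) fun h' => ?_))))))
    all_goals
      refine ⟨by repeat' first
          | exact hF₄' | refine Fr.set ?_ (by simp) | refine Fr.setIdx ?_ (by simp), ?_⟩
      intro r' l
      simp only [Store.set_idx, Store.setIdx_idx, Nat.reduceEqDiff, if_false, if_true, hkr₄, h13,
        hB₄.i0, h12] at h h'
      simp [hkr₄, hke₄, h90, IsEnd, h, h', h12]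
      try grind
  intro σ₃ hF₃ hinc
  have hB₃ := hB₂.fr hF₃ h7
  refine runs_map2 (Set.Ici 10) {11} (Set.Ici 12) 11 (fun _ _ => 0)
    (by simp) (by simp) (by simp) (by simp) (by simp) (by simp)
    (Set.Ici_subset_Ici.2 (by norm_num)) (by simp) (by simp) hB₃.i2 hB₃.i3
    (by rw [hB₃.i4]; omega) (by rw [hB₃.i5]; omega) ?_ ?_
  · intro r e σ₄ hr he hF hkr hke _
    refine runs_realLit ⟨Fr.refl.set (by simp), fun r' l => ?_⟩
    simp [hkr, hke]
  · intro σ₄ hF₄ hz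
    refine hQ σ₄ ?_ ?_ ?_ ?_ ?_
    · refine ((hF₁.mono subset_rfl ?_).trans (hF₂.mono subset_rfl ?_)).trans
        ((hF₃.mono subset_rfl ?_).trans (hF₄.mono subset_rfl ?_)) <;>
      · intro k hk
        simp only [Set.mem_insert_iff, Set.mem_singleton_iff] at hk ⊢
        omega
    · intro e he
      rw [hF₄.arr 10 (by simp), hF₃.arr 10 (by simp), hF₂.arr 10 (by simp), hx, hB.i5,
        if_pos ⟨rfl, he⟩]
    · intro r hr e he
      rw [hF₄.arr 7 (by simp), hF₃.arr 7 (by simp), hT, hB₁.i4, hB₁.i5, if_pos ⟨hr, he⟩]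
    · intro r hr e he
      rw [hF₄.arr 9 (by simp), hinc, hB₂.i4, hB₂.i5, if_pos ⟨hr, he⟩]
    · intro r hr e he
      rw [hz, hB₃.i4, hB₃.i5, if_pos ⟨hr, he⟩]

end

end

section

section

variable {m n : ℕ} {F : ℕ → ℝ → ℝ} {L : ℕ} {σ : Store} {Q : Store → Prop}
  {V : ℕ → ℕ → ℝ} {x₀ : ℕ → ℝ} {bas : ℕ → Option ℕ} {v : ℕ}

/-! #### A basic solution

Arrays `7`, `11` and `10` hold the tableau, the matrix of the basis and the solution. -/

/-- Array `12` holds the row sums of the basis matrix, which mark the occupied rows. Nonzero entries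
are recognised by a positive square in array `24`. Flag `23` tells whether a pivot row was found;
its number goes to register `7`. -/
def refreshCmd : Cmd :=
  .seq (.for 11 4 <| .for 12 5 <| .ifNonpos (ve 10 12) (.realLit ⟨11, 11, 12⟩ 0) .skip) <|
  .seq (.for 11 4 <| .seq
    (.seq (.realLit (sc 22) 0) (.for 12 5 <| .realOp .add (sc 22) (sc 22) ⟨11, 11, 12⟩))
    (.copy (ve 12 11) (sc 22))) <|
  .seq (.realLit (sc 23) 0) <|
  .for 11 4 <| .seq (.realOp .mul (sc 24) ⟨7, 11, 10⟩ ⟨7, 11, 10⟩) <|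
    .ifNonpos (ve 12 11)
      (.ifNonpos (sc 24) .skip (.seq (.realLit (sc 23) 1) (.idxAdd 7 11 2))) .skip

/-- Drop columns outside the support from the basis and look for a row that is free to be the pivot
row of column `v`. -/
theorem runs_refresh (hB : Base m n L σ) (hv : σ.idx 10 = v)
    (hT : Tableau (m + n) (m * n) (v + 1) V x₀ (σ.arr 7) (σ.arr 11) (σ.arr 10 0) bas)
    (hQ : ∀ σ' bas', Fr (insert 7 (Set.Ici 11)) {11, 12, 21, 22, 23, 24} σ σ' →
      Tableau (m + n) (m * n) (v + 1) V x₀ (σ'.arr 7) (σ'.arr 11) (σ'.arr 10 0) bas' →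
      (∀ r < m + n, ∀ e, bas' r = some e ↔ bas r = some e ∧ σ.arr 10 0 e ≠ 0) →
      ((σ'.arr 23 0 0 = 1 ∧ σ'.idx 7 < m + n ∧ bas' (σ'.idx 7) = none ∧
          σ'.arr 7 (σ'.idx 7) v ≠ 0) ∨
        (σ'.arr 23 0 0 = 0 ∧ ∀ r < m + n, bas' r = none → σ'.arr 7 r v = 0)) → Q σ') :
    Runs F L refreshCmd σ Q := by
  have hadd := hB.add_le
  have hmul := hB.mul_le
  have h7 : ∀ k ∈ Set.Ici 11, 7 ≤ k := fun k hk => le_trans (by norm_num) (Set.mem_Ici.1 hk)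
  refine runs_seq (runs_map2 (Set.Ici 11) {11, 21} (Set.Ici 13) 11
    (fun r e => if σ.arr 10 0 e ≤ 0 then 0 else σ.arr 11 r e) (by simp) (by simp) (by simp)
    (by simp) (by simp) (by simp) (Set.Ici_subset_Ici.2 (by norm_num)) (by simp) (by simp) hB.i2
    hB.i3 (by rw [hB.i4]; omega) (by rw [hB.i5]; omega) ?_ ?_)
  · intro r e σ₁ hr he hF hkr hke hsame
    have hB₁ := hB.fr hF h7
    have hx : σ₁.get (ve 10 12) = σ.arr 10 0 e := by
      simp [hB₁.i2, hke, hF.arr 10 (by simp)]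
    refine runs_ifNonpos (by simp) hB₁.i2 (fun h => runs_realLit ?_) fun h => runs_skip ?_
    · rw [hx] at h
      refine ⟨(Fr.refl.set (by simp)).set (by simp), fun r' l => ?_⟩
      simp [hkr, hke, h]
    · rw [hx] at h
      refine ⟨Fr.refl.set (by simp), fun r' l => ?_⟩
      simp only [Store.set_arr, Nat.reduceEqDiff, false_and, if_false, not_le.2 h, ← hsame]
      split_ifs with h1 <;> first | rfl | rw [h1.1, h1.2]
  intro σ₁ hF₁ hB11
  have hB₁ := hB.fr hF₁ h7
  rw [hB.i4, hB.i5] at hB11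
  obtain ⟨bas', hT₁, hbas⟩ := hT.clear (B' := σ₁.arr 11) fun r hr e he => by
    rw [hB11, if_pos ⟨hr, he⟩]
  refine runs_seq (runs_map1 (Set.Ici 11) {12, 21, 22} (Set.Ici 12) 12
    (fun r => ∑ e ∈ Finset.range (m * n), σ₁.arr 11 r e) (by simp) (by simp)
    (Set.Ici_subset_Ici.2 (by norm_num)) (by simp) hB₁.i2 hB₁.i3 (by rw [hB₁.i4]; omega) ?_ ?_)
  · intro r σ₂ hr hF hk _
    have hB₂ := hB₁.fr hF h7
    refine runs_seq (runs_sum {12} {22} ∅ 22 (fun e => σ₁.arr 11 r e) (by simp) (by simp)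
      (by simp) (by simp) (by simp) hB₂.i2 hB₂.i3 (by rw [hB₂.i5]; omega) ?_ ?_)
    · intro e σ₃ he hF₃ hke
      have hB₃ := hB₂.fr hF₃ (by simp)
      refine runs_realOp ⟨Fr.refl.set (by simp), ?_⟩
      simp [hB₃.i2, hke, hF₃.idx 11 (by simp), hk, hF₃.arr 11 (by simp), hF.arr 11 (by simp),
        RealOp.eval]
    · intro σ₃ hF₃ hsum
      have hB₃ := hB₂.fr hF₃ (by simp)
      refine runs_copy (by simp) hB₃.i2 ⟨((hF₃.mono (by simp) (by simp)).set (by simp)).set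
        (by simp), fun r' l => ?_⟩
      rw [hB₂.i5] at hsum
      simp [hB₃.i2, hF₃.idx 11 (by simp), hk, hsum, hF₃.arr 12 (by simp)]
  intro σ₂ hF₂ hu
  have hB₂ := hB₁.fr hF₂ h7
  rw [hB₁.i4] at hu
  have hu' : ∀ r < m + n, σ₂.arr 12 0 r ≤ 0 ↔ bas' r = none := by
    intro r hr
    rw [hu, if_pos ⟨rfl, hr⟩, hT₁.sum_entry hr]
    split_ifs with h <;> simp [h]
  refine runs_seq (runs_realLit ?_)
  have hF₂₀ : Fr (insert 7 (Set.Ici 11)) {21, 23, 24} σ₂ (σ₂.set (sc 23) (0 : ℕ)) :=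
    Fr.refl.set (by simp)
  have hB₃ := hB₂.fr hF₂₀ (by simpa using h7)
  have h7' : ∀ r l, σ₂.arr 7 r l = σ.arr 7 r l := fun r l => by
    rw [hF₂.arr 7 (by simp), hF₁.arr 7 (by simp)]
  have h10 : σ₂.idx 10 = v := by rw [hF₂.idx 10 (by simp), hF₁.idx 10 (by simp), hv]
  refine runs_for (insert 7 (Set.Ici 11)) {21, 23, 24} (insert 7 (Set.Ici 12)) (fun w σ₄ =>
    ((σ₄.arr 23 0 0 = 1 ∧ σ₄.idx 7 < m + n ∧ bas' (σ₄.idx 7) = none ∧ σ.arr 7 (σ₄.idx 7) v ≠ 0) ∨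
      (σ₄.arr 23 0 0 = 0 ∧ ∀ r < m + n, w ≤ r → bas' r = none → σ.arr 7 r v = 0)) ∧
      (w ≤ m + n)) (by simp) (by simp)
    (Set.insert_subset_insert (Set.Ici_subset_Ici.2 (by norm_num))) (by simp) hB₃.i2 hB₃.i3
    (by rw [hB₃.i4]; omega) ?_ ?_ ?_ ?_
  · intro w k σ₄ h
    simpa using h
  · rw [hB₃.i4]
    refine ⟨Or.inr ⟨?_, fun r h1 h2 => by omega⟩, le_rfl⟩
    simp [hB₂.i2]
  · rintro w σ₄ hw hF₄ hkw ⟨hInv, hwR⟩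
    have hF₄' := hF₂₀.trans hF₄
    have hB₄ := hB₃.fr hF₄ (by simpa using h7)
    have e7 : ∀ l, σ₄.arr 7 w l = σ.arr 7 w l := fun l => by
      rw [hF₄'.arr 7 (by simp), h7']
    have e10 : σ₄.idx 10 = v := by rw [hF₄'.idx 10 (by simp), h10]
    have e12 : ∀ l, σ₄.arr 12 0 l = σ₂.arr 12 0 l := fun l => by rw [hF₄'.arr 12 (by simp)]
    have hw' : w < m + n := by omega
    refine runs_seq (runs_realOp (runs_ifNonpos (by simp) (by simp [hB₄.i2]) (fun h =>
      runs_ifNonpos (by simp) (by simp [hB₄.i2]) (fun h' => runs_skip ?_) fun h' =>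
      runs_seq (runs_realLit (runs_idxAdd ?_))) fun h => runs_skip ?_))
    · refine ⟨((Fr.refl.set (by simp)).set (by simp)).set (by simp), ?_, hw'.le⟩
      simp only [RealOp.eval, Store.get_def, Store.set_idx, Store.set_arr, hkw, hB₄.i2, e10,
        e7, and_self, if_true, Nat.reduceEqDiff, false_and, if_false] at h'
      have h0 : σ.arr 7 w v = 0 := by nlinarith
      simp only [Store.set_idx, Store.set_arr, Nat.reduceEqDiff, false_and, if_false]
      refine hInv.imp id fun h1 => ⟨h1.1, fun r hr hwr hb => ?_⟩
      rcases hwr.eq_or_lt with rfl | hwr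
      · exact h0
      · exact h1.2 r hr hwr hb
    · refine ⟨((((Fr.refl.set (by simp)).set (by simp)).set (by simp)).set (by simp)).setIdx
        (by simp), ?_, hw'.le⟩
      simp only [RealOp.eval, Store.get_def, Store.set_idx, Store.set_arr, hkw, hB₄.i2, e10,
        e7, e12, and_self, if_true, Nat.reduceEqDiff, false_and, if_false] at h h'
      left
      simp only [Store.setIdx_arr, Store.setIdx_idx, Store.set_arr, Store.set_idx, hB₄.i2, hkw,
        and_self, if_true, add_zero, Nat.cast_one, true_and, hw', (hu' w hw').1 h]
      intro h0
      simp [h0] at h'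
    · refine ⟨(Fr.refl.set (by simp)).set (by simp), ?_, hw'.le⟩
      simp only [RealOp.eval, Store.get_def, Store.set_idx, Store.set_arr, hkw, hB₄.i2,
        e12, Nat.reduceEqDiff, false_and, if_false] at h
      simp only [Store.set_idx, Store.set_arr, Nat.reduceEqDiff, false_and, if_false]
      refine hInv.imp id fun h1 => ⟨h1.1, fun r hr hwr hb => ?_⟩
      rcases hwr.eq_or_lt with rfl | hwr
      · exact absurd ((hu' _ hr).2 hb) (not_le.2 h)
      · exact h1.2 r hr hwr hb
  · rintro σ₄ hF₄ ⟨hInv, -⟩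
    have hF₄' := hF₂₀.trans hF₄
    have e7 : σ₄.arr 7 = σ.arr 7 := by
      rw [hF₄'.arr 7 (by simp), hF₂.arr 7 (by simp), hF₁.arr 7 (by simp)]
    have e11 : σ₄.arr 11 = σ₁.arr 11 := by
      rw [hF₄'.arr 11 (by simp), hF₂.arr 11 (by simp)]
    have e10 : σ₄.arr 10 = σ.arr 10 := by
      rw [hF₄'.arr 10 (by simp), hF₂.arr 10 (by simp), hF₁.arr 10 (by simp)]
    refine hQ σ₄ bas' ?_ ?_ hbas ?_
    · refine (hF₁.mono (by simp) ?_).trans ((hF₂.mono (by simp) ?_).trans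
        (hF₄'.mono subset_rfl ?_)) <;>
      · intro k hk
        simp only [Set.mem_insert_iff, Set.mem_singleton_iff] at hk ⊢
        omega
    · rw [e7, e11, e10]
      exact hT₁
    · rw [e7]
      simpa using hInv

/-- The direction is kept in array `13` and the step length in array `25`. The first step length `x
v` makes entry `v` vanish, the direction being `-1` there; it is shortened whenever some entry would
become negative. -/
def moveCmd : Cmd :=
  .seq (.for 11 5 <| .seq
    (.seq (.realLit (sc 22) 0) (.for 12 4 <|
      .seq (.realOp .mul (sc 24) ⟨11, 12, 11⟩ ⟨7, 12, 10⟩) (.realOp .add (sc 22) (sc 22) (sc 24)))) <|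
    .seq (.ifEq 11 10 (.seq (.realLit (sc 24) 1) (.realOp .sub (sc 22) (sc 22) (sc 24))))
    (.copy (ve 13 11) (sc 22))) <|
  .seq (.copy (sc 25) (ve 10 10)) <|
  .seq (.for 11 5 <|
    .seq (.realOp .mul (sc 24) (sc 25) (ve 13 11)) <|
    .seq (.realOp .add (sc 24) (ve 10 11) (sc 24)) <|
    .seq (.realLit (sc 21) 0) <|
    .ite (.realLe (sc 21) (sc 24)) .skip <|
      .seq (.realOp .sub (sc 24) (sc 21) (ve 13 11)) (.realOp .div (sc 25) (ve 10 11) (sc 24))) <|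
  .for 11 5 <| .seq (.realOp .mul (sc 24) (sc 25) (ve 13 11))
    (.realOp .add (ve 10 11) (ve 10 11) (sc 24))

/-- Move along the direction that trades column `v` for the basis until an entry vanishes. -/
theorem runs_move (hB : Base m n L σ) (hv : σ.idx 10 = v) (hvN : v < m * n)
    (hT : Tableau (m + n) (m * n) (v + 1) V x₀ (σ.arr 7) (σ.arr 11) (σ.arr 10 0) bas)
    (hfree : ∀ r < m + n, bas r = none → σ.arr 7 r v = 0) (hxv : 0 < σ.arr 10 0 v)
    (hQ : ∀ σ', Fr (Set.Ici 11) {10, 13, 21, 22, 24, 25} σ σ' →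
      Tableau (m + n) (m * n) (v + 1) V x₀ (σ'.arr 7) (σ'.arr 11) (σ'.arr 10 0) bas →
      (σ'.arr 10 0 v = 0 ∨ ∃ r < m + n, ∃ e, bas r = some e ∧ σ'.arr 10 0 e = 0 ∧
        σ'.arr 7 r v ≠ 0) → Q σ') :
    Runs F L moveCmd σ Q := by
  have hadd := hB.add_le
  have hmul := hB.mul_le
  have h7 : ∀ k ∈ Set.Ici 11, 7 ≤ k := fun k hk => le_trans (by norm_num) (Set.mem_Ici.1 hk)
  set d : ℕ → ℝ := fun e => ∑ r ∈ Finset.range (m + n), σ.arr 11 r e * σ.arr 7 r v -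
    if e = v then 1 else 0 with hd
  set x := σ.arr 10 0 with hx
  have hx0 := hT.nonneg
  have hdv : d v = -1 := hT.direction_self hvN fun e _ => rfl
  refine runs_seq (runs_map1 (Set.Ici 11) {13, 21, 22, 24} (Set.Ici 12) 13 d (by simp) (by simp)
    (Set.Ici_subset_Ici.2 (by norm_num)) (by simp) hB.i2 hB.i3 (by rw [hB.i5]; omega) ?_ ?_)
  · intro e σ₁ he hF hk _
    have hB₁ := hB.fr hF h7
    have hv₁ : σ₁.idx 10 = v := by rw [hF.idx 10 (by simp), hv]
    refine runs_seq (runs_sum {12} {22, 24} ∅ 22 (fun r => σ.arr 11 r e * σ.arr 7 r v) (by simp)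
      (by simp) (by simp) (by simp) (by simp) hB₁.i2 hB₁.i3 (by rw [hB₁.i4]; omega) ?_ ?_)
    · intro r σ₂ hr hF₂ hkr
      have hB₂ := hB₁.fr hF₂ (by simp)
      refine runs_seq (runs_realOp (runs_realOp ⟨(Fr.refl.set (by simp)).set (by simp), ?_⟩))
      simp [hB₂.i2, hkr, hF₂.idx 11 (by simp), hk, hF₂.idx 10 (by simp), hv₁,
        hF₂.arr 11 (by simp), hF.arr 11 (by simp), hF₂.arr 7 (by simp), hF.arr 7 (by simp),
        RealOp.eval]
    · intro σ₂ hF₂ hsum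
      have hB₂ := hB₁.fr hF₂ (by simp)
      have hk₂ : σ₂.idx 11 = e := by rw [hF₂.idx 11 (by simp), hk]
      have hv₂ : σ₂.idx 10 = v := by rw [hF₂.idx 10 (by simp), hv₁]
      have hF₂' : Fr (Set.Ici 12) {13, 21, 22, 24} σ₁ σ₂ := hF₂.mono (by simp) (by
        intro k hk
        simp only [Set.mem_insert_iff, Set.mem_singleton_iff] at hk ⊢
        omega)
      rw [hB₁.i4] at hsum
      refine runs_seq (runs_ifEq (fun h => runs_seq (runs_realLit (runs_realOp
        (runs_copy (by simp) (by simp [hB₂.i2]) ?_)))) fun h =>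
          runs_copy (by simp) (by simp [hB₂.i2]) ?_)
      · rw [hk₂, hv₂] at h
        refine ⟨(((hF₂'.set (by simp)).set (by simp)).set (by simp)).set (by simp), ?_⟩
        intro r l
        simp [hB₂.i2, hk₂, hsum, hd, h, RealOp.eval, hF₂.arr 13 (by simp)]
      · rw [hk₂, hv₂] at h
        refine ⟨(hF₂'.set (by simp)).set (by simp), ?_⟩
        intro r l
        simp [hB₂.i2, hk₂, hsum, hd, h, hF₂.arr 13 (by simp)]
  intro σ₁ hF₁ h13
  have hB₁ := hB.fr hF₁ h7
  have hv₁ : σ₁.idx 10 = v := by rw [hF₁.idx 10 (by simp), hv]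
  refine runs_seq (runs_copy (by simp) hB₁.i2 (runs_seq ?_))
  have hF₁₀ : Fr (Set.Ici 11) {21, 24, 25} σ₁
      ((σ₁.set (sc 21) 0).set (sc 25) (σ₁.get (ve 10 10))) :=
    (Fr.refl.set (by simp)).set (by simp)
  have ht₁ : σ₁.get (ve 10 10) = x v := by
    simp [hB₁.i2, hv₁, hF₁.arr 10 (by simp), hx]
  rw [hB.i5] at h13
  -- Ratio test: the current step respects the entries from `w` on, and some decreasing entry
  -- becomes exactly `0`.
  refine runs_for (Set.Ici 11) {21, 24, 25} ∅ (fun w σ₂ => 0 ≤ σ₂.arr 25 0 0 ∧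
    (∀ e < m * n, w ≤ e → 0 ≤ x e + σ₂.arr 25 0 0 * d e) ∧
    ∃ e < m * n, d e < 0 ∧ x e + σ₂.arr 25 0 0 * d e = 0)
    (by simp) (by simp) (by simp) (by simp)
    (by simp [hB₁.i2]) (by simp [hB₁.i3]) (by simp [hB₁.i5]; omega) (fun _ _ _ h => h) ?_ ?_ ?_
  · simp only [Store.set_idx, Store.set_arr, hB₁.i2, hB₁.i5, and_self, if_true, ht₁]
    exact ⟨hxv.le, fun e h1 h2 => by omega, v, hvN, by rw [hdv]; norm_num, by rw [hdv]; ring⟩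
  · rintro w σ₂ hw hF₂ hkw ⟨ht0, hall, e₀, he₀, hde₀, hxe₀⟩
    simp only [Store.set_idx, hB₁.i5] at hw
    have hF₂' := hF₁₀.trans hF₂
    have hB₂ := hB₁.fr hF₂' h7
    have ed : σ₂.arr 13 0 w = d w := by
      rw [hF₂'.arr 13 (by simp), h13, if_pos ⟨rfl, hw⟩]
    have ex : σ₂.arr 10 0 w = x w := by
      rw [hF₂'.arr 10 (by simp), hF₁.arr 10 (by simp)]
    set t := σ₂.arr 25 0 0 with ht
    refine runs_seq (runs_realOp (runs_seq (runs_realOp (runs_seq (runs_realLit (runs_ite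
      (fun h => runs_skip ?_) fun h => runs_seq (runs_realOp (runs_realOp ?_))))))))
    · refine ⟨((Fr.refl.set (by simp)).set (by simp)).set (by simp), ?_⟩
      simp only [Test.Holds, RealOp.eval, Store.get_def, Store.set_idx, Store.set_arr, hkw,
        hB₂.i2, ed, ex, and_self, if_true, Nat.reduceEqDiff, false_and, if_false, ← ht,
        Nat.cast_zero] at h
      simp only [Store.set_arr, Nat.reduceEqDiff, false_and, if_false, ← ht]
      refine ⟨ht0, fun e he hwe => ?_, e₀, he₀, hde₀, hxe₀⟩
      rcases hwe.eq_or_lt with rfl | hwe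
      · exact h
      · exact hall e he hwe
    · refine ⟨((((Fr.refl.set (by simp)).set (by simp)).set (by simp)).set (by simp)).set
        (by simp), ?_⟩
      simp only [Test.Holds, RealOp.eval, Store.get_def, Store.set_idx, Store.set_arr, hkw,
        hB₂.i2, ed, ex, and_self, if_true, Nat.reduceEqDiff, false_and, if_false, ← ht,
        Nat.cast_zero] at h
      simp only [RealOp.eval, Store.get_def, Store.set_idx, Store.set_arr, hkw,
        hB₂.i2, ed, ex, and_self, if_true, Nat.reduceEqDiff, false_and, if_false, Nat.cast_zero,
        zero_sub]
      push Not at h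
      have hxw := hx0 w hw
      have hdw : d w < 0 := by
        by_contra! h0
        have := mul_nonneg ht0 h0
        linarith
      have hlt : x w / -d w ≤ t := by
        rw [div_le_iff₀ (by linarith)]
        linarith
      have hnn : 0 ≤ x w / -d w := div_nonneg hxw (by linarith)
      have hzero : x w + x w / -d w * d w = 0 := by
        rw [div_neg, neg_mul, div_mul_cancel₀ _ hdw.ne]
        ring
      refine ⟨hnn, fun e he hwe => ?_, w, hw, hdw, hzero⟩
      rcases hwe.eq_or_lt with rfl | hwe
      · exact hzero.ge
      · have h1 := hall e he hwe
        have h2 := hx0 e he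
        -- The step has become shorter. Non-decreasing entries are safe anyway, and decreasing ones
        -- fall less than with the old step.
        rcases le_total 0 (d e) with h3 | h3
        · positivity
        · nlinarith
  rintro σ₂ hF₂ ⟨ht0, hall, e₀, he₀, hde₀, hxe₀⟩
  have hF₂' := hF₁₀.trans hF₂
  have hB₂ := hB₁.fr hF₂' h7
  set t := σ₂.arr 25 0 0 with ht
  refine runs_map1 (Set.Ici 11) {10, 24} ∅ 10 (fun e => x e + t * d e) (by simp) (by simp)
    (by simp) (by simp) hB₂.i2 hB₂.i3 (by rw [hB₂.i5]; omega) ?_ ?_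
  · intro e σ₃ he hF₃ hke hsame
    have hB₃ := hB₂.fr hF₃ h7
    rw [hB₂.i5] at he
    have ed : σ₃.arr 13 0 e = d e := by
      rw [hF₃.arr 13 (by simp), hF₂'.arr 13 (by simp), h13, if_pos ⟨rfl, he⟩]
    have ex : σ₃.arr 10 0 e = x e := by
      rw [hsame, hF₂'.arr 10 (by simp), hF₁.arr 10 (by simp)]
    refine runs_seq (runs_realOp (runs_realOp ⟨(Fr.refl.set (by simp)).set (by simp), ?_⟩))
    intro r l
    simp [hB₃.i2, hke, ed, ex, hF₃.arr 25 (by simp), ← ht, RealOp.eval]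
  intro σ₃ hF₃ hx₃
  rw [hB₂.i5] at hx₃
  have hxe : ∀ e < m * n, σ₃.arr 10 0 e = x e + t * d e := fun e he => by
    rw [hx₃, if_pos ⟨rfl, he⟩]
  have e7 : σ₃.arr 7 = σ.arr 7 := by
    rw [hF₃.arr 7 (by simp), hF₂'.arr 7 (by simp), hF₁.arr 7 (by simp)]
  have e11 : σ₃.arr 11 = σ.arr 11 := by
    rw [hF₃.arr 11 (by simp), hF₂'.arr 11 (by simp), hF₁.arr 11 (by simp)]
  refine hQ σ₃ ?_ ?_ ?_
  · refine (hF₁.mono subset_rfl ?_).trans ((hF₂'.mono subset_rfl ?_).trans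
      (hF₃.mono subset_rfl ?_)) <;>
    · intro k hk
      simp only [Set.mem_insert_iff, Set.mem_singleton_iff] at hk ⊢
      omega
  · rw [e7, e11]
    exact hT.move hvN hxv.ne' hfree (fun e _ => rfl) hxe fun e he => by
      rw [hxe e he]
      exact hall e he (Nat.zero_le _)
  · rw [e7]
    by_cases hev : e₀ = v
    · left
      rw [← hev, hxe e₀ he₀, hxe₀]
    · right
      obtain ⟨r, hr, hb, hne⟩ := hT.exists_bas_of_direction (fun e _ => rfl) he₀ hev hde₀.ne
      exact ⟨r, hr, e₀, hb, by rw [hxe e₀ he₀, hxe₀], hne⟩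

/-- The new tableau is assembled in array `8` and then copied back, since the pivot row and column
are read throughout the elimination. -/
def pivotCmd : Cmd :=
  .seq (.for 11 4 <| .for 12 5 <|
    .seq (.realOp .div (sc 24) ⟨7, 7, 12⟩ ⟨7, 7, 10⟩) <|
    .seq (.realOp .mul (sc 26) ⟨7, 11, 10⟩ (sc 24)) <|
    .seq (.realOp .sub ⟨8, 11, 12⟩ ⟨7, 11, 12⟩ (sc 26)) <|
    .ifEq 11 7 (.copy ⟨8, 11, 12⟩ (sc 24))) <|
  .seq (.for 11 4 <| .for 12 5 <| .copy ⟨7, 11, 12⟩ ⟨8, 11, 12⟩) <|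
  .realLit ⟨11, 7, 10⟩ 1

theorem runs_pivot (hB : Base m n L σ) (hv : σ.idx 10 = v) (hvN : v < m * n)
    (hT : Tableau (m + n) (m * n) (v + 1) V x₀ (σ.arr 7) (σ.arr 11) (σ.arr 10 0) bas)
    (hx₀ : x₀ v ≠ 0) (hs : σ.idx 7 < m + n) (hb : bas (σ.idx 7) = none)
    (hTs : σ.arr 7 (σ.idx 7) v ≠ 0)
    (hQ : ∀ σ' bas', Fr (Set.Ici 11) {7, 8, 11, 21, 24, 26} σ σ' →
      Tableau (m + n) (m * n) v V x₀ (σ'.arr 7) (σ'.arr 11) (σ'.arr 10 0) bas' → Q σ') :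
    Runs F L pivotCmd σ Q := by
  have hadd := hB.add_le
  have hmul := hB.mul_le
  have h7 : ∀ k ∈ Set.Ici 11, 7 ≤ k := fun k hk => le_trans (by norm_num) (Set.mem_Ici.1 hk)
  set s := σ.idx 7 with hsd
  refine runs_seq (runs_map2 (Set.Ici 11) {8, 21, 24, 26} (Set.Ici 13) 8
    (fun r e => if r = s then σ.arr 7 s e / σ.arr 7 s v
      else σ.arr 7 r e - σ.arr 7 r v * (σ.arr 7 s e / σ.arr 7 s v)) (by simp) (by simp) (by simp)
    (by simp) (by simp) (by simp) (Set.Ici_subset_Ici.2 (by norm_num)) (by simp) (by simp) hB.i2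
    hB.i3 (by rw [hB.i4]; omega) (by rw [hB.i5]; omega) ?_ ?_)
  · intro r e σ₁ hr he hF hkr hke _
    have hB₁ := hB.fr hF h7
    have e10 : σ₁.idx 10 = v := by rw [hF.idx 10 (by simp), hv]
    have e7 : σ₁.idx 7 = s := by rw [hF.idx 7 (by simp)]
    refine runs_seq (runs_realOp (runs_seq (runs_realOp (runs_seq (runs_realOp (runs_ifEq
      (fun h => runs_copy (by simp) (by simp [hB₁.i2]) ?_) fun h => ?_))))))
    · refine ⟨((((Fr.refl.set (by simp)).set (by simp)).set (by simp)).set (by simp)).set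
        (by simp), ?_⟩
      simp only [Store.set_idx, hkr, e7] at h
      intro r' l
      simp only [RealOp.eval, Store.get_def, Store.set_idx, Store.set_arr, hkr, hke, e10, e7,
        hB₁.i2, hF.arr 7 (by simp), and_self, if_true, Nat.reduceEqDiff, false_and, if_false,
        true_and]
      rw [if_pos h]
      split_ifs <;> rfl
    · refine ⟨((Fr.refl.set (by simp)).set (by simp)).set (by simp), ?_⟩
      simp only [Store.set_idx, hkr, e7] at h
      intro r' l
      simp only [RealOp.eval, Store.get_def, Store.set_idx, Store.set_arr, hkr, hke, e10, e7,
        hB₁.i2, hF.arr 7 (by simp), and_self, if_true, Nat.reduceEqDiff, false_and, if_false,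
        true_and]
      rw [if_neg h]
  intro σ₁ hF₁ h8
  have hB₁ := hB.fr hF₁ h7
  rw [hB.i4, hB.i5] at h8
  refine runs_seq (runs_map2 (Set.Ici 11) {7, 21} (Set.Ici 13) 7 (fun r e => σ₁.arr 8 r e)
    (by simp) (by simp) (by simp)
    (by simp) (by simp) (by simp) (Set.Ici_subset_Ici.2 (by norm_num)) (by simp) (by simp) hB₁.i2
    hB₁.i3 (by rw [hB₁.i4]; omega) (by rw [hB₁.i5]; omega) ?_ ?_)
  · intro r e σ₂ hr he hF hkr hke _
    have hB₂ := hB₁.fr hF h7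
    refine runs_copy (by simp) hB₂.i2 ⟨(Fr.refl.set (by simp)).set (by simp), ?_⟩
    intro r' l
    simp [hkr, hke, hF.arr 8 (by simp)]
  intro σ₂ hF₂ h7'
  rw [hB₁.i4, hB₁.i5] at h7'
  have e10 : σ₂.idx 10 = v := by rw [hF₂.idx 10 (by simp), hF₁.idx 10 (by simp), hv]
  have e7 : σ₂.idx 7 = s := by rw [hF₂.idx 7 (by simp), hF₁.idx 7 (by simp)]
  refine runs_realLit (hQ _ (Function.update bas s (some v)) ?_ ?_)
  · refine Fr.set ((hF₁.mono subset_rfl ?_).trans (hF₂.mono subset_rfl ?_)) (by simp) <;>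
    · intro k hk
      simp only [Set.mem_insert_iff, Set.mem_singleton_iff] at hk ⊢
      omega
  · have e10' : (σ₂.set ⟨11, 7, 10⟩ (1 : ℕ)).arr 10 0 = σ.arr 10 0 := by
      rw [Store.set_arr_ne _ _ _ (by simp), hF₂.arr 10 (by simp), hF₁.arr 10 (by simp)]
    rw [e10']
    refine hT.pivot hvN hs hx₀ hb hTs ?_ ?_
    · intro r hr e he
      simp only [Store.set_arr, Nat.reduceEqDiff, false_and, if_false]
      rw [h7', if_pos ⟨hr, he⟩, h8, if_pos ⟨hr, he⟩]
    · intro r hr e he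
      simp [e7, e10, hF₂.arr 11 (by simp), hF₁.arr 11 (by simp)]

/-- A column of the support either finds a free pivot row or depends on the basis. In the second
case `moveCmd` annihilates column `v` itself or a basic column whose row meets `v`; dropping the
latter frees a pivot row, so after a second refresh the column is disposed of either way. -/
def basicCmd : Cmd :=
  .for 10 5 <| .ifNonpos (ve 10 10) .skip <|
    .seq refreshCmd <|
    .seq (.ifNonpos (sc 23) (.seq moveCmd refreshCmd) .skip) <|
    .ifNonpos (sc 23) .skip pivotCmd

/-- The program `basicCmd` makes the columns of the support of the solution independent. -/
theorem runs_basic (hB : Base m n L σ)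
    (hT : Tableau (m + n) (m * n) (m * n) V x₀ (σ.arr 7) (σ.arr 11) (σ.arr 10 0) bas)
    (hQ : ∀ σ' bas', Fr (insert 7 (Set.Ici 10)) {7, 8, 10, 11, 12, 13, 21, 22, 23, 24, 25, 26} σ σ' →
      Tableau (m + n) (m * n) 0 V x₀ (σ'.arr 7) (σ'.arr 11) (σ'.arr 10 0) bas' → Q σ') :
    Runs F L basicCmd σ Q := by
  have hmul := hB.mul_le
  have h7 : ∀ k ∈ insert 7 (Set.Ici 10), 7 ≤ k := by
    intro k hk
    simp only [Set.mem_insert_iff, Set.mem_Ici] at hk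
    omega
  have h7' : ∀ k ∈ insert 7 (Set.Ici 11), 7 ≤ k := by
    intro k hk
    simp only [Set.mem_insert_iff, Set.mem_Ici] at hk
    omega
  refine runs_for (insert 7 (Set.Ici 10)) {7, 8, 10, 11, 12, 13, 21, 22, 23, 24, 25, 26}
    (insert 7 (Set.Ici 11)) (fun v σ₁ => ∃ bas,
      Tableau (m + n) (m * n) v V x₀ (σ₁.arr 7) (σ₁.arr 11) (σ₁.arr 10 0) bas) (by simp) (by simp)
    (Set.insert_subset_insert (Set.Ici_subset_Ici.2 (by norm_num))) (by simp) hB.i2 hB.i3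
    (by rw [hB.i5]; omega) (fun _ _ _ h => h) ⟨bas, by rw [hB.i5]; exact hT⟩ ?_
    fun σ' hF ⟨bas', h⟩ => hQ σ' bas' hF h
  rintro v σ₁ hv hF₁ hkv ⟨bas₁, hT₁⟩
  rw [hB.i5] at hv
  have hB₁ := hB.fr hF₁ h7
  have hxv : σ₁.get (ve 10 10) = σ₁.arr 10 0 v := by simp [hB₁.i2, hkv]
  refine runs_ifNonpos (by simp) hB₁.i2 (fun h => runs_skip ?_) fun h => ?_
  · rw [hxv] at h
    exact ⟨Fr.refl.set (by simp), bas₁, hT₁.skip (le_antisymm h (hT₁.nonneg v hv))⟩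
  rw [hxv] at h
  have hx₀v : x₀ v ≠ 0 := fun h0 => h.ne' (hT₁.supp v hv h0)
  have hF₁' : Fr (insert 7 (Set.Ici 11)) {7, 8, 10, 11, 12, 13, 21, 22, 23, 24, 25, 26} σ₁
    (σ₁.set (sc 21) 0) := Fr.refl.set (by simp)
  refine runs_seq (runs_refresh (hB₁.fr hF₁' h7') (by simpa using hkv) hT₁ ?_)
  intro σ₂ bas₂ hF₂ hT₂ hbas₂ hcase
  have hF₂' : Fr (insert 7 (Set.Ici 11)) {7, 8, 10, 11, 12, 13, 21, 22, 23, 24, 25, 26} σ₁ σ₂ := by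
    refine hF₁'.trans (hF₂.mono subset_rfl ?_)
    intro k hk
    simp only [Set.mem_insert_iff, Set.mem_singleton_iff] at hk ⊢
    omega
  have hB₂ := hB₁.fr hF₂' h7'
  have hv₂ : σ₂.idx 10 = v := by rw [hF₂'.idx 10 (by simp), hkv]
  have hx₂ : σ₂.arr 10 0 v = σ₁.arr 10 0 v := by
    rw [hF₂.arr 10 (by simp), Store.set_arr_ne _ _ _ (by simp)]
  have h23 : σ₂.get (sc 23) = σ₂.arr 23 0 0 := by simp [hB₂.i2]
  have hpiv : ∀ (σ₃ : Store) (bas₃ : ℕ → Option ℕ),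
      Fr (insert 7 (Set.Ici 11)) {7, 8, 10, 11, 12, 13, 21, 22, 23, 24, 25, 26} σ₁ σ₃ →
      Tableau (m + n) (m * n) (v + 1) V x₀ (σ₃.arr 7) (σ₃.arr 11) (σ₃.arr 10 0) bas₃ →
      ((σ₃.arr 23 0 0 = 1 ∧ σ₃.idx 7 < m + n ∧ bas₃ (σ₃.idx 7) = none ∧
          σ₃.arr 7 (σ₃.idx 7) v ≠ 0) ∨ (σ₃.arr 23 0 0 = 0 ∧ σ₃.arr 10 0 v = 0)) →
      Runs F L (.ifNonpos (sc 23) .skip pivotCmd) σ₃ fun σ' =>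
        Fr (insert 7 (Set.Ici 11)) {7, 8, 10, 11, 12, 13, 21, 22, 23, 24, 25, 26} σ₁ σ' ∧
          ∃ bas', Tableau (m + n) (m * n) v V x₀ (σ'.arr 7) (σ'.arr 11) (σ'.arr 10 0) bas' := by
    intro σ₃ bas₃ hF₃ hT₃ hcase
    have hB₃ := hB₁.fr hF₃ h7'
    have hv₃ : σ₃.idx 10 = v := by rw [hF₃.idx 10 (by simp), hkv]
    have h23 : σ₃.get (sc 23) = σ₃.arr 23 0 0 := by simp [hB₃.i2]
    have hF₃' : Fr (insert 7 (Set.Ici 11)) {7, 8, 10, 11, 12, 13, 21, 22, 23, 24, 25, 26} σ₃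
      (σ₃.set (sc 21) 0) := Fr.refl.set (by simp)
    refine runs_ifNonpos (by simp) hB₃.i2 (fun h => runs_skip ?_) fun h => ?_
    · rw [h23] at h
      rcases hcase with hc | hc
      · rw [hc.1] at h
        norm_num at h
      · exact ⟨hF₃.trans hF₃', bas₃, hT₃.skip hc.2⟩
    · rw [h23] at h
      rcases hcase with hc | hc
      · refine runs_pivot (hB₃.fr hF₃' h7') (by simpa using hv₃) hv hT₃ hx₀v hc.2.1 hc.2.2.1
          hc.2.2.2 ?_
        intro σ₄ bas₄ hF₄ hT₄
        refine ⟨(hF₃.trans hF₃').trans (hF₄.mono (by simp) ?_), bas₄, hT₄⟩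
        intro k hk
        simp only [Set.mem_insert_iff, Set.mem_singleton_iff] at hk ⊢
        omega
      · rw [hc.1] at h
        exact absurd h (lt_irrefl _)
  refine runs_seq (runs_ifNonpos (by simp) hB₂.i2 (fun h' => ?_) fun h' => runs_skip ?_)
  · rw [h23] at h'
    rcases hcase with hc | hc
    · rw [hc.1] at h'
      norm_num at h'
    have hF₂'' : Fr (insert 7 (Set.Ici 11)) {7, 8, 10, 11, 12, 13, 21, 22, 23, 24, 25, 26} σ₁
      (σ₂.set (sc 21) 0) := hF₂'.set (by simp)
    refine runs_seq (runs_move (hB₁.fr hF₂'' h7') (by simpa using hv₂) hv hT₂ hc.2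
      (lt_of_lt_of_eq h hx₂.symm) ?_)
    intro σ₃ hF₃ hT₃ hcase₃
    have hF₃' : Fr (insert 7 (Set.Ici 11)) {7, 8, 10, 11, 12, 13, 21, 22, 23, 24, 25, 26} σ₁
        σ₃ := by
      refine hF₂''.trans (hF₃.mono (by simp) ?_)
      intro k hk
      simp only [Set.mem_insert_iff, Set.mem_singleton_iff] at hk ⊢
      omega
    refine runs_refresh (hB₁.fr hF₃' h7') (by rw [hF₃'.idx 10 (by simp), hkv]) hT₃ ?_
    intro σ₄ bas₄ hF₄ hT₄ hbas₄ hcase₄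
    have e7 : σ₄.arr 7 = σ₃.arr 7 := hF₄.arr 7 (by simp)
    have e10 : σ₄.arr 10 = σ₃.arr 10 := hF₄.arr 10 (by simp)
    refine hpiv σ₄ bas₄ ?_ hT₄ (hcase₄.imp id fun hc₄ => ⟨hc₄.1, ?_⟩)
    · refine hF₃'.trans (hF₄.mono subset_rfl ?_)
      intro k hk
      simp only [Set.mem_insert_iff, Set.mem_singleton_iff] at hk ⊢
      omega
    · rw [e10]
      -- Had a basic entry vanished instead, the second refresh would have dropped it from the basis
      -- and its row would be a free row with a nonzero entry in column `v`.
      refine hcase₃.resolve_right ?_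
      rintro ⟨r, hr, e, hbe, hxe, hne⟩
      refine hne ?_
      rw [← e7]
      refine hc₄.2 r hr ?_
      rw [Option.eq_none_iff_forall_ne_some]
      intro e' he'
      obtain ⟨h1, h2⟩ := (hbas₄ r hr e').1 he'
      rw [hbe, Option.some_inj] at h1
      exact h2 (h1 ▸ hxe)
  · rw [h23] at h'
    rcases hcase with hc | hc
    · refine hpiv _ bas₂ (hF₂'.set (by simp)) hT₂ (Or.inl ?_)
      simpa using hc
    · rw [hc.1] at h'
      exact absurd h' (lt_irrefl _)

end

end

section

/-! #### Matching edges with incident vertices -/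

/-- A partial matching `asg` of the edges in `E₀`, with the remaining edges `E` and the remaining
vertices `U`, and the indicator functions of both sets. -/
structure PartialMatching (m n k : ℕ) (E₀ : Finset ℕ) (E U : Finset ℕ) (rem cap : ℕ → ℝ)
    (asg : ℕ → ℕ → ℝ) : Prop where
  edge : E₀ ⊆ Finset.range (m * n)
  sub : E ⊆ E₀
  card_le : E.card ≤ k
  vert : U ⊆ Finset.range (m + n)
  rem_eq : ∀ e < m * n, rem e = if e ∈ E then 1 else 0
  cap_eq : ∀ r < m + n, cap r = if r ∈ U then 1 else 0
  hall : Hall (IsEnd m n) E U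
  asg_eq : ∀ r < m + n, ∀ e < m * n, asg r e = 0 ∨ (asg r e = 1 ∧ IsEnd m n r e ∧ r ∉ U ∧ e ∈ E₀)
  exists_asg : ∀ e ∈ E₀, e ∉ E → ∃ r < m + n, asg r e = 1
  unique : ∀ r < m + n, ∀ e < m * n, ∀ e' < m * n, asg r e = 1 → asg r e' = 1 → e = e'

namespace PartialMatching

variable {m n k : ℕ} {E₀ E U : Finset ℕ} {rem cap : ℕ → ℝ} {asg : ℕ → ℕ → ℝ}

theorem card_isEnd_le (U : Finset ℕ) (m n e : ℕ) :
    (U.filter fun r => IsEnd m n r e).card ≤ 2 := by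
  refine (Finset.card_le_card (t := {m + e % n, e / n}) fun r hr => ?_).trans Finset.card_le_two
  simpa [IsEnd] using (Finset.mem_filter.1 hr).2

theorem assign (h : PartialMatching m n (k + 1) E₀ E U rem cap asg)
    {r e : ℕ} (hr : r ∈ U) (he : e ∈ E) (heN : e < m * n) (hre : IsEnd m n r e)
    (hmin : ∀ r' ∈ U, ∀ e' ∈ E, IsEnd m n r' e' →
      (E.filter fun e => IsEnd m n r e).card ≤ (E.filter fun e => IsEnd m n r' e).card)
    {rem' cap' : ℕ → ℝ} {asg' : ℕ → ℕ → ℝ}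
    (hrem : ∀ f < m * n, rem' f = if f = e then 0 else rem f)
    (hcap : ∀ q < m + n, cap' q = if q = r then 0 else cap q)
    (hasg : ∀ q < m + n, ∀ f < m * n, asg' q f = if q = r ∧ f = e then 1 else asg q f) :
    PartialMatching m n k E₀ (E.erase e) (U.erase r) rem' cap' asg' := by
  have hrR : r < m + n := Finset.mem_range.1 (h.vert hr)
  refine ⟨h.edge, (Finset.erase_subset _ _).trans h.sub, ?_, (Finset.erase_subset _ _).trans h.vert,
    ?_, ?_, h.hall.erase (fun e _ => card_isEnd_le U m n e) hr he hre hmin, ?_, ?_, ?_⟩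
  · rw [Finset.card_erase_of_mem he]
    have := h.card_le
    omega
  · intro f hf
    rw [hrem f hf, h.rem_eq f hf]
    by_cases hfe : f = e <;> simp [hfe]
  · intro q hq
    rw [hcap q hq, h.cap_eq q hq]
    by_cases hqr : q = r <;> simp [hqr]
  · intro q hq f hf
    rw [hasg q hq f hf]
    split_ifs with hc
    · obtain ⟨rfl, rfl⟩ := hc
      exact Or.inr ⟨rfl, hre, by simp, h.sub he⟩
    · exact (h.asg_eq q hq f hf).imp id fun ⟨h1, h2, h3, h4⟩ =>
        ⟨h1, h2, fun h' => h3 (Finset.mem_of_mem_erase h'), h4⟩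
  · intro f hf hfE
    by_cases hfe : f = e
    · subst hfe
      exact ⟨r, hrR, by rw [hasg r hrR _ heN]; simp⟩
    · obtain ⟨q, hq, hq1⟩ := h.exists_asg f hf fun h' => hfE (Finset.mem_erase.2 ⟨hfe, h'⟩)
      refine ⟨q, hq, ?_⟩
      rw [hasg q hq f (Finset.mem_range.1 (h.edge hf)), if_neg (by simp [hfe]), hq1]
  -- The vertex `r` was still available, so no edge had been matched with it.
  · have key : ∀ f < m * n, asg r f ≠ 1 := by
      intro f hf h1
      rcases h.asg_eq r hrR f hf with h0 | ⟨-, -, h0, -⟩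
      · rw [h0] at h1
        norm_num at h1
      · exact h0 hr
    intro q hq f hf f' hf' h1 h2
    rw [hasg q hq f hf] at h1
    rw [hasg q hq f' hf'] at h2
    by_cases hqr : q = r
    · subst hqr
      by_cases hfe : f = e
      · by_cases hfe' : f' = e
        · rw [hfe, hfe']
        · rw [if_neg (by simp [hfe'])] at h2
          exact absurd h2 (key f' hf')
      · rw [if_neg (by simp [hfe])] at h1
        exact absurd h1 (key f hf)
    · simp only [hqr, false_and, if_false] at h1 h2
      exact h.unique q hq f hf f' hf' h1 h2

/-- Hall's condition for single edges gives every remaining edge an available end. If no pair is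
left there is no edge left, and the bound on their number may drop. -/
theorem of_empty (h : PartialMatching m n (k + 1) E₀ E U rem cap asg)
    (hne : ∀ r ∈ U, ∀ e ∈ E, ¬ IsEnd m n r e) : PartialMatching m n k E₀ E U rem cap asg := by
  have : E = ∅ := by
    by_contra hE
    obtain ⟨e, he⟩ := Finset.nonempty_iff_ne_empty.2 hE
    obtain ⟨r, hr, hre⟩ := h.hall.exists_inc he
    exact hne r hr e he hre
  exact { h with card_le := by simp [this] }

end PartialMatching

def bestCmd : Cmd :=
  .seq (.realLit (sc 23) 1) <| .seq (.copy (sc 25) (ve 17 11)) <|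
    .seq (.idxAdd 7 11 2) (.idxAdd 8 12 2)

/-- The product of three indicators is positive exactly for a remaining vertex with a remaining
incident edge. Cell `25` keeps the smallest degree seen so far, and registers `7` and `8` the pair
that attains it. -/
def findCmd : Cmd :=
  .seq (.realLit (sc 23) 0) <|
  .for 11 4 <| .for 12 5 <|
    .seq (.realOp .mul (sc 24) (ve 14 12) ⟨9, 11, 12⟩) <|
    .seq (.realOp .mul (sc 24) (ve 15 11) (sc 24)) <|
    .ifNonpos (sc 24) .skip <| .ifNonpos (sc 23) bestCmd <|
      .ite (.realLe (sc 25) (ve 17 11)) .skip bestCmd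

def degreeCmd : Cmd :=
  .for 11 4 <| .seq
    (.seq (.realLit (sc 22) 0) <| .for 12 5 <|
      .seq (.realOp .mul (sc 24) (ve 14 12) ⟨9, 11, 12⟩) (.realOp .add (sc 22) (sc 22) (sc 24)))
    (.copy (ve 17 11) (sc 22))

/-- Arrays `14` and `15` indicate the remaining edges and vertices, array `16` is the matching. Each
round serves an edge at a vertex of minimal positive degree, recomputing all degrees; `m * n` rounds
exhaust the edges. -/
def matchCmd : Cmd :=
  .seq (.for 10 5 <| .ifNonpos (ve 10 10) (.realLit (ve 14 10) 0) (.realLit (ve 14 10) 1)) <|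
  .seq (.for 10 4 <| .realLit (ve 15 10) 1) <|
  .seq (.for 10 4 <| .for 11 5 <| .realLit ⟨16, 10, 11⟩ 0) <|
  .for 10 5 <| .seq degreeCmd <| .seq findCmd <|
    .ifNonpos (sc 23) .skip <|
      .seq (.realLit ⟨16, 7, 8⟩ 1) <| .seq (.realLit (ve 14 8) 0) (.realLit (ve 15 7) 0)

section

variable {m n : ℕ} {F : ℕ → ℝ → ℝ} {L : ℕ} {σ : Store} {Q : Store → Prop} {k : ℕ}
  {E₀ E U : Finset ℕ}

theorem runs_degree (hB : Base m n L σ)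
    (hQ : ∀ σ', Fr (Set.Ici 11) {17, 21, 22, 24} σ σ' →
      (∀ r < m + n, σ'.arr 17 0 r = ∑ e ∈ Finset.range (m * n), σ.arr 14 0 e * σ.arr 9 r e) →
      Q σ') : Runs F L degreeCmd σ Q := by
  have hadd := hB.add_le
  have hmul := hB.mul_le
  have h7 : ∀ k ∈ Set.Ici 11, 7 ≤ k := fun k hk => le_trans (by norm_num) (Set.mem_Ici.1 hk)
  refine runs_map1 (Set.Ici 11) {17, 21, 22, 24} (Set.Ici 12) 17
    (fun r => ∑ e ∈ Finset.range (m * n), σ.arr 14 0 e * σ.arr 9 r e) (by simp) (by simp)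
    (Set.Ici_subset_Ici.2 (by norm_num)) (by simp) hB.i2 hB.i3 (by rw [hB.i4]; omega) ?_ ?_
  · intro r σ₁ hr hF hk _
    have hB₁ := hB.fr hF h7
    refine runs_seq (runs_sum {12} {22, 24} ∅ 22 (fun e => σ.arr 14 0 e * σ.arr 9 r e) (by simp)
      (by simp) (by simp) (by simp) (by simp) hB₁.i2 hB₁.i3 (by rw [hB₁.i5]; omega) ?_ ?_)
    · intro e σ₂ he hF₂ hke
      have hB₂ := hB₁.fr hF₂ (by simp)
      refine runs_seq (runs_realOp (runs_realOp ⟨(Fr.refl.set (by simp)).set (by simp), ?_⟩))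
      simp [hB₂.i2, hke, hF₂.idx 11 (by simp), hk, hF₂.arr 14 (by simp), hF.arr 14 (by simp),
        hF₂.arr 9 (by simp), hF.arr 9 (by simp), RealOp.eval]
    · intro σ₂ hF₂ hsum
      have hB₂ := hB₁.fr hF₂ (by simp)
      rw [hB₁.i5] at hsum
      refine runs_copy (by simp) hB₂.i2 ⟨((hF₂.mono (by simp) ?_).set (by simp)).set
        (by simp), fun r' l => ?_⟩
      · intro k hk
        simp only [Set.mem_insert_iff, Set.mem_singleton_iff] at hk ⊢
        omega
      · simp [hB₂.i2, hF₂.idx 11 (by simp), hk, hsum, hF₂.arr 17 (by simp)]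
  · intro σ' hF h
    refine hQ σ' hF fun r hr => ?_
    rw [h, hB.i4, if_pos ⟨rfl, hr⟩]

/-- Among the pairs of a vertex and an edge with `P` that may be matched, the one in the registers
`7` and `8` has a vertex of minimal degree. -/
def IsBest (m n : ℕ) (valid : ℕ → ℕ → Prop) (deg : ℕ → ℝ) (P : ℕ → ℕ → Prop) (σ : Store) : Prop :=
  (σ.arr 23 0 0 = 0 ∧ ∀ r < m + n, ∀ e < m * n, P r e → ¬ valid r e) ∨
    (σ.arr 23 0 0 = 1 ∧ σ.idx 7 < m + n ∧ σ.idx 8 < m * n ∧ valid (σ.idx 7) (σ.idx 8) ∧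
      σ.arr 25 0 0 = deg (σ.idx 7) ∧
      ∀ r < m + n, ∀ e < m * n, P r e → valid r e → deg (σ.idx 7) ≤ deg r)

theorem runs_find (hB : Base m n L σ) {valid : ℕ → ℕ → Prop} {deg : ℕ → ℝ}
    (hvalid : ∀ r < m + n, ∀ e < m * n,
      0 < σ.arr 15 0 r * (σ.arr 14 0 e * σ.arr 9 r e) ↔ valid r e)
    (hdeg : ∀ r < m + n, σ.arr 17 0 r = deg r)
    (hQ : ∀ σ', Fr (insert 7 (insert 8 (Set.Ici 11))) {21, 23, 24, 25} σ σ' →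
      IsBest m n valid deg (fun _ _ => True) σ' → Q σ') :
    Runs F L findCmd σ Q := by
  have hadd := hB.add_le
  have hmul := hB.mul_le
  have h7 : ∀ k ∈ insert 7 (insert 8 (Set.Ici 11)), 7 ≤ k := by
    intro k hk
    simp only [Set.mem_insert_iff, Set.mem_Ici] at hk
    omega
  have h7' : ∀ k ∈ insert 7 (insert 8 (Set.Ici 12)), 7 ≤ k := by
    intro k hk
    simp only [Set.mem_insert_iff, Set.mem_Ici] at hk
    omega
  refine runs_seq (runs_realLit ?_)
  have hF₀ : Fr (insert 7 (insert 8 (Set.Ici 11))) {21, 23, 24, 25} σ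
    (σ.set (sc 23) (0 : ℕ)) := Fr.refl.set (by simp)
  have hB₀ := hB.fr hF₀ h7
  refine runs_for (insert 7 (insert 8 (Set.Ici 11))) {21, 23, 24, 25}
    (insert 7 (insert 8 (Set.Ici 12)))
    (fun w => IsBest m n valid deg fun r _ => w ≤ r) (by simp) (by simp)
    (Set.insert_subset_insert (Set.insert_subset_insert (Set.Ici_subset_Ici.2 (by norm_num))))
    (by simp) hB₀.i2 hB₀.i3 (by rw [hB₀.i4]; omega) ?_ ?_ ?_ ?_
  · intro v w σ' h
    simpa [IsBest] using h
  · left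
    rw [hB₀.i4]
    exact ⟨by simp [hB.i2], fun r hr e _ h => by omega⟩
  · intro w σ₁ hw hF₁ hkw hI
    rw [hB₀.i4] at hw
    have hF₁' := hF₀.trans hF₁
    have hB₁ := hB.fr hF₁' h7
    refine runs_for (insert 7 (insert 8 (Set.Ici 12))) {21, 23, 24, 25} {7, 8}
      -- The pairs already inspected are those from `(w, u)` on in lexicographic order, as both
      -- loops count down.
      (fun u => IsBest m n valid deg fun r e => w + 1 ≤ r ∨ (r = w ∧ u ≤ e)) (by simp) (by simp)
      (by intro k hk; simp only [Set.mem_insert_iff, Set.mem_singleton_iff] at hk ⊢; omega)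
      (by simp) hB₁.i2 hB₁.i3 (by rw [hB₁.i5]; omega) ?_ ?_ ?_ ?_
    · intro v w σ' h
      simpa [IsBest] using h
    · rw [hB₁.i5]
      refine hI.imp (fun h => ⟨h.1, fun r hr e he hp => ?_⟩) fun h =>
        ⟨h.1, h.2.1, h.2.2.1, h.2.2.2.1, h.2.2.2.2.1, fun r hr e he hp => ?_⟩
      · exact h.2 r hr e he (by omega)
      · exact h.2.2.2.2.2 r hr e he (by omega)
    · intro u σ₂ hu hF₂ hku hI₂
      rw [hB₁.i5] at hu
      have hF₂' : Fr (insert 7 (insert 8 (Set.Ici 11))) {21, 23, 24, 25} σ σ₂ :=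
        hF₁'.trans (hF₂.mono (Set.insert_subset_insert
          (Set.insert_subset_insert (Set.Ici_subset_Ici.2 (by norm_num)))) subset_rfl)
      have hB₂ := hB.fr hF₂' h7
      have ek : σ₂.idx 11 = w := by rw [hF₂.idx 11 (by simp), hkw]
      have hbest : ∀ σ₃ : Store, Fr {7, 8} {21, 23, 24, 25} σ₂ σ₃ → valid w u →
          (∀ r < m + n, ∀ e < m * n, (w + 1 ≤ r ∨ (r = w ∧ u + 1 ≤ e)) → valid r e →
            deg w ≤ deg r) →
          Runs F L bestCmd σ₃ fun σ₄ => Fr {7, 8} {21, 23, 24, 25} σ₂ σ₄ ∧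
            IsBest m n valid deg (fun r e => w + 1 ≤ r ∨ (r = w ∧ u ≤ e)) σ₄ := by
        intro σ₃ hF₃ hval hmin
        have hB₃ := hB₂.fr hF₃ (by simp)
        have ek₃ : σ₃.idx 11 = w := by rw [hF₃.idx 11 (by simp), ek]
        have eu₃ : σ₃.idx 12 = u := by rw [hF₃.idx 12 (by simp), hku]
        have e17 : σ₃.arr 17 0 w = deg w := by
          rw [hF₃.arr 17 (by simp), hF₂'.arr 17 (by simp), hdeg w hw]
        refine runs_seq (runs_realLit (runs_seq (runs_copy (by simp) (by simp [hB₃.i2])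
          (runs_seq (runs_idxAdd (runs_idxAdd ⟨?_, Or.inr ?_⟩))))))
        · exact ((((hF₃.set (by simp)).set (by simp)).set (by simp)).setIdx (by simp)).setIdx
            (by simp)
        · simp only [Store.setIdx_arr, Store.setIdx_idx, Store.set_idx, Store.set_arr,
            Store.get_def, hB₃.i2, ek₃, eu₃, e17, Nat.reduceEqDiff, if_true, if_false, and_self,
            false_and, add_zero, Nat.cast_one, true_and, hw, hu, hval]
          intro r hr e he hp hv
          by_cases hre : r = w ∧ e = u
          · rw [hre.1]
          · exact hmin r hr e he (by omega) hv
      have hskip : ∀ σ₃ : Store, Fr {7, 8} {21, 24} σ₂ σ₃ → σ₃.idx = σ₂.idx →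
          (valid w u → σ₂.arr 23 0 0 = 1 ∧ σ₂.arr 25 0 0 ≤ deg w) →
          Fr {7, 8} {21, 23, 24, 25} σ₂ σ₃ ∧
            IsBest m n valid deg (fun r e => w + 1 ≤ r ∨ (r = w ∧ u ≤ e)) σ₃ := by
        intro σ₃ hF₃ hidx hval
        refine ⟨hF₃.mono subset_rfl ?_, ?_⟩
        · intro k hk
          simp only [Set.mem_insert_iff, Set.mem_singleton_iff] at hk ⊢
          omega
        · rw [IsBest, hF₃.arr 23 (by simp), hF₃.arr 25 (by simp), hidx]
          refine hI₂.imp (fun h => ⟨h.1, fun r hr e he hp hv => ?_⟩) fun h =>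
            ⟨h.1, h.2.1, h.2.2.1, h.2.2.2.1, h.2.2.2.2.1, fun r hr e he hp hv => ?_⟩
          · by_cases hre : r = w ∧ e = u
            · obtain ⟨rfl, rfl⟩ := hre
              have := (hval hv).1
              rw [h.1] at this
              norm_num at this
            · exact h.2 r hr e he (by omega) hv
          · by_cases hre : r = w ∧ e = u
            · obtain ⟨rfl, rfl⟩ := hre
              rw [← h.2.2.2.2.1]
              exact (hval hv).2
            · exact h.2.2.2.2.2 r hr e he (by omega) hv
      have hiff := hvalid w hw u hu
      refine runs_seq (runs_realOp (runs_seq (runs_realOp (runs_ifNonpos (by simp)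
        (by simp [hB₂.i2]) (fun h => runs_skip ?_) fun h => runs_ifNonpos (by simp)
        (by simp [hB₂.i2]) (fun h' => hbest _ ?_ ?_ ?_) fun h' => runs_ite
        (fun h'' => runs_skip ?_) fun h'' => hbest _ ?_ ?_ ?_))))
      all_goals simp only [RealOp.eval, Store.get_def, Store.set_idx, Store.set_arr, hB₂.i2, ek,
        hku, and_self, if_true, Nat.reduceEqDiff, false_and, if_false, hF₂'.arr 14 (by simp),
        hF₂'.arr 15 (by simp), hF₂'.arr 9 (by simp)] at h
      · refine hskip _ (((Fr.refl.set (by simp)).set (by simp)).set (by simp)) rfl fun hv => ?_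
        exact absurd (hiff.2 hv) (not_lt.2 h)
      · exact (((Fr.refl.set (by simp)).set (by simp)).set (by simp)).set (by simp)
      · exact hiff.1 h
      · simp only [Store.get_def, Store.set_idx, Store.set_arr, hB₂.i2, Nat.reduceEqDiff,
          false_and, if_false] at h'
        intro r hr e he hp hv
        rcases hI₂ with h1 | h1
        · exact absurd hv (h1.2 r hr e he hp)
        · rw [h1.1] at h'
          norm_num at h'
      all_goals simp only [Test.Holds, Store.get_def, Store.set_idx, Store.set_arr, hB₂.i2,
        Nat.reduceEqDiff, false_and, if_false, ek, hF₂'.arr 17 (by simp), hdeg w hw] at h' h''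
      all_goals
        have h1 : σ₂.arr 23 0 0 = 1 := by
          rcases hI₂ with h1 | h1
          · rw [h1.1] at h'
            exact absurd h' (lt_irrefl _)
          · exact h1.1
      · refine hskip _ ((((Fr.refl.set (by simp)).set (by simp)).set (by simp)).set (by simp)) rfl
          fun hv => ⟨h1, h''⟩
      · exact (((Fr.refl.set (by simp)).set (by simp)).set (by simp)).set (by simp)
      · exact hiff.1 h
      · intro r hr e he hp hv
        rcases hI₂ with h2 | h2
        · exact absurd hv (h2.2 r hr e he hp)
        · rw [h2.2.2.2.2.1] at h''
          exact (not_le.1 h'').le.trans (h2.2.2.2.2.2 r hr e he hp hv)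
    · intro σ₂ hF₂ hI₂
      refine ⟨hF₂, hI₂.imp (fun h => ⟨h.1, fun r hr e he hp => ?_⟩) fun h =>
        ⟨h.1, h.2.1, h.2.2.1, h.2.2.2.1, h.2.2.2.2.1, fun r hr e he hp => ?_⟩⟩
      · exact h.2 r hr e he (by omega)
      · exact h.2.2.2.2.2 r hr e he (by omega)
  · intro σ₁ hF₁ hI
    refine hQ σ₁ (hF₀.trans hF₁) (hI.imp (fun h => ⟨h.1, fun r hr e he hp => ?_⟩) fun h =>
        ⟨h.1, h.2.1, h.2.2.1, h.2.2.2.1, h.2.2.2.2.1, fun r hr e he hp => ?_⟩)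
    · exact h.2 r hr e he (by omega)
    · exact h.2.2.2.2.2 r hr e he (by omega)

theorem runs_match (hB : Base m n L σ) (hx : ∀ e < m * n, 0 ≤ σ.arr 10 0 e)
    (hE₀ : E₀ = (Finset.range (m * n)).filter fun e => σ.arr 10 0 e ≠ 0)
    (hall : Hall (IsEnd m n) E₀ (Finset.range (m + n)))
    (hinc : ∀ r < m + n, ∀ e < m * n, σ.arr 9 r e = if IsEnd m n r e then 1 else 0)
    (hQ : ∀ σ' E U rem cap, Fr (Set.Ici 7) {14, 15, 16, 17, 21, 22, 23, 24, 25} σ σ' →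
      PartialMatching m n 0 E₀ E U rem cap (σ'.arr 16) → Q σ') :
    Runs F L matchCmd σ Q := by
  have hadd := hB.add_le
  have hmul := hB.mul_le
  have h7 : ∀ k ∈ Set.Ici 10, 7 ≤ k := fun k hk => le_trans (by norm_num) (Set.mem_Ici.1 hk)
  refine runs_seq (runs_map1 (Set.Ici 10) {14, 21} (Set.Ici 11) 14
    (fun e => if e ∈ E₀ then 1 else 0) (by simp) (by simp)
    (Set.Ici_subset_Ici.2 (by norm_num)) (by simp) hB.i2 hB.i3 (by rw [hB.i5]; omega) ?_ ?_)
  · intro e σ₁ he hF hk _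
    have hB₁ := hB.fr hF h7
    rw [hB.i5] at he
    have hxe : σ₁.get (ve 10 10) = σ.arr 10 0 e := by
      simp [hB₁.i2, hk, hF.arr 10 (by simp)]
    refine runs_ifNonpos (by simp) hB₁.i2 (fun h => runs_realLit ?_) fun h => runs_realLit ?_
    · rw [hxe] at h
      have : e ∉ E₀ := by
        rw [hE₀]
        simp [le_antisymm h (hx e he)]
      refine ⟨(Fr.refl.set (by simp)).set (by simp), fun r l => ?_⟩
      simp [hB₁.i2, hk, this]
    · rw [hxe] at h
      have : e ∈ E₀ := by
        rw [hE₀]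
        simp [he, h.ne']
      refine ⟨(Fr.refl.set (by simp)).set (by simp), fun r l => ?_⟩
      simp [hB₁.i2, hk, this]
  intro σ₁ hF₁ h14
  have hB₁ := hB.fr hF₁ h7
  rw [hB.i5] at h14
  refine runs_seq (runs_map1 (Set.Ici 10) {15} (Set.Ici 11) 15
    (fun _ => 1) (by simp) (by simp)
    (Set.Ici_subset_Ici.2 (by norm_num)) (by simp) hB₁.i2 hB₁.i3 (by rw [hB₁.i4]; omega) ?_ ?_)
  · intro r σ₂ hr hF hk _
    have hB₂ := hB₁.fr hF h7
    exact runs_realLit ⟨Fr.refl.set (by simp), fun r l => by simp [hB₂.i2, hk]⟩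
  intro σ₂ hF₂ h15
  have hB₂ := hB₁.fr hF₂ h7
  rw [hB₁.i4] at h15
  refine runs_seq (runs_map2 (Set.Ici 10) {16} (Set.Ici 12) 16 (fun _ _ => 0)
    (by simp) (by simp) (by simp) (by simp) (by simp) (by simp)
    (Set.Ici_subset_Ici.2 (by norm_num)) (by simp) (by simp) hB₂.i2 hB₂.i3
    (by rw [hB₂.i4]; omega) (by rw [hB₂.i5]; omega) ?_ ?_)
  · intro r e σ₃ hr he hF hkr hke _
    exact runs_realLit ⟨Fr.refl.set (by simp), fun r' l => by simp [hkr, hke]⟩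
  intro σ₃ hF₃ h16
  have hB₃ := hB₂.fr hF₃ h7
  rw [hB₂.i4, hB₂.i5] at h16
  have hF₁₃ : Fr (Set.Ici 7) {14, 15, 16, 17, 21, 22, 23, 24, 25} σ σ₃ := by
    refine (hF₁.mono (Set.Ici_subset_Ici.2 (by norm_num)) ?_).trans
      ((hF₂.mono (Set.Ici_subset_Ici.2 (by norm_num)) ?_).trans
      (hF₃.mono (Set.Ici_subset_Ici.2 (by norm_num)) ?_)) <;>
    · intro k hk
      simp only [Set.mem_insert_iff, Set.mem_singleton_iff] at hk ⊢
      omega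
  have hsub : E₀ ⊆ Finset.range (m * n) := by
    rw [hE₀]
    exact Finset.filter_subset _ _
  refine runs_for (insert 7 (insert 8 (Set.Ici 10))) {14, 15, 16, 17, 21, 22, 23, 24, 25}
    (insert 7 (insert 8 (Set.Ici 11))) (fun k σ₄ => ∃ E U,
      PartialMatching m n k E₀ E U (σ₄.arr 14 0) (σ₄.arr 15 0) (σ₄.arr 16)) (by simp) (by simp)
    (Set.insert_subset_insert (Set.insert_subset_insert (Set.Ici_subset_Ici.2 (by norm_num))))
    (by simp) hB₃.i2 hB₃.i3 (by rw [hB₃.i5]; omega) (fun _ _ _ h => h) ?_ ?_ ?_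
  · rw [hB₃.i5]
    refine ⟨E₀, Finset.range (m + n), hsub, subset_rfl, ?_, subset_rfl, ?_, ?_, hall, ?_, ?_, ?_⟩
    · simpa using Finset.card_le_card hsub
    · intro e he
      rw [hF₃.arr 14 (by simp), hF₂.arr 14 (by simp), h14, if_pos ⟨rfl, he⟩]
    · intro r hr
      rw [hF₃.arr 15 (by simp), h15, if_pos ⟨rfl, hr⟩, if_pos (Finset.mem_range.2 hr)]
    · intro r hr e he
      left
      rw [h16, if_pos ⟨hr, he⟩]
    · intro e he he'
      exact absurd he he'
    · intro r hr e he e' _ h1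
      rw [h16, if_pos ⟨hr, he⟩] at h1
      norm_num at h1
  · rintro k σ₄ hk hF₄ hkk ⟨E, U, hP⟩
    have h7' : ∀ k ∈ insert 7 (insert 8 (Set.Ici 10)), 7 ≤ k := by
      intro k hk
      simp only [Set.mem_insert_iff, Set.mem_Ici] at hk
      omega
    have h7'' : ∀ k ∈ insert 7 (insert 8 (Set.Ici 11)), 7 ≤ k := by
      intro k hk
      simp only [Set.mem_insert_iff, Set.mem_Ici] at hk
      omega
    have hB₄ := hB₃.fr hF₄ h7'
    have hinc₄ : ∀ r < m + n, ∀ e < m * n, σ₄.arr 9 r e = if IsEnd m n r e then 1 else 0 := by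
      intro r hr e he
      rw [hF₄.arr 9 (by simp), hF₁₃.arr 9 (by simp), hinc r hr e he]
    refine runs_seq (runs_degree hB₄ fun σ₅ hF₅ hdeg => ?_)
    have hB₅ := hB₄.fr hF₅ fun k hk => le_trans (by norm_num) (Set.mem_Ici.1 hk)
    refine runs_seq (runs_find hB₅ (valid := fun r e => r ∈ U ∧ e ∈ E ∧ IsEnd m n r e)
      (deg := fun r => ((E.filter fun e => IsEnd m n r e).card : ℝ)) ?_ ?_ ?_)
    · intro r hr e he
      rw [hF₅.arr 15 (by simp), hF₅.arr 14 (by simp), hF₅.arr 9 (by simp), hP.cap_eq r hr,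
        hP.rem_eq e he, hinc₄ r hr e he]
      by_cases h1 : r ∈ U <;> by_cases h2 : e ∈ E <;> by_cases h3 : IsEnd m n r e <;>
        simp [h1, h2, h3]
    · intro r hr
      rw [hdeg r hr, Finset.sum_congr rfl fun e he => by
        rw [hP.rem_eq e (Finset.mem_range.1 he), hinc₄ r hr e (Finset.mem_range.1 he)]]
      have hEN : E ⊆ Finset.range (m * n) := hP.sub.trans hsub
      simp only [ite_mul, one_mul, zero_mul]
      rw [Finset.sum_ite_mem, Finset.inter_eq_right.2 hEN, Finset.sum_boole]
    intro σ₆ hF₆ hbest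
    have hF₄₆ : Fr (insert 7 (insert 8 (Set.Ici 11))) {14, 15, 16, 17, 21, 22, 23, 24, 25} σ₄
        σ₆ := by
      refine (hF₅.mono ?_ ?_).trans (hF₆.mono subset_rfl ?_)
      · exact (Set.subset_insert _ _).trans (Set.subset_insert _ _)
      all_goals
        intro k hk
        simp only [Set.mem_insert_iff, Set.mem_singleton_iff] at hk ⊢
        omega
    have hB₆ := hB₄.fr hF₄₆ h7''
    have e14 : σ₆.arr 14 = σ₄.arr 14 := by rw [hF₆.arr 14 (by simp), hF₅.arr 14 (by simp)]
    have e15 : σ₆.arr 15 = σ₄.arr 15 := by rw [hF₆.arr 15 (by simp), hF₅.arr 15 (by simp)]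
    have e16 : σ₆.arr 16 = σ₄.arr 16 := by rw [hF₆.arr 16 (by simp), hF₅.arr 16 (by simp)]
    have e23 : σ₆.get (sc 23) = σ₆.arr 23 0 0 := by simp [hB₆.i2]
    refine runs_ifNonpos (by simp) hB₆.i2 (fun h => runs_skip ?_) fun h =>
      runs_seq (runs_realLit (runs_seq (runs_realLit (runs_realLit ?_))))
    · rw [e23] at h
      refine ⟨hF₄₆.set (by simp), E, U, ?_⟩
      rw [Store.set_arr_ne _ _ _ (by simp), Store.set_arr_ne _ _ _ (by simp),
        Store.set_arr_ne _ _ _ (by simp), e14, e15, e16]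
      rcases hbest with h1 | h1
      · refine hP.of_empty fun r hr e he hre => ?_
        exact h1.2 r (Finset.mem_range.1 (hP.vert hr)) e (Finset.mem_range.1
          (hsub (hP.sub he))) trivial ⟨hr, he, hre⟩
      · rw [h1.1] at h
        norm_num at h
    · rw [e23] at h
      rcases hbest with h1 | ⟨-, hr, he, ⟨hrU, heE, hre⟩, -, hmin⟩
      · rw [h1.1] at h
        exact absurd h (lt_irrefl _)
      refine ⟨(((hF₄₆.set (by simp)).set (by simp)).set (by simp)).set (by simp),
        E.erase (σ₆.idx 8), U.erase (σ₆.idx 7), hP.assign hrU heE he hre ?_ ?_ ?_ ?_⟩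
      · intro r' hr' e' he' hre'
        have h2 := hmin r' (Finset.mem_range.1 (hP.vert hr')) e' (Finset.mem_range.1
          (hsub (hP.sub he'))) trivial ⟨hr', he', hre'⟩
        exact Nat.cast_le.1 h2
      · intro f _
        simp [hB₆.i2, e14]
      · intro q _
        simp [hB₆.i2, e15]
      · intro q _ f _
        simp [e16]
  · rintro σ₄ hF₄ ⟨E, U, hP⟩
    refine hQ σ₄ E U _ _ (hF₁₃.trans (hF₄.mono ?_ subset_rfl)) hP
    intro k hk
    simp only [Set.mem_insert_iff, Set.mem_Ici] at hk ⊢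
    omega

end

end

section

/-! #### The schedule -/

def edgeCmd (i j : ℕ) : Cmd := .seq (.idxAdd 13 j 2) (.for 12 i (.idxAdd 13 13 1))

/-- For small `β` several machines may hold a fraction of at least `β` of one job. The flag in array
`19` lets only the first one found be selected. -/
def selectCmd : Cmd :=
  .seq (.for 10 1 <| .realLit (ve 19 10) 0) <|
  .for 10 0 <| .for 11 1 <| .seq (edgeCmd 10 11) <| .seq (.realLit ⟨18, 10, 11⟩ 0) <|
    .ifNonpos (ve 19 11)
      (.ite (.realLe ⟨2, 2, 6⟩ (ve 10 13))
        (.seq (.realLit ⟨18, 10, 11⟩ 1) (.realLit (ve 19 11) 1)) .skip) .skip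

/-- Only the rows of array `16` that belong to machines are read, so an edge matched with its job is
dropped. -/
def assignCmd : Cmd :=
  .seq (.for 10 0 <| .for 11 1 <| .seq (edgeCmd 10 11) <|
    .ifNonpos (ve 19 11) (.copy ⟨4, 10, 11⟩ ⟨16, 10, 13⟩) (.copy ⟨4, 10, 11⟩ ⟨18, 10, 11⟩)) <|
  .for 10 1 <| .realLit (ve 5 10) 0

/-- Cell `27` receives `C / (1 - β)^(1/p)`, by which all jobs without a selected machine are
finished. For each machine, cell `28` is the time up to which its selected jobs have been booked. -/
def startCmd : Cmd :=
  .seq (.realLit (sc 24) 1) <| .seq (.realOp .sub (sc 27) (sc 24) ⟨2, 2, 6⟩) <|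
  .seq (.realOp .div (sc 24) (sc 24) (sc 2)) <| .seq (.realOp .pow (sc 27) (sc 27) (sc 24)) <|
  .seq (.realOp .div (sc 27) ⟨2, 2, 3⟩ (sc 27)) <|
  .for 10 0 <| .seq (.copy (sc 28) (sc 27)) <|
    .for 11 1 <| .ifNonpos ⟨18, 10, 11⟩ .skip <|
      .seq (.copy (ve 5 11) (sc 28)) (.realOp .add (sc 28) (sc 28) ⟨6, 10, 11⟩)

/-- For the pairs with `P`, the matrix `s` selects at most one machine for every job, with a
fraction of at least `β`, and `f` indicates the jobs with such a machine. -/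
structure IsSelection (m n : ℕ) (β : ℝ) (y : ℕ → ℝ) (P : ℕ → ℕ → Prop) (s : ℕ → ℕ → ℝ) (f : ℕ → ℝ) :
    Prop where
  val : ∀ i < m, ∀ j < n, P i j → s i j = 0 ∨ (s i j = 1 ∧ β ≤ y (i * n + j) ∧ f j = 1)
  large : ∀ i < m, ∀ j < n, P i j → β ≤ y (i * n + j) → f j = 1
  flag : ∀ j < n, f j = 0 ∨ (f j = 1 ∧ ∃ i < m, P i j ∧ s i j = 1)
  unique : ∀ i < m, ∀ i' < m, ∀ j < n, P i j → P i' j → s i j = 1 → s i' j = 1 → i = i'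

theorem IsSelection.congr {m n : ℕ} {β : ℝ} {y : ℕ → ℝ} {P P' : ℕ → ℕ → Prop} {s : ℕ → ℕ → ℝ}
    {f : ℕ → ℝ} (h : IsSelection m n β y P s f) (hP : ∀ i < m, ∀ j < n, P i j ↔ P' i j) :
    IsSelection m n β y P' s f where
  val i hi j hj hp := h.val i hi j hj ((hP i hi j hj).2 hp)
  large i hi j hj hp := h.large i hi j hj ((hP i hi j hj).2 hp)
  flag j hj := (h.flag j hj).imp id fun ⟨h1, i, hi, h2⟩ =>
    ⟨h1, i, hi, (hP i hi j hj).1 h2.1, h2.2⟩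
  unique i hi i' hi' j hj hp hp' := h.unique i hi i' hi' j hj ((hP i hi j hj).2 hp)
    ((hP i' hi' j hj).2 hp')

theorem IsSelection.insert {m n : ℕ} {β : ℝ} {y : ℕ → ℝ} {P : ℕ → ℕ → Prop} {s s' : ℕ → ℕ → ℝ}
    {f f' : ℕ → ℝ} (h : IsSelection m n β y P s f) {i₀ j₀ : ℕ} (hi₀ : i₀ < m)
    (hnP : ¬ P i₀ j₀)
    (hs : ∀ i j, s' i j = if i = i₀ ∧ j = j₀ then
      (if f j₀ ≤ 0 ∧ β ≤ y (i₀ * n + j₀) then 1 else 0) else s i j)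
    (hf : ∀ j, f' j = if j = j₀ ∧ f j₀ ≤ 0 ∧ β ≤ y (i₀ * n + j₀) then 1 else f j) :
    IsSelection m n β y (fun i j => P i j ∨ (i = i₀ ∧ j = j₀)) s' f' := by
  have hold : ∀ i j, P i j → s' i j = s i j := by
    intro i j hp
    rw [hs, if_neg]
    rintro ⟨rfl, rfl⟩
    exact hnP hp
  have hmono : ∀ j, f j = 1 → f' j = 1 := by
    intro j hj
    rw [hf]
    split_ifs <;> first | rfl | exact hj
  constructor
  · intro i hi j hj hp
    by_cases hij : i = i₀ ∧ j = j₀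
    · obtain ⟨rfl, rfl⟩ := hij
      rw [hs, hf]
      by_cases hc : f j ≤ 0 ∧ β ≤ y (i * n + j) <;> simp [hc]
    · rw [hold i j (hp.resolve_right hij)]
      exact (h.val i hi j hj (hp.resolve_right hij)).imp id fun ⟨h1, h2, h3⟩ =>
        ⟨h1, h2, hmono j h3⟩
  · intro i hi j hj hp hβ
    by_cases hij : i = i₀ ∧ j = j₀
    · obtain ⟨rfl, rfl⟩ := hij
      rw [hf]
      rcases h.flag j hj with h1 | h1
      · simp [h1, hβ]
      · simp [h1.1]
    · exact hmono j (h.large i hi j hj (hp.resolve_right hij) hβ)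
  · intro j hj
    by_cases hc : j = j₀ ∧ f j₀ ≤ 0 ∧ β ≤ y (i₀ * n + j₀)
    · right
      refine ⟨by rw [hf, if_pos hc], i₀, hi₀, Or.inr ⟨rfl, hc.1⟩, ?_⟩
      rw [hs, if_pos ⟨rfl, hc.1⟩, if_pos hc.2]
    · rw [hf, if_neg hc]
      exact (h.flag j hj).imp id fun ⟨h1, i, hi, h2, h3⟩ =>
        ⟨h1, i, hi, Or.inl h2, by rw [hold i j h2, h3]⟩
  -- The new pair is selected only if the flag of its job is down, whereas an earlier selection for
  -- that job would have raised it.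
  · have key : ∀ i < m, ∀ j < n, P i j → s' i j = 1 → s' i₀ j₀ = 1 → j ≠ j₀ := by
      rintro i hi j hj hp h1 h2 rfl
      rw [hs, if_pos ⟨rfl, rfl⟩] at h2
      rw [hold i j hp] at h1
      rcases h.val i hi j hj hp with h3 | ⟨-, -, h3⟩
      · rw [h3] at h1
        norm_num at h1
      · rw [h3] at h2
        norm_num at h2
    intro i hi i' hi' j hj hp hp' h1 h2
    rcases hp with hp | ⟨rfl, rfl⟩ <;> rcases hp' with hp' | ⟨rfl, hj'⟩
    · rw [hold _ _ hp] at h1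
      rw [hold _ _ hp'] at h2
      exact h.unique i hi i' hi' j hj hp hp' h1 h2
    · subst hj'
      exact absurd rfl (key i hi _ hj hp h1 h2)
    · exact absurd rfl (key i' hi' _ hj hp' h2 h1)
    · rfl

section

variable {m n : ℕ} {F : ℕ → ℝ → ℝ} {L : ℕ} {σ : Store} {Q : Store → Prop}

/-- A rule for two nested loops with an invariant that depends on the set of pairs that have been
processed. -/
theorem runs_for2 {k k' lim lim' : ℕ} {c : Cmd} (I A I' : Set ℕ)
    (Inv : (ℕ → ℕ → Prop) → Store → Prop)
    (hk : k ∈ I) (hkk : k' ∈ I) (h2 : 2 ∉ I) (h3 : 3 ∉ I) (hl : lim' ∉ I) (hne : k ≠ k')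
    (hI : I' ⊆ I) (hk' : k ∉ I') (hkk' : k' ∉ I')
    (z : σ.idx 2 = 0) (o : σ.idx 3 = 1) (hL : σ.idx lim ≤ L) (hL' : σ.idx lim' ≤ L)
    (hcongr : ∀ P P' σ₁, (∀ r < σ.idx lim, ∀ l < σ.idx lim', P r l ↔ P' r l) →
      Inv P σ₁ → Inv P' σ₁)
    (hs : ∀ P w σ', Inv P σ' → Inv P (σ'.setIdx k w))
    (hs' : ∀ P w σ', Inv P σ' → Inv P (σ'.setIdx k' w))
    (h0 : Inv (fun _ _ => False) σ)
    (hb : ∀ P v w σ₁, v < σ.idx lim → w < σ.idx lim' → ¬ P v w → Fr I A σ σ₁ → σ₁.idx k = v →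
      σ₁.idx k' = w → Inv P σ₁ →
      Runs F L c σ₁ fun σ₂ => Fr I' A σ₁ σ₂ ∧ Inv (fun r l => P r l ∨ (r = v ∧ l = w)) σ₂)
    (hQ : ∀ σ', Fr I A σ σ' → Inv (fun _ _ => True) σ' → Q σ') :
    Runs F L (.for k lim (.for k' lim' c)) σ Q := by
  refine runs_for I A (I \ {k}) (fun v => Inv fun r _ => v ≤ r)
      hk h3 Set.sdiff_subset (by simp) z o hL (fun _ _ _ h => hs _ _ _ h) ?_ ?_ ?_
  · exact hcongr _ _ _ (fun r hr l _ => by simpa using hr) h0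
  · intro v σ₁ hv hF hkv hInv
    have e' : σ₁.idx lim' = σ.idx lim' := hF.idx _ hl
    refine runs_for (I \ {k}) A I' (fun w => Inv fun r l => v + 1 ≤ r ∨ (r = v ∧ w ≤ l))
      ⟨hkk, fun h => hne h.symm⟩ (fun h => h3 h.1)
      (fun q hq => ⟨hI hq, fun h => hk' (h ▸ hq)⟩) hkk' ((hF.idx 2 h2).trans z)
      ((hF.idx 3 h3).trans o) (e' ▸ hL') (fun _ _ _ h => hs' _ _ _ h) ?_ ?_ ?_
    · refine hcongr _ _ _ (fun r hr l hl => ?_) hInv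
      omega
    · intro w σ₂ hw hF2 hkw hInv2
      rw [e'] at hw
      refine (hb _ v w σ₂ hv hw (by omega) (hF.trans (hF2.mono Set.sdiff_subset subset_rfl))
        ((hF2.idx k (by simp)).trans hkv) hkw hInv2).mono ?_
      rintro σ₃ ⟨hF3, h⟩
      refine ⟨hF3, hcongr _ _ _ (fun r hr l hl => ?_) h⟩
      omega
    · intro σ' hF' h
      refine ⟨hF', hcongr _ _ _ (fun r hr l hl => ?_) h⟩
      omega
  · intro σ' hF h
    exact hQ σ' hF (hcongr _ _ _ (fun r hr l hl => by simp) h)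

theorem runs_edge {i j : ℕ} (hB : Base m n L σ) (hi : i ≠ 13) (hj : σ.idx i ≤ L)
    (hQ : ∀ σ', Fr {12, 13} ∅ σ σ' → σ'.idx 13 = σ.idx i * n + σ.idx j → Q σ') :
    Runs F L (edgeCmd i j) σ Q := by
  refine runs_seq (runs_idxAdd ?_)
  have hF₀ : Fr {12, 13} ∅ σ (σ.setIdx 13 (σ.idx j + σ.idx 2)) := Fr.refl.setIdx (by simp)
  have hB₀ := hB.fr hF₀ (by simp)
  have ei : (σ.setIdx 13 (σ.idx j + σ.idx 2)).idx i = σ.idx i := by simp [hi]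
  refine runs_for {12, 13} ∅ {13} (fun v σ₁ => v * n + σ₁.idx 13 = σ.idx i * n + σ.idx j)
    (by simp) (by simp) (by simp) (by simp) hB₀.i2 hB₀.i3 (by rw [ei]; exact hj) ?_ ?_ ?_ ?_
  · intro v w σ' h
    simpa using h
  · rw [ei]
    simp [hB.i2]
  · intro v σ₁ hv hF hk h
    have hB₁ := hB₀.fr hF (by simp)
    refine runs_idxAdd ⟨Fr.refl.setIdx (by simp), ?_⟩
    simp only [Store.setIdx_idx, if_true, hB₁.i1]
    rw [← h]
    ring
  · intro σ' hF h
    exact hQ σ' (hF₀.trans hF) (by simpa using h)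

theorem runs_select (hB : Base m n L σ)
    (hQ : ∀ σ', Fr (Set.Ici 10) {18, 19, 21} σ σ' →
      IsSelection m n (σ.arr 2 0 2) (σ.arr 10 0) (fun _ _ => True) (σ'.arr 18) (σ'.arr 19 0) →
      Q σ') : Runs F L selectCmd σ Q := by
  have hadd := hB.add_le
  have h7 : ∀ k ∈ Set.Ici 10, 7 ≤ k := fun k hk => le_trans (by norm_num) (Set.mem_Ici.1 hk)
  refine runs_seq (runs_map1 (Set.Ici 10) {19} (Set.Ici 11) 19
    (fun _ => 0) (by simp) (by simp)
    (Set.Ici_subset_Ici.2 (by norm_num)) (by simp) hB.i2 hB.i3 (by rw [hB.i1]; omega) ?_ ?_)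
  · intro r σ₂ hr hF hk _
    have hB₂ := hB.fr hF h7
    exact runs_realLit ⟨Fr.refl.set (by simp), fun r l => by simp [hB₂.i2, hk]⟩
  intro σ₁ hF₁ h19
  have hB₁ := hB.fr hF₁ h7
  rw [hB.i1] at h19
  refine runs_for2 (Set.Ici 10) {18, 19, 21} (Set.Ici 12) (fun P σ₂ =>
    IsSelection m n (σ.arr 2 0 2) (σ.arr 10 0) P (σ₂.arr 18) (σ₂.arr 19 0))
    (by simp) (by simp) (by simp) (by simp) (by simp) (by simp)
    (Set.Ici_subset_Ici.2 (by norm_num)) (by simp) (by simp) hB₁.i2 hB₁.i3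
    (by rw [hB₁.i0]; omega) (by rw [hB₁.i1]; omega) ?_ (fun _ _ _ h => h) (fun _ _ _ h => h)
    ?_ ?_ ?_
  · intro P P' σ₂ hP h
    rw [hB₁.i0, hB₁.i1] at hP
    exact h.congr hP
  · exact ⟨by simp, by simp, fun j hj => Or.inl (by rw [h19, if_pos ⟨rfl, hj⟩]), by simp⟩
  · intro P i j σ₂ hi hj hnP hF₂ hki hkj h
    rw [hB₁.i0] at hi
    rw [hB₁.i1] at hj
    have hB₂ := hB₁.fr hF₂ h7
    refine runs_seq (runs_edge hB₂ (by norm_num) (by rw [hki]; omega) fun σ₃ hF₃ h13 => ?_)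
    have hB₃ := hB₂.fr hF₃ (by simp)
    have eki : σ₃.idx 10 = i := by rw [hF₃.idx 10 (by simp), hki]
    have ekj : σ₃.idx 11 = j := by rw [hF₃.idx 11 (by simp), hkj]
    rw [hki, hkj] at h13
    have e2 : σ₃.arr 2 = σ.arr 2 := by
      rw [hF₃.arr 2 (by simp), hF₂.arr 2 (by simp), hF₁.arr 2 (by simp)]
    have e10 : σ₃.arr 10 = σ.arr 10 := by
      rw [hF₃.arr 10 (by simp), hF₂.arr 10 (by simp), hF₁.arr 10 (by simp)]
    have e18 : σ₃.arr 18 = σ₂.arr 18 := hF₃.arr 18 (by simp)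
    have e19 : σ₃.arr 19 = σ₂.arr 19 := hF₃.arr 19 (by simp)
    have hF₃' : Fr (Set.Ici 12) {18, 19, 21} σ₂ σ₃ := hF₃.mono (by
      intro k hk
      simp only [Set.mem_insert_iff, Set.mem_singleton_iff, Set.mem_Ici] at hk ⊢
      omega) (by simp)
    refine runs_seq (runs_realLit (runs_ifNonpos (by simp) (by simp [hB₃.i2]) (fun h1 => runs_ite
      (fun h2 => runs_seq (runs_realLit (runs_realLit ?_))) fun h2 => runs_skip ?_)
      fun h1 => runs_skip ?_))
    all_goals
      simp only [Store.get_def, Store.set_idx, Store.set_arr, hB₃.i2, ekj, e19,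
        Nat.reduceEqDiff, false_and, if_false] at h1
    · refine ⟨(((hF₃'.set (by simp)).set (by simp)).set (by simp)).set (by simp), ?_⟩
      simp only [Test.Holds, Store.get_def, Store.set_arr, Store.set_idx, hB₃.i2, hB₃.i6, h13,
        e2, e10, Nat.reduceEqDiff, false_and, if_false] at h2
      refine h.insert hi hnP (fun r l => ?_) fun l => ?_
      · simp [eki, ekj, h1, h2, e18]
        split_ifs <;> rfl
      · simp [hB₃.i2, ekj, h1, h2, e19]
    · refine ⟨(hF₃'.set (by simp)).set (by simp), ?_⟩
      simp only [Test.Holds, Store.get_def, Store.set_arr, Store.set_idx, hB₃.i2, hB₃.i6, h13,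
        e2, e10, Nat.reduceEqDiff, false_and, if_false] at h2
      refine h.insert hi hnP (fun r l => ?_) fun l => ?_
      · simp [eki, ekj, h2, e18]
      · simp [h2, e19]
    · refine ⟨(hF₃'.set (by simp)).set (by simp), ?_⟩
      have h1' := not_le.2 h1
      refine h.insert hi hnP (fun r l => ?_) fun l => ?_
      · simp [eki, ekj, h1', e18]
      · simp [h1', e19]
  · intro σ₂ hF₂ h
    exact hQ σ₂ ((hF₁.mono subset_rfl (by simp)).trans hF₂) h

theorem runs_assign (hB : Base m n L σ)
    (hQ : ∀ σ', Fr (Set.Ici 10) {4, 5, 21} σ σ' →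
      (∀ i < m, ∀ j < n, σ'.arr 4 i j =
        if σ.arr 19 0 j ≤ 0 then σ.arr 16 i (i * n + j) else σ.arr 18 i j) →
      (∀ j < n, σ'.arr 5 0 j = 0) → Q σ') : Runs F L assignCmd σ Q := by
  have hadd := hB.add_le
  have h7 : ∀ k ∈ Set.Ici 10, 7 ≤ k := fun k hk => le_trans (by norm_num) (Set.mem_Ici.1 hk)
  refine runs_seq (runs_map2 (Set.Ici 10) {4, 21} (Set.Ici 12) 4 (fun i j =>
    if σ.arr 19 0 j ≤ 0 then σ.arr 16 i (i * n + j) else σ.arr 18 i j)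
    (by simp) (by simp) (by simp) (by simp) (by simp) (by simp)
    (Set.Ici_subset_Ici.2 (by norm_num)) (by simp) (by simp) hB.i2 hB.i3
    (by rw [hB.i0]; omega) (by rw [hB.i1]; omega) ?_ ?_)
  · intro i j σ₂ hi hj hF₂ hki hkj _
    rw [hB.i0] at hi
    have hB₂ := hB.fr hF₂ h7
    refine runs_seq (runs_edge hB₂ (by norm_num) (by rw [hki]; omega) fun σ₃ hF₃ h13 => ?_)
    have hB₃ := hB₂.fr hF₃ (by simp)
    have eki : σ₃.idx 10 = i := by rw [hF₃.idx 10 (by simp), hki]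
    have ekj : σ₃.idx 11 = j := by rw [hF₃.idx 11 (by simp), hkj]
    rw [hki, hkj] at h13
    have e19 : σ₃.arr 19 = σ.arr 19 := by rw [hF₃.arr 19 (by simp), hF₂.arr 19 (by simp)]
    have e16 : σ₃.arr 16 = σ.arr 16 := by rw [hF₃.arr 16 (by simp), hF₂.arr 16 (by simp)]
    have e18 : σ₃.arr 18 = σ.arr 18 := by rw [hF₃.arr 18 (by simp), hF₂.arr 18 (by simp)]
    have e4 : σ₃.arr 4 = σ₂.arr 4 := by rw [hF₃.arr 4 (by simp)]
    have hF₃' : Fr (Set.Ici 12) {4, 21} σ₂ σ₃ := hF₃.mono (by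
      intro k hk
      simp only [Set.mem_insert_iff, Set.mem_singleton_iff, Set.mem_Ici] at hk ⊢
      omega) (by simp)
    refine runs_ifNonpos (by simp) hB₃.i2 (fun h1 => runs_copy (by simp) (by simp [hB₃.i2]) ?_)
      fun h1 => runs_copy (by simp) (by simp [hB₃.i2]) ?_
    all_goals
      simp only [Store.get_def, hB₃.i2, ekj, e19] at h1
      refine ⟨((hF₃'.set (by simp)).set (by simp)).set (by simp), fun r l => ?_⟩
    · simp [eki, ekj, h13, e16, e4, h1]
    · simp [eki, ekj, e18, e4, not_le.2 h1]
  intro σ₁ hF₁ h4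
  have hB₁ := hB.fr hF₁ h7
  rw [hB.i0, hB.i1] at h4
  refine runs_map1 (Set.Ici 10) {5} (Set.Ici 11) 5
    (fun _ => 0) (by simp) (by simp)
    (Set.Ici_subset_Ici.2 (by norm_num)) (by simp) hB₁.i2 hB₁.i3 (by rw [hB₁.i1]; omega) ?_ ?_
  · intro r σ₂ hr hF hk _
    have hB₂ := hB₁.fr hF h7
    exact runs_realLit ⟨Fr.refl.set (by simp), fun r l => by simp [hB₂.i2, hk]⟩
  intro σ₂ hF₂ h5
  rw [hB₁.i1] at h5
  refine hQ σ₂ ((hF₁.mono subset_rfl ?_).trans (hF₂.mono subset_rfl ?_)) ?_ ?_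
  iterate 2
    · intro k hk
      simp only [Set.mem_insert_iff, Set.mem_singleton_iff] at hk ⊢
      omega
  · intro i hi j hj
    rw [hF₂.arr 4 (by simp), h4, if_pos ⟨hi, hj⟩]
  · intro j hj
    rw [h5, if_pos ⟨rfl, hj⟩]

/-- The total coefficient of the jobs from `j` on that are selected for machine `i`. -/
def selectedLoad (n : ℕ) (s a : ℕ → ℕ → ℝ) (i j : ℕ) : ℝ :=
  ∑ k ∈ Finset.Ico j n, if 0 < s i k then a i k else 0

theorem runs_start {p C β : ℝ} (hB : Base m n L σ) (hp : σ.arr 2 0 0 = p) (hC : σ.arr 2 0 1 = C)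
    (hβ : σ.arr 2 0 2 = β) (hβ1 : β < 1)
    (huniq : ∀ i < m, ∀ i' < m, ∀ j < n, 0 < σ.arr 18 i j → 0 < σ.arr 18 i' j → i = i')
    (h5 : ∀ j < n, σ.arr 5 0 j = 0)
    (hQ : ∀ σ', Fr (Set.Ici 10) {5, 21, 24, 27, 28} σ σ' →
      (∀ i < m, ∀ j < n, 0 < σ.arr 18 i j → σ'.arr 5 0 j =
        C / (1 - β) ^ (1 / p) + selectedLoad n (σ.arr 18) (σ.arr 6) i (j + 1)) →
      (∀ j < n, (∀ i < m, σ.arr 18 i j ≤ 0) → σ'.arr 5 0 j = 0) → Q σ') :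
    Runs F L startCmd σ Q := by
  have hadd := hB.add_le
  have h7 : ∀ k ∈ Set.Ici 10, 7 ≤ k := fun k hk => le_trans (by norm_num) (Set.mem_Ici.1 hk)
  have h1β : 0 ≤ 1 - β := by linarith
  set D := C / (1 - β) ^ (1 / p) with hD
  refine runs_seq (runs_realLit (runs_seq (runs_realOp (runs_seq (runs_realOp (runs_seq
    (runs_realOp (runs_seq (runs_realOp ?_)))))))))
  set σ₀ := ((((σ.set (sc 24) (1 : ℕ)).set (sc 27) _).set (sc 24) _).set (sc 27) _).set (sc 27) _
    with hσ₀
  have hF₀ : Fr (Set.Ici 10) {5, 21, 24, 27, 28} σ σ₀ :=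
    ((((Fr.refl.set (by simp)).set (by simp)).set (by simp)).set (by simp)).set (by simp)
  have hD₀ : σ₀.arr 27 0 0 = D := by
    rw [hσ₀]
    simp [RealOp.eval, hB.i2, hB.i3, hB.i6, hp, hC, hβ, hD, h1β]
  have hσ₀5 : σ₀.arr 5 = σ.arr 5 := by
    funext r l
    simp [hσ₀]
  clear_value σ₀
  clear hσ₀
  have hB₀ := hB.fr hF₀ h7
  refine runs_for (Set.Ici 10) {5, 21, 28} (Set.Ici 11) (fun v σ₁ =>
    (∀ i < m, v ≤ i → ∀ j < n, 0 < σ.arr 18 i j → σ₁.arr 5 0 j =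
        D + selectedLoad n (σ.arr 18) (σ.arr 6) i (j + 1)) ∧
      ∀ j < n, (∀ i < m, σ.arr 18 i j ≤ 0) → σ₁.arr 5 0 j = 0) (by simp) (by simp)
    (Set.Ici_subset_Ici.2 (by norm_num)) (by simp) hB₀.i2 hB₀.i3 (by rw [hB₀.i0]; omega)
    (fun _ _ _ h => h) ?_ ?_ ?_
  · rw [hB₀.i0, hσ₀5]
    exact ⟨fun i hi hi' => by omega, fun j hj _ => h5 j hj⟩
  · rintro i σ₁ hi hF₁ hki ⟨hI1, hI2⟩
    rw [hB₀.i0] at hi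
    have hB₁ := hB₀.fr hF₁ h7
    have e27 : σ₁.get (sc 27) = D := by simp [hB₁.i2, hF₁.arr 27 (by simp), hD₀]
    refine runs_seq (runs_copy (by simp) hB₁.i2 ?_)
    rw [e27]
    have hF₁' : Fr (Set.Ici 11) {5, 21, 28} σ₁ ((σ₁.set (sc 21) 0).set (sc 28) D) :=
      (Fr.refl.set (by simp)).set (by simp)
    refine runs_for (Set.Ici 11) {5, 21, 28} ∅ (fun w σ₂ =>
      σ₂.arr 28 0 0 = D + selectedLoad n (σ.arr 18) (σ.arr 6) i w ∧
      (∀ j < n, w ≤ j → 0 < σ.arr 18 i j → σ₂.arr 5 0 j =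
        D + selectedLoad n (σ.arr 18) (σ.arr 6) i (j + 1)) ∧
      ∀ j < n, σ.arr 18 i j ≤ 0 → σ₂.arr 5 0 j = σ₁.arr 5 0 j) (by simp) (by simp)
      (by simp) (by simp) (by simp [hB₁.i2]) (by simp [hB₁.i3]) (by simp [hB₁.i1]; omega)
      (fun _ _ _ h => h) ?_ ?_ ?_
    · simp only [Store.set_idx, hB₁.i1]
      refine ⟨by simp [hB₁.i2, selectedLoad], fun j hj hj' => by omega, fun j hj _ => ?_⟩
      simp
    · rintro j σ₂ hj hF₂ hkj ⟨hJ1, hJ2, hJ3⟩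
      simp only [Store.set_idx, hB₁.i1] at hj
      have hB₂ := hB₁.fr (hF₁'.trans hF₂) fun k hk => le_trans (by norm_num) (Set.mem_Ici.1 hk)
      have eki : σ₂.idx 10 = i := by
        rw [hF₂.idx 10 (by simp), Store.set_idx, Store.set_idx, hki]
      have e18 : σ₂.arr 18 = σ.arr 18 := by
        rw [(hF₁'.trans hF₂).arr 18 (by simp), (hF₀.trans (hF₁.mono subset_rfl (by
          intro k hk
          simp only [Set.mem_insert_iff, Set.mem_singleton_iff] at hk ⊢
          omega))).arr 18 (by simp)]
      have e6 : σ₂.arr 6 = σ.arr 6 := by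
        rw [(hF₁'.trans hF₂).arr 6 (by simp), (hF₀.trans (hF₁.mono subset_rfl (by
          intro k hk
          simp only [Set.mem_insert_iff, Set.mem_singleton_iff] at hk ⊢
          omega))).arr 6 (by simp)]
      have hstep : selectedLoad n (σ.arr 18) (σ.arr 6) i j =
          (if 0 < σ.arr 18 i j then σ.arr 6 i j else 0) +
            selectedLoad n (σ.arr 18) (σ.arr 6) i (j + 1) := by
        rw [selectedLoad, Finset.sum_eq_sum_Ico_succ_bot hj]
        rfl
      refine runs_ifNonpos (by simp) hB₂.i2 (fun h => runs_skip ?_) fun h =>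
        runs_seq (runs_copy (by simp) (by simp [hB₂.i2]) (runs_realOp ?_))
      all_goals simp only [Store.get_def, eki, hkj, e18] at h
      · refine ⟨Fr.refl.set (by simp), ?_⟩
        rw [Store.set_arr_ne _ _ _ (by simp), Store.set_arr_ne _ _ _ (by simp), hstep,
          if_neg (not_lt.2 h), zero_add]
        refine ⟨hJ1, fun k hk hjk hs => ?_, hJ3⟩
        rcases hjk.eq_or_lt with rfl | hjk
        · exact absurd hs (not_lt.2 h)
        · exact hJ2 k hk hjk hs
      · refine ⟨(((Fr.refl.set (by simp)).set (by simp)).set (by simp)).set (by simp), ?_, ?_, ?_⟩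
        · simp [hB₂.i2, eki, hkj, e6, hJ1, RealOp.eval, hstep, h]
          ring
        · intro k hk hjk hs
          simp only [Store.set_arr, Store.set_idx, Store.get_def, hB₂.i2, hkj, Nat.reduceEqDiff,
            false_and, if_false, true_and, hJ1]
          split_ifs with hkj'
          · rw [hkj']
          · exact hJ2 k hk (by omega) hs
        · intro k hk hs
          have : k ≠ j := by
            rintro rfl
            exact absurd h (not_lt.2 hs)
          simp [hkj, this, hJ3 k hk hs]
    · rintro σ₂ hF₂ ⟨-, hJ2, hJ3⟩
      refine ⟨hF₁'.trans hF₂, ?_, ?_⟩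
      · intro i' hi' hii j hj hs
        rcases hii.eq_or_lt with rfl | hii
        · exact hJ2 j hj (Nat.zero_le _) hs
        -- A job has one selected machine, so the present machine does not overwrite a start time
        -- written for another one.
        · have hs' : σ.arr 18 i j ≤ 0 := by
            by_contra! hpos
            have := huniq i hi i' hi' j hj hpos hs
            omega
          rw [hJ3 j hj hs', hI1 i' hi' hii j hj hs]
      · intro j hj hs
        rw [hJ3 j hj (hs i hi), hI2 j hj hs]
  · rintro σ₁ hF₁ ⟨hI1, hI2⟩
    refine hQ σ₁ (hF₀.trans (hF₁.mono subset_rfl ?_)) (fun i hi => hI1 i hi (Nat.zero_le _)) hI2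
    intro k hk
    simp only [Set.mem_insert_iff, Set.mem_singleton_iff] at hk ⊢
    omega

end

end

section

variable {m n : ℕ}

/-! ### The rounding algorithm -/

theorem edge_lt {m n i j : ℕ} (hi : i < m) (hj : j < n) : i * n + j < m * n :=
  calc i * n + j < i * n + n := by omega
    _ = (i + 1) * n := by ring
    _ ≤ m * n := Nat.mul_le_mul_right n hi

theorem edge_div {n j : ℕ} (i : ℕ) (hj : j < n) : (i * n + j) / n = i := by
  rw [mul_comm, Nat.mul_add_div (by omega), Nat.div_eq_of_lt hj, add_zero]

theorem edge_mod {n j : ℕ} (i : ℕ) (hj : j < n) : (i * n + j) % n = j := by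
  rw [mul_comm, Nat.mul_add_mod, Nat.mod_eq_of_lt hj]

theorem sum_range_mul (m n : ℕ) (f : ℕ → ℝ) :
    ∑ e ∈ Finset.range (m * n), f e = ∑ i : Fin m, ∑ j : Fin n, f (i * n + j) := by
  rw [Finset.sum_range, ← finProdFinEquiv.sum_comp, Fintype.sum_prod_type]
  refine Finset.sum_congr rfl fun i _ => Finset.sum_congr rfl fun j _ => ?_
  rw [finProdFinEquiv_apply_val, add_comm, mul_comm]

/-- Row `m + j` of the system is the assignment constraint of job `j`, and row `i` below is the load
of machine `i`. Preserving the row sums therefore preserves feasibility. -/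
theorem sum_colEntry_job (a : ℕ → ℕ → ℝ) (z : ℕ → ℝ) (j : Fin n) :
    ∑ e ∈ Finset.range (m * n), colEntry m n a (m + j) e * z e = ∑ i : Fin m, z (i * n + j) := by
  rw [sum_range_mul]
  refine Finset.sum_congr rfl fun i _ => ?_
  rw [Finset.sum_eq_single j]
  · rw [colEntry, if_pos (by rw [edge_mod _ j.2]), one_mul]
  · intro k _ hk
    rw [colEntry, if_neg, if_neg, zero_mul]
    · rw [edge_div _ k.2]
      have := i.2
      omega
    · rw [edge_mod _ k.2]
      intro h
      exact hk (Fin.ext (by omega))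
  · simp

theorem sum_colEntry_machine (a : ℕ → ℕ → ℝ) (z : ℕ → ℝ) (i : Fin m) :
    ∑ e ∈ Finset.range (m * n), colEntry m n a i e * z e =
      ∑ j : Fin n, a i j * z (i * n + j) := by
  rw [sum_range_mul, Finset.sum_eq_single i]
  · refine Finset.sum_congr rfl fun j _ => ?_
    rw [colEntry, edge_div _ j.2, edge_mod _ j.2, if_neg (by have := i.2; omega), if_pos rfl]
  · intro k _ hk
    refine Finset.sum_eq_zero fun j _ => ?_
    rw [colEntry, edge_div _ j.2, edge_mod _ j.2, if_neg (by have := i.2; omega), if_neg,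
      zero_mul]
    intro h
    exact hk (Fin.ext h.symm)
  · simp

/-- The rounding of a solution, given the critical speeds and the threshold: a basic solution is
computed, and its fractional edges are matched with machines and jobs. -/
def coreCmd : Cmd :=
  .seq weightCmd <| .seq buildCmd <| .seq basicCmd <| .seq matchCmd <| .seq selectCmd <|
    .seq assignCmd startCmd

theorem runs_core {I : Instance m n} {p C β : ℝ} {γ : Fin n → ℝ} {x : Fin m → Fin n → ℝ} {L : ℕ}
    {σ : Store} (hm : 0 < m) (hp1 : 1 ≤ p) (hβ0 : 0 < β) (hβ1 : β < 1)
    (hx : I.IsFractional p C γ x) (hB : Base m n L σ)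
    (h0 : ∀ i j, σ.arr 0 (i : Fin m) (j : Fin n) = I.speed i j)
    (h1 : ∀ i j, σ.arr 1 (i : Fin m) (j : Fin n) = x i j)
    (hp : σ.arr 2 0 0 = p) (hC : σ.arr 2 0 1 = C) (hβ : σ.arr 2 0 2 = β)
    (h3 : ∀ j : Fin n, σ.arr 3 0 j = γ j) :
    Runs I.oracle L coreCmd σ fun σ' => (outputSchedule m n σ').IsFeasible I p ∧
      (outputSchedule m n σ').makespan I p ≤ (1 / β + 1 / (1 - β) ^ (1 / p)) * C := by
  have h7 : ∀ k ∈ Set.Ici 10, 7 ≤ k := fun k hk => le_trans (by norm_num) (Set.mem_Ici.1 hk)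
  refine runs_seq (runs_weight hB hx.speed_nonneg h0 hp hC h3 fun σ₁ hF₁ ha => ?_)
  have hB₁ := hB.fr hF₁ h7
  refine runs_seq (runs_build hB₁ fun σ₂ hF₂ hx₂ hT₂ hinc₂ hB₂' => ?_)
  have hB₂ := hB₁.fr hF₂ h7
  have hx₂' : ∀ (i : Fin m) (j : Fin n), σ₂.arr 10 0 (i * n + j) = x i j := by
    intro i j
    rw [hx₂ _ (edge_lt i.2 j.2), edge_div _ j.2, edge_mod _ j.2, hF₁.arr 1 (by simp), h1]
  have hx₂0 : ∀ e < m * n, 0 ≤ σ₂.arr 10 0 e := by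
    intro e he
    have hn : 0 < n := Nat.pos_of_mul_pos_left ((Nat.zero_le _).trans_lt he)
    have := hx.nonneg ⟨e / n, Nat.div_lt_of_lt_mul (by rwa [mul_comm])⟩
      ⟨e % n, Nat.mod_lt _ hn⟩
    rw [hx₂ e he, hF₁.arr 1 (by simp)]
    exact le_of_le_of_eq this (h1 _ _).symm
  refine runs_seq (runs_basic hB₂ (Tableau.init hT₂ hB₂' hx₂0) fun σ₃ bas hF₃ hT₃ => ?_)
  have hB₃ := hB₂.fr hF₃ (by
    intro k hk
    simp only [Set.mem_insert_iff, Set.mem_Ici] at hk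
    omega)
  set y : ℕ → ℝ := σ₃.arr 10 0 with hy
  have hV : ∀ r < m + n, ∀ e < m * n, colEntry m n (σ₁.arr 6) r e ≠ 0 → IsEnd m n r e := by
    intro r _ e _ hne
    rw [colEntry] at hne
    rw [IsEnd]
    by_contra! hcon
    rw [if_neg hcon.1, if_neg hcon.2] at hne
    exact hne rfl
  have hhall : Hall (IsEnd m n) ((Finset.range (m * n)).filter fun e => y e ≠ 0)
      (Finset.range (m + n)) := by
    refine hall_of_independent hV (Finset.filter_subset _ _) fun d hd hVd =>
      hT₃.eq_zero_of_sum_eq_zero (fun e he hye => hd e ?_) hVd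
    simp [hye]
  refine runs_seq (runs_match hB₃ hT₃.nonneg rfl hhall (fun r hr e he => by
    rw [hF₃.arr 9 (by simp), hinc₂ r hr e he]) fun σ₄ E U rem cap hF₄ hP => ?_)
  have hB₄ := hB₃.fr hF₄ fun k hk => hk
  have hE : E = ∅ := Finset.card_eq_zero.1 (Nat.le_zero.1 hP.card_le)
  refine runs_seq (runs_select hB₄ fun σ₅ hF₅ hsel => ?_)
  have hB₅ := hB₄.fr hF₅ h7
  refine runs_seq (runs_assign hB₅ fun σ₆ hF₆ h4 h5 => ?_)
  have hB₆ := hB₅.fr hF₆ h7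
  have e2 : σ₄.arr 2 = σ.arr 2 := by
    rw [hF₄.arr 2 (by simp), hF₃.arr 2 (by simp), hF₂.arr 2 (by simp), hF₁.arr 2 (by simp)]
  have e2' : σ₆.arr 2 = σ.arr 2 := by
    rw [hF₆.arr 2 (by simp), hF₅.arr 2 (by simp), e2]
  have e6 : σ₆.arr 6 = σ₁.arr 6 := by
    rw [hF₆.arr 6 (by simp), hF₅.arr 6 (by simp), hF₄.arr 6 (by simp), hF₃.arr 6 (by simp),
      hF₂.arr 6 (by simp)]
  have e10 : σ₄.arr 10 0 = y := by rw [hF₄.arr 10 (by simp)]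
  have e18 : σ₆.arr 18 = σ₅.arr 18 := hF₆.arr 18 (by simp)
  have e16 : σ₅.arr 16 = σ₄.arr 16 := hF₅.arr 16 (by simp)
  rw [e2, e10, hβ] at hsel
  set s := σ₅.arr 18 with hs
  have hpos : ∀ i < m, ∀ j < n, 0 < s i j ↔ s i j = 1 := by
    intro i hi j hj
    rcases hsel.val i hi j hj trivial with h | h
    · simp [h]
    · simp [h.1]
  refine runs_start hB₆ (by rw [e2', hp]) (by rw [e2', hC]) (by rw [e2', hβ]) hβ1 ?_ h5
    fun σ₇ hF₇ hst1 hst2 => ?_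
  · rw [e18]
    intro i hi i' hi' j hj hpi hpi'
    exact hsel.unique i hi i' hi' j hj trivial trivial ((hpos i hi j hj).1 hpi)
      ((hpos i' hi' j hj).1 hpi')
  rw [e18, e6] at hst1
  rw [e18] at hst2
  have h4' : ∀ i < m, ∀ j < n, σ₇.arr 4 i j =
      if σ₅.arr 19 0 j ≤ 0 then σ₄.arr 16 i (i * n + j) else s i j := by
    intro i hi j hj
    rw [hF₇.arr 4 (by simp), h4 i hi j hj, e16]
  have hE₀ : ∀ (i : Fin m) (j : Fin n), 0 < y (i * n + j) →
      (i * n + j : ℕ) ∈ (Finset.range (m * n)).filter fun e => y e ≠ 0 := by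
    intro i j h
    simp [edge_lt i.2 j.2, h.ne']
  -- No edge is left over, so a support edge that is not matched with its machine is matched with
  -- its job.
  have hmatched : ∀ (i : Fin m) (j : Fin n), 0 < y (i * n + j) →
      σ₄.arr 16 i (i * n + j) ≠ 1 → σ₄.arr 16 (m + j) (i * n + j) = 1 := by
    intro i j h hne
    obtain ⟨r, hr, h1⟩ := hP.exists_asg _ (hE₀ i j h) (by simp [hE])
    rcases hP.asg_eq r hr _ (edge_lt i.2 j.2) with h0 | ⟨-, h2, -⟩
    · rw [h0] at h1
      norm_num at h1
    · rw [IsEnd, edge_div _ j.2, edge_mod _ j.2] at h2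
      rcases h2 with rfl | rfl
      · exact h1
      · exact absurd h1 hne
  have hsum : ∀ r < m + n, ∑ e ∈ Finset.range (m * n), colEntry m n (σ₁.arr 6) r e * y e =
      ∑ e ∈ Finset.range (m * n), colEntry m n (σ₁.arr 6) r e * σ₂.arr 10 0 e := hT₃.sol
  refine schedule_of_rounding (a := I.weight p C γ) (y := fun i j => y (i * n + j)) (γ := γ)
    (sgl := fun i j => s i j = 1) (asg := fun i j => σ₄.arr 16 i (i * n + j) = 1)
    hp1 hβ0 hβ1 (hx.target_nonneg hm)
    (fun i j => hT₃.nonneg _ (edge_lt i.2 j.2)) (I.weight_nonneg hx.speed_nonneg)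
    ?_ ?_ ?_ ?_ ?_ ?_ ?_ ?_ ?_ ?_
  · intro i j h
    refine hx.coeff i j (lt_of_le_of_ne (hx.nonneg i j) fun h' => h.ne' ?_)
    exact hT₃.supp _ (edge_lt i.2 j.2) (by rw [hx₂', ← h'])
  · intro j
    have := hsum (m + j) (by omega)
    rw [sum_colEntry_job, sum_colEntry_job] at this
    rw [this, ← hx.assign j]
    exact Finset.sum_congr rfl fun i _ => hx₂' i j
  · intro i
    have := hsum i (by omega)
    rw [sum_colEntry_machine, sum_colEntry_machine] at this
    refine le_of_eq_of_le ?_ (hx.load i)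
    calc ∑ j, I.weight p C γ i j * y (i * n + j)
        = ∑ j : Fin n, σ₁.arr 6 i j * y (i * n + j) :=
          Finset.sum_congr rfl fun j _ => by rw [ha]
      _ = ∑ j : Fin n, σ₁.arr 6 i j * σ₂.arr 10 0 (i * n + j) := this
      _ = _ := Finset.sum_congr rfl fun j _ => by rw [ha, hx₂']
  · intro i j h
    rcases hsel.val i i.2 j j.2 trivial with h' | h'
    · rw [h'] at h
      norm_num at h
    · exact h'.2.1
  · intro i j h
    have hf := hsel.large i i.2 j j.2 trivial h
    rcases hsel.flag j j.2 with h' | ⟨-, i', hi', -, h'⟩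
    · rw [h'] at hf
      norm_num at hf
    · exact ⟨⟨i', hi'⟩, h'⟩
  · intro i j h
    rcases hP.asg_eq i (by omega) _ (edge_lt i.2 j.2) with h0 | ⟨-, -, -, h2⟩
    · rw [h0] at h
      norm_num at h
    · exact lt_of_le_of_ne (hT₃.nonneg _ (edge_lt i.2 j.2)) (Ne.symm (Finset.mem_filter.1 h2).2)
  · intro i j j' hj hj'
    have := hP.unique i (by omega) _ (edge_lt i.2 j.2) _ (edge_lt i.2 j'.2) hj hj'
    exact Fin.ext (by omega)
  · intro i i' j hi hni hi' hni'
    -- Both omitted edges are matched with the vertex `m + j` of the job, which admits only one.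
    have := hP.unique (m + j) (by omega) _ (edge_lt i.2 j.2) _ (edge_lt i'.2 j.2)
      (hmatched i j hi hni) (hmatched i' j hi' hni')
    have h1 := edge_div i j.2
    have h2 := edge_div i' j.2
    exact Fin.ext (by rw [← h1, ← h2, this])
  · intro i j h
    have hf : ¬ σ₅.arr 19 0 j ≤ 0 := by
      rcases hsel.val i i.2 j j.2 trivial with h' | h'
      · rw [h'] at h
        norm_num at h
      · rw [h'.2.2]
        norm_num
    constructor
    · ext i'
      simp only [outputSchedule, Finset.mem_filter, Finset.mem_univ, true_and,
        Finset.mem_singleton]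
      rw [h4' i' i'.2 j j.2, if_neg hf, hpos i' i'.2 j j.2]
      constructor
      · intro h'
        exact Fin.ext (hsel.unique i' i'.2 i i.2 j j.2 trivial trivial h' h)
      · rintro rfl
        exact h
    · change σ₇.arr 5 0 j = _
      rw [hst1 i i.2 j j.2 ((hpos i i.2 j j.2).2 h), selectedLoad, Finset.sum_filter]
      congr 1
      have : Finset.Ico ((j : ℕ) + 1) n = (Finset.range n).filter fun k => (j : ℕ) < k := by
        ext k
        simp only [Finset.mem_Ico, Finset.mem_filter, Finset.mem_range]
        omega
      rw [this, Finset.sum_filter, Finset.sum_range]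
      refine Finset.sum_congr rfl fun k _ => ?_
      rw [ha, ite_and]
      simp only [Fin.lt_def, hpos i i.2 k k.2]
  · intro j h
    have hf : σ₅.arr 19 0 j ≤ 0 := by
      rcases hsel.flag j j.2 with h' | ⟨-, i', hi', -, h'⟩
      · exact h'.le
      · exact absurd h' (h ⟨i', hi'⟩)
    constructor
    · intro i
      simp only [outputSchedule, Finset.mem_filter, Finset.mem_univ, true_and]
      rw [h4' i i.2 j j.2, if_pos hf]
      rcases hP.asg_eq i (by omega) _ (edge_lt i.2 j.2) with h0 | ⟨h0, -⟩ <;> simp [h0]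
    · refine hst2 j j.2 fun i hi => ?_
      rw [← not_lt, hpos i hi j j.2]
      exact h ⟨i, hi⟩

/-! #### Integral critical speeds -/

/-- Computes the integral critical speeds by doubling and bisection. -/
def criticalCmd : Cmd :=
  .for 10 1 <| .seq (.realLit (sc 20) 0) <| .seq (.query (sc 24) 10 (sc 20)) <|
    .ite (.realLe (sc 24) ⟨2, 2, 3⟩) (.realLit (ve 3 10) 0) <|
      .seq (.realLit (sc 22) 1) <| .seq (.realLit (sc 23) 1) <| .seq (.realLit (sc 25) 1) <|
      .seq (.realLit (sc 26) 2) <|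
      .seq (.loop (.realLe (sc 25) (sc 23)) <| .seq (.query (sc 24) 10 (sc 22)) <|
        .ite (.realLe (sc 24) ⟨2, 2, 3⟩) (.realLit (sc 23) 0)
          (.realOp .mul (sc 22) (sc 22) (sc 26))) <|
      .seq (.realLit (sc 27) 0) <|
      .seq (.loop (.realLe (sc 26) (sc 22)) <| .seq (.realOp .div (sc 22) (sc 22) (sc 26)) <|
        .seq (.realOp .add (sc 28) (sc 27) (sc 22)) <| .seq (.query (sc 24) 10 (sc 28)) <|
        .ite (.realLe (sc 24) ⟨2, 2, 3⟩) .skip (.copy (sc 27) (sc 28))) <|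
      .realOp .add (ve 3 10) (sc 27) (sc 25)

theorem Instance.oracle_eq (I : Instance m n) (j : Fin n) {q : ℝ} (hq : 0 ≤ q) :
    I.oracle j q = I.time j q := by
  simp [Instance.oracle, hq]

theorem runs_critical {I : Instance m n} {C : ℝ} {L K : ℕ} {σ : Store} {Q : Store → Prop}
    (hB : Base m n L σ) (hC : σ.arr 2 0 1 = C) (hK : ∀ j, I.time j (2 ^ K) ≤ C) (hKL : K + 1 ≤ L)
    (hQ : ∀ σ', Fr (Set.Ici 10) {3, 20, 21, 22, 23, 24, 25, 26, 27, 28} σ σ' →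
      (∀ j : Fin n, σ'.arr 3 0 j = I.critSpeed integralSpeeds C j) → Q σ') :
    Runs I.oracle L criticalCmd σ Q := by
  have hadd := hB.add_le
  have h7 : ∀ k ∈ Set.Ici 10, 7 ≤ k := fun k hk => le_trans (by norm_num) (Set.mem_Ici.1 hk)
  refine runs_map1 (Set.Ici 10) {3, 20, 21, 22, 23, 24, 25, 26, 27, 28} ∅ 3
    (fun j => if h : j < n then I.critSpeed integralSpeeds C ⟨j, h⟩ else 0) (by simp) (by simp)
    (by simp) (by simp) hB.i2 hB.i3 (by rw [hB.i1]; omega) ?_ ?_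
  swap
  · intro σ' hF h
    refine hQ σ' hF fun j => ?_
    rw [h, hB.i1, if_pos ⟨rfl, j.2⟩, dif_pos j.2]
  intro w σ₁ hw hF₁ hkw _
  rw [hB.i1] at hw
  have hB₁ := hB.fr hF₁ h7
  set j : Fin n := ⟨w, hw⟩ with hj
  have hC₁ : σ₁.arr 2 0 1 = C := by rw [hF₁.arr 2 (by simp), hC]
  have horacle : ∀ q : ℝ, 0 ≤ q → I.oracle w q = I.time j q := fun q hq => I.oracle_eq j hq
  rw [dif_pos hw]
  -- Speed `0` is tested first: the bisection starts with the lower end `0`, which has to miss the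
  -- target.
  refine runs_seq (runs_realLit (runs_seq (runs_query (runs_ite (fun h => runs_realLit ?_)
    fun h => ?_))))
  all_goals
    simp only [Test.Holds, Store.get_def, Store.set_arr, Store.set_idx, hB₁.i2, hB₁.i3, hkw,
      Nat.reduceEqDiff, false_and, if_false, and_self, if_true, hC₁, Nat.cast_zero,
      horacle 0 le_rfl] at h
  · refine ⟨((Fr.refl.set (by simp)).set (by simp)).set (by simp), fun r l => ?_⟩
    have : I.critSpeed integralSpeeds C j = (0 : ℕ) :=
      Instance.critSpeed_integral_eq (by simpa using h) (by simp)
    rw [this]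
    simp [hB₁.i2, hkw]
  refine runs_seq (runs_realLit (runs_seq (runs_realLit (runs_seq (runs_realLit (runs_seq
    (runs_realLit (runs_seq ?_))))))))
  set σ₂ := (((((σ₁.set (sc 20) (0 : ℕ)).set (sc 24) _).set (sc 22) (1 : ℕ)).set (sc 23)
    (1 : ℕ)).set (sc 25) (1 : ℕ)).set (sc 26) (2 : ℕ) with hσ₂
  have hF₂ : Fr ∅ {20, 21, 22, 23, 24, 25, 26, 27, 28} σ₁ σ₂ :=
    (((((Fr.refl.set (by simp)).set (by simp)).set (by simp)).set (by simp)).set (by simp)).set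
      (by simp)
  have e22 : σ₂.arr 22 0 0 = 1 := by simp [hσ₂, hB₁.i2]
  have e23 : σ₂.arr 23 0 0 = 1 := by simp [hσ₂, hB₁.i2]
  have e25 : σ₂.arr 25 0 0 = 1 := by simp [hσ₂, hB₁.i2]
  have e26 : σ₂.arr 26 0 0 = 2 := by simp [hσ₂, hB₁.i2]
  clear_value σ₂
  clear hσ₂
  -- Doubling: cell `22` holds `2 ^ t`, and flag `23` falls once this speed meets the target. By
  -- `hK` this happens at `t = K` at the latest, so there are at most `K + 1` rounds.
  refine runs_loop (fun k σ₃ => Fr ∅ {22, 23, 24} σ₂ σ₃ ∧ ∃ t ≤ K, σ₃.arr 22 0 0 = 2 ^ t ∧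
    ((σ₃.arr 23 0 0 = 1 ∧ k + t = K + 1) ∨ (σ₃.arr 23 0 0 = 0 ∧ I.time j (2 ^ t) ≤ C)))
    hKL ⟨Fr.refl, 0, Nat.zero_le _, by simpa using e22, Or.inl ⟨e23, rfl⟩⟩ ?_ ?_
  · rintro k σ₃ ⟨hF₃, t, htK, ht, hcase⟩ hb
    have hB₃ := hB₁.fr (hF₂.trans (hF₃.mono subset_rfl (by
      intro k hk
      simp only [Set.mem_insert_iff, Set.mem_singleton_iff] at hk ⊢
      omega))) (by simp)
    have hb' : (1 : ℝ) ≤ σ₃.arr 23 0 0 := by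
      simpa [Test.Holds, hB₃.i2, hF₃.arr 25 (by simp), e25] using hb
    rcases hcase with ⟨hfl, hk⟩ | ⟨hfl, -⟩
    swap
    · rw [hfl] at hb'
      norm_num at hb'
    have ekw : σ₃.idx 10 = w := by rw [hF₃.idx 10 (by simp), hF₂.idx 10 (by simp), hkw]
    have e2 : σ₃.arr 2 0 1 = C := by rw [hF₃.arr 2 (by simp), hF₂.arr 2 (by simp), hC₁]
    have e26' : σ₃.arr 26 0 0 = 2 := by rw [hF₃.arr 26 (by simp), e26]
    refine ⟨K - t, by omega, runs_seq (runs_query (runs_ite (fun h' => runs_realLit ?_)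
      fun h' => runs_realOp ?_))⟩
    all_goals
      simp only [Test.Holds, Store.get_def, Store.set_arr, Store.set_idx, hB₃.i2, hB₃.i3, ekw,
        Nat.reduceEqDiff, false_and, if_false, and_self, if_true, e2, ht,
        horacle (2 ^ t) (by positivity)] at h'
    · refine ⟨(hF₃.set (by simp)).set (by simp), t, htK, by simp [ht], Or.inr ⟨?_, h'⟩⟩
      simp [hB₃.i2]
    · have htK' : t < K := by
        refine lt_of_le_of_ne htK ?_
        rintro rfl
        exact h' (hK j)
      refine ⟨(hF₃.set (by simp)).set (by simp), t + 1, htK', ?_, Or.inl ⟨?_, by omega⟩⟩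
      · simp [hB₃.i2, ht, e26', RealOp.eval, pow_succ]
      · simp [hfl]
  rintro k σ₃ ⟨hF₃, t, htK, ht, hcase⟩ hb
  have hF₃' : Fr ∅ {20, 21, 22, 23, 24, 25, 26, 27, 28} σ₁ σ₃ := hF₂.trans (hF₃.mono subset_rfl (by
    intro k hk
    simp only [Set.mem_insert_iff, Set.mem_singleton_iff] at hk ⊢
    omega))
  have hB₃ := hB₁.fr hF₃' (by simp)
  have hle : I.time j (2 ^ t) ≤ C := by
    rcases hcase with ⟨hfl, -⟩ | ⟨-, h'⟩
    · exact absurd (by simp [Test.Holds, hB₃.i2, hF₃.arr 25 (by simp), e25, hfl]) hb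
    · exact h'
  refine runs_seq (runs_realLit (runs_seq ?_))
  have hF₃₀ : Fr ∅ {20, 21, 22, 23, 24, 25, 26, 27, 28} σ₁ (σ₃.set (sc 27) (0 : ℕ)) :=
    hF₃'.set (by simp)
  -- Bisection: `g` misses the target, `g + 2 ^ k` meets it, and `k` rounds are left. At `k = 0` the
  -- critical speed is `g + 1`.
  refine runs_loop (fun k σ₄ => Fr ∅ {21, 22, 24, 27, 28} (σ₃.set (sc 27) (0 : ℕ)) σ₄ ∧
    σ₄.arr 22 0 0 = 2 ^ k ∧ ∃ g : ℕ, σ₄.arr 27 0 0 = g ∧ ¬ I.time j g ≤ C ∧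
      I.time j ((g : ℝ) + 2 ^ k) ≤ C) (k := t) (by omega) ?_ ?_ ?_
  · refine ⟨Fr.refl, by simpa using ht, 0, by simp [hB₃.i2], by simpa using h, by simpa using hle⟩
  · rintro k σ₄ ⟨hF₄, h22, g, hg, hg1, hg2⟩ hb'
    have hF₄' : Fr ∅ {20, 21, 22, 23, 24, 25, 26, 27, 28} σ₁ σ₄ :=
      hF₃₀.trans (hF₄.mono subset_rfl (by
        intro k hk
        simp only [Set.mem_insert_iff, Set.mem_singleton_iff] at hk ⊢
        omega))
    have hB₄ := hB₁.fr hF₄' (by simp)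
    have e26' : σ₄.arr 26 0 0 = 2 := by
      rw [hF₄.arr 26 (by simp), Store.set_arr_ne _ _ _ (by simp), hF₃.arr 26 (by simp), e26]
    have hb2 : (2 : ℝ) ≤ 2 ^ k := by
      simpa [Test.Holds, hB₄.i2, h22, e26'] using hb'
    obtain ⟨l, rfl⟩ : ∃ l, k = l + 1 := by
      refine ⟨k - 1, ?_⟩
      rcases Nat.eq_zero_or_pos k with rfl | hk
      · norm_num at hb2
      · omega
    have ekw : σ₄.idx 10 = w := by rw [hF₄'.idx 10 (by simp), hkw]
    have e2 : σ₄.arr 2 0 1 = C := by rw [hF₄'.arr 2 (by simp), hC₁]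
    have ehalf : (2 : ℝ) ^ (l + 1) / 2 = 2 ^ l := by
      rw [pow_succ]
      norm_num
    refine ⟨l, rfl, runs_seq (runs_realOp (runs_seq (runs_realOp (runs_seq (runs_query (runs_ite
      (fun h' => runs_skip ?_) fun h' => runs_copy (by simp) (by simp [hB₄.i2]) ?_))))))⟩
    all_goals
      simp only [Test.Holds, RealOp.eval, Store.get_def, Store.set_arr, Store.set_idx, hB₄.i2,
        hB₄.i3, ekw, Nat.reduceEqDiff, false_and, if_false, and_self, if_true, e2, h22, e26', hg,
        ehalf, horacle ((g : ℝ) + 2 ^ l) (by positivity)] at h'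
    · refine ⟨((hF₄.set (by simp)).set (by simp)).set (by simp), ?_, g, ?_, hg1, h'⟩
      · simp [hB₄.i2, RealOp.eval, h22, e26', ehalf]
      · simp [hg]
    · refine ⟨((((hF₄.set (by simp)).set (by simp)).set (by simp)).set (by simp)).set (by simp),
        ?_, g + 2 ^ l, ?_, ?_, ?_⟩
      · simp [hB₄.i2, RealOp.eval, h22, e26', ehalf]
      · simp [hB₄.i2, RealOp.eval, h22, e26', ehalf, hg]
      · push_cast
        exact h'
      · push_cast
        rw [add_assoc, ← two_mul, ← pow_succ']
        exact hg2
  · rintro k σ₄ ⟨hF₄, h22, g, hg, hg1, hg2⟩ hb'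
    have hF₄' : Fr ∅ {20, 21, 22, 23, 24, 25, 26, 27, 28} σ₁ σ₄ :=
      hF₃₀.trans (hF₄.mono subset_rfl (by
        intro k hk
        simp only [Set.mem_insert_iff, Set.mem_singleton_iff] at hk ⊢
        omega))
    have hB₄ := hB₁.fr hF₄' (by simp)
    have e26' : σ₄.arr 26 0 0 = 2 := by
      rw [hF₄.arr 26 (by simp), Store.set_arr_ne _ _ _ (by simp), hF₃.arr 26 (by simp), e26]
    have e25' : σ₄.arr 25 0 0 = 1 := by
      rw [hF₄.arr 25 (by simp), Store.set_arr_ne _ _ _ (by simp), hF₃.arr 25 (by simp), e25]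
    have hk : k = 0 := by
      by_contra hk
      refine hb' ?_
      have : (2 : ℝ) ≤ 2 ^ k := le_self_pow₀ (by norm_num) hk
      simpa [Test.Holds, hB₄.i2, h22, e26'] using this
    subst hk
    have hcrit : I.critSpeed integralSpeeds C j = (g + 1 : ℕ) := by
      refine Instance.critSpeed_integral_eq ?_ fun k hk => ?_
      · push_cast
        simpa using hg2
      · obtain rfl : k = g := by omega
        exact hg1
    have ekw : σ₄.idx 10 = w := by rw [hF₄'.idx 10 (by simp), hkw]
    refine runs_realOp ⟨(hF₄'.mono subset_rfl (by simp)).set (by simp), fun r l => ?_⟩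
    rw [hcrit]
    simp [hB₄.i2, ekw, RealOp.eval, hg, e25', hF₄'.arr 3 (by simp)]

/-! #### The threshold for `p ≥ 2` -/

/-- Stores the threshold `1 - log p / p`. -/
def thresholdCmd : Cmd :=
  .seq (.realLog (sc 24) (sc 2)) <| .seq (.realOp .div (sc 24) (sc 24) (sc 2)) <|
    .seq (.realLit (sc 25) 1) <| .realOp .sub ⟨2, 2, 6⟩ (sc 25) (sc 24)

theorem runs_threshold {F : ℕ → ℝ → ℝ} {L : ℕ} {σ : Store} {Q : Store → Prop} {p : ℝ}
    (hB : Base m n L σ) (hp : σ.arr 2 0 0 = p)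
    (hQ : ∀ σ', Fr ∅ {2, 24, 25} σ σ' → (∀ l, σ'.arr 2 0 l =
      if l = 2 then 1 - Real.log p / p else σ.arr 2 0 l) → Q σ') :
    Runs F L thresholdCmd σ Q := by
  refine runs_seq (runs_realLog (runs_seq (runs_realOp (runs_seq (runs_realLit
    (runs_realOp (hQ _ ?_ ?_)))))))
  · exact (((Fr.refl.set (by simp)).set (by simp)).set (by simp)).set (by simp)
  · intro l
    simp [hB.i2, hB.i6, RealOp.eval, hp]

/-- For `p ≥ 2` one has `0 < log p ≤ p - 1`, so `log p / p` lies strictly between `0` and `1`; this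
number is `1 - β`, and both terms of the guarantee simplify. -/
theorem threshold_bounds {p : ℝ} (hp : 2 ≤ p) :
    0 < 1 - Real.log p / p ∧ 1 - Real.log p / p < 1 ∧
      1 / (1 - Real.log p / p) + 1 / (1 - (1 - Real.log p / p)) ^ (1 / p) =
        p / (p - Real.log p) + (p / Real.log p) ^ (1 / p) := by
  have hp0 : 0 < p := by linarith
  have hlog : 0 < Real.log p := Real.log_pos (by linarith)
  have hlt : Real.log p < p := (Real.log_le_sub_one_of_pos hp0).trans_lt (by linarith)
  have h1 : Real.log p / p < 1 := (div_lt_one hp0).2 hlt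
  have h2 : 0 < Real.log p / p := by positivity
  refine ⟨by linarith, by linarith, ?_⟩
  rw [sub_sub_cancel]
  congr 1
  · have : p - Real.log p ≠ 0 := by linarith
    field_simp
  · rw [one_div, ← Real.inv_rpow h2.le, inv_div]

theorem Instance.IsLPSolution.target_nonneg {I : Instance m n} {Q : Set ℝ} {p C : ℝ}
    {x : Fin m → Fin n → ℝ} (h : I.IsLPSolution Q p C x) (hm : 0 < m) : 0 ≤ C := by
  refine le_trans ?_ (h.load ⟨0, hm⟩)
  refine add_nonneg (Finset.sum_nonneg fun j _ => ?_) (Finset.sum_nonneg fun j _ => ?_)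
  · exact mul_nonneg (I.time_nonneg j _ (Nat.cast_nonneg _)) (h.nonneg _ _)
  · have h1 := I.critSpeed_nonneg Q C j
    exact mul_nonneg (mul_nonneg (I.time_nonneg j _ h1)
      (Real.rpow_nonneg (div_nonneg h1 (Nat.cast_nonneg _)) _)) (h.nonneg _ _)

/-- One loop bound serves the whole program: loops over vertices, loops over edges, and the at most
`size + 2` doublings and bisections. -/
theorem Instance.size_bounds (I : Instance m n) :
    m + n ≤ (I.size + 2) ^ 2 ∧ m * n ≤ (I.size + 2) ^ 2 ∧ I.size + 2 ≤ (I.size + 2) ^ 2 := by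
  have h : m + n ≤ I.size := by
    rw [Instance.size]
    omega
  refine ⟨?_, ?_, ?_⟩
  · nlinarith
  · have h1 : m ≤ I.size := by omega
    have h2 : n ≤ I.size := by omega
    have := Nat.mul_le_mul h1 h2
    nlinarith
  · nlinarith

/-- A program whose loops do at most `(size + 2) ^ 2` rounds runs in polynomial time. -/
theorem Runs.schedules {I : Instance m n} {c : Cmd} {σ : Store} {p B : ℝ}
    (h : Runs I.oracle ((I.size + 2) ^ 2) c σ fun σ' =>
      (outputSchedule m n σ').IsFeasible I p ∧ (outputSchedule m n σ').makespan I p ≤ B) :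
    c.Schedules I p σ ((c.costPoly.comp ((Polynomial.X + 2) ^ 2)).eval I.size) B := by
  obtain ⟨σ', t, h1, h2, h3⟩ := h
  refine ⟨σ', t, h1, h2.trans (le_of_eq ?_), h3⟩
  simp [Polynomial.eval_comp]

/-! ### Contents of the initial memory -/

section Input

variable (I : Instance m n) (x : Fin m → Fin n → ℝ) (params : List ℝ) (γ : Fin n → ℝ)

theorem inputStore_speed (i : Fin m) (j : Fin n) :
    (inputStore I x params γ).arr 0 i j = I.speed i j := by
  simp [inputStore, padMatrix]

theorem inputStore_solution (i : Fin m) (j : Fin n) :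
    (inputStore I x params γ).arr 1 i j = x i j := by
  simp [inputStore, padMatrix]

theorem inputStore_params (l : ℕ) :
    (inputStore I x params γ).arr 2 0 l = params.getD l 0 := by
  simp [inputStore]

theorem inputStore_critical (j : Fin n) :
    (inputStore I x params γ).arr 3 0 j = γ j := by
  simp [inputStore, padMatrix]

theorem runs_setup_inputStore {F : ℕ → ℝ → ℝ} {Q : Store → Prop}
    (hQ : ∀ σ', σ'.arr = (inputStore I x params γ).arr → Base m n ((I.size + 2) ^ 2) σ' → Q σ') :
    Runs F ((I.size + 2) ^ 2) setupCmd (inputStore I x params γ) Q :=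
  runs_setup (by simp [inputStore]) (by simp [inputStore]) (by simp [inputStore])
    I.size_bounds.1 I.size_bounds.2.1 hQ

end Input

end

section

variable {m n : ℕ}

/-! ### The rounding programs -/

theorem runs_critical_core {I : Instance m n} {p C β : ℝ} {x : Fin m → Fin n → ℝ} {σ : Store}
    (hm : 0 < m) (hp1 : 1 ≤ p) (hβ0 : 0 < β) (hβ1 : β < 1)
    (hx : I.IsLPSolution integralSpeeds p C x) (hB : Base m n ((I.size + 2) ^ 2) σ)
    (h0 : ∀ i j, σ.arr 0 (i : Fin m) (j : Fin n) = I.speed i j)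
    (h1 : ∀ i j, σ.arr 1 (i : Fin m) (j : Fin n) = x i j)
    (hp : σ.arr 2 0 0 = p) (hC : σ.arr 2 0 1 = C) (hβ : σ.arr 2 0 2 = β) :
    Runs I.oracle ((I.size + 2) ^ 2) (.seq criticalCmd coreCmd) σ fun σ' =>
      (outputSchedule m n σ').IsFeasible I p ∧
      (outputSchedule m n σ').makespan I p ≤ (1 / β + 1 / (1 - β) ^ (1 / p)) * C := by
  refine runs_seq (runs_critical hB hC (fun j => hx.time_two_pow_le hm hp1 j) I.size_bounds.2.2
    fun σ₁ hF h3 => ?_)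
  have hB₁ := hB.fr hF fun k hk => le_trans (by norm_num) (Set.mem_Ici.1 hk)
  have e2 : σ₁.arr 2 = σ.arr 2 := hF.arr 2 (by simp)
  refine runs_core hm hp1 hβ0 hβ1 hx.isFractional_integral hB₁ (fun i j => ?_) (fun i j => ?_)
    (by rw [e2, hp]) (by rw [e2, hC]) (by rw [e2, hβ]) h3
  · rw [hF.arr 0 (by simp), h0]
  · rw [hF.arr 1 (by simp), h1]

theorem runs_round_integral {I : Instance m n} {p C β : ℝ} {x : Fin m → Fin n → ℝ}
    (hm : 0 < m) (hp : 1 ≤ p) (hβ0 : 0 < β) (hβ1 : β < 1)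
    (hx : I.IsLPSolution integralSpeeds p C x) :
    Runs I.oracle ((I.size + 2) ^ 2) (.seq setupCmd (.seq criticalCmd coreCmd))
      (inputStore I x [p, C, β] 0) fun σ' => (outputSchedule m n σ').IsFeasible I p ∧
        (outputSchedule m n σ').makespan I p ≤ (1 / β + 1 / (1 - β) ^ (1 / p)) * C := by
  refine runs_seq (runs_setup_inputStore I x _ _ fun σ₁ harr hB => ?_)
  refine runs_critical_core hm hp hβ0 hβ1 hx hB ?_ ?_ ?_ ?_ ?_ <;> rw [harr]
  · exact inputStore_speed I x _ _
  · exact inputStore_solution I x _ _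
  all_goals simp [inputStore_params]

theorem runs_round_real {I : Instance m n} {p C β : ℝ} {x : Fin m → Fin n → ℝ}
    (hm : 0 < m) (hp : 1 ≤ p) (hβ0 : 0 < β) (hβ1 : β < 1)
    (hx : I.IsLPSolution realSpeeds p C x) :
    Runs I.oracle ((I.size + 2) ^ 2) (.seq setupCmd coreCmd)
      (inputStore I x [p, C, β] (I.critSpeed realSpeeds C)) fun σ' =>
        (outputSchedule m n σ').IsFeasible I p ∧
        (outputSchedule m n σ').makespan I p ≤ (1 / β + 1 / (1 - β) ^ (1 / p)) * C := by
  refine runs_seq (runs_setup_inputStore I x _ _ fun σ₁ harr hB => ?_)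
  refine runs_core hm hp hβ0 hβ1 (hx.isFractional_real (hx.target_nonneg hm)) hB
    ?_ ?_ ?_ ?_ ?_ ?_ <;> rw [harr]
  · exact inputStore_speed I x _ _
  · exact inputStore_solution I x _ _
  · simp [inputStore_params]
  · simp [inputStore_params]
  · simp [inputStore_params]
  · exact inputStore_critical I x _ _

theorem runs_round_threshold_integral {I : Instance m n} {p C : ℝ} {x : Fin m → Fin n → ℝ}
    (hm : 0 < m) (hp : 2 ≤ p) (hx : I.IsLPSolution integralSpeeds p C x) :
    Runs I.oracle ((I.size + 2) ^ 2)
      (.seq setupCmd (.seq thresholdCmd (.seq criticalCmd coreCmd)))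
      (inputStore I x [p, C] 0) fun σ' => (outputSchedule m n σ').IsFeasible I p ∧
        (outputSchedule m n σ').makespan I p ≤
          (p / (p - Real.log p) + (p / Real.log p) ^ (1 / p)) * C := by
  obtain ⟨hβ0, hβ1, hβ⟩ := threshold_bounds hp
  rw [← hβ]
  refine runs_seq (runs_setup_inputStore I x _ _ fun σ₁ harr hB => runs_seq
    (runs_threshold (p := p) hB ?_ fun σ₂ hF h2 => ?_))
  · simp [harr, inputStore_params]
  refine runs_critical_core hm (by linarith) hβ0 hβ1 hx (hB.fr hF (by simp)) ?_ ?_ ?_ ?_ ?_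
  · rw [hF.arr 0 (by simp), harr]
    exact inputStore_speed I x _ _
  · rw [hF.arr 1 (by simp), harr]
    exact inputStore_solution I x _ _
  all_goals simp [h2, harr, inputStore_params]

theorem runs_round_threshold_real {I : Instance m n} {p C : ℝ} {x : Fin m → Fin n → ℝ}
    (hm : 0 < m) (hp : 2 ≤ p) (hx : I.IsLPSolution realSpeeds p C x) :
    Runs I.oracle ((I.size + 2) ^ 2) (.seq setupCmd (.seq thresholdCmd coreCmd))
      (inputStore I x [p, C] (I.critSpeed realSpeeds C)) fun σ' =>
        (outputSchedule m n σ').IsFeasible I p ∧ (outputSchedule m n σ').makespan I p ≤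
          (p / (p - Real.log p) + (p / Real.log p) ^ (1 / p)) * C := by
  obtain ⟨hβ0, hβ1, hβ⟩ := threshold_bounds hp
  rw [← hβ]
  refine runs_seq (runs_setup_inputStore I x _ _ fun σ₁ harr hB => runs_seq
    (runs_threshold (p := p) hB ?_ fun σ₂ hF h2 => ?_))
  · simp [harr, inputStore_params]
  refine runs_core hm (by linarith) hβ0 hβ1 (hx.isFractional_real (hx.target_nonneg hm))
    (hB.fr hF (by simp)) ?_ ?_ ?_ ?_ ?_ ?_
  · rw [hF.arr 0 (by simp), harr]
    exact inputStore_speed I x _ _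
  · rw [hF.arr 1 (by simp), harr]
    exact inputStore_solution I x _ _
  · simp [h2, harr, inputStore_params]
  · simp [h2, harr, inputStore_params]
  · simp [h2]
  · rw [hF.arr 3 (by simp), harr]
    exact inputStore_critical I x _ _

end

end Malleable

end

/-! ### Assembly -/

theorem mainTheorem6 :
    -- Threshold rounding: the critical speeds are integral and are not part of the input.
    (∃ (c : Malleable.Cmd) (P : Polynomial ℕ),
      ∀ (m n : ℕ) (I : Malleable.Instance m n) (p C β : ℝ) (x : Fin m → Fin n → ℝ),
        0 < m → 1 ≤ p → 0 < β → β < 1 →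
        I.IsLPSolution Malleable.integralSpeeds p C x →
        c.Schedules I p (Malleable.inputStore I x [p, C, β] 0) (P.eval I.size)
          ((1 / β + 1 / (1 - β) ^ (1 / p)) * C)) ∧
    -- Threshold rounding: the critical speeds are real and come with the linear program.
    (∃ (c : Malleable.Cmd) (P : Polynomial ℕ),
      ∀ (m n : ℕ) (I : Malleable.Instance m n) (p C β : ℝ) (x : Fin m → Fin n → ℝ),
        0 < m → 1 ≤ p → 0 < β → β < 1 →
        I.IsLPSolution Malleable.realSpeeds p C x →
        c.Schedules I p
          (Malleable.inputStore I x [p, C, β] (I.critSpeed Malleable.realSpeeds C))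
          (P.eval I.size) ((1 / β + 1 / (1 - β) ^ (1 / p)) * C)) ∧
    -- The rounding theorem for `p ≥ 2`, with integral critical speeds.
    (∃ (c : Malleable.Cmd) (P : Polynomial ℕ),
      ∀ (m n : ℕ) (I : Malleable.Instance m n) (p C : ℝ) (x : Fin m → Fin n → ℝ),
        0 < m → 2 ≤ p →
        I.IsLPSolution Malleable.integralSpeeds p C x →
        c.Schedules I p (Malleable.inputStore I x [p, C] 0) (P.eval I.size)
          ((p / (p - Real.log p) + (p / Real.log p) ^ (1 / p)) * C)) ∧
    -- The rounding theorem for `p ≥ 2`, with real critical speeds.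
    (∃ (c : Malleable.Cmd) (P : Polynomial ℕ),
      ∀ (m n : ℕ) (I : Malleable.Instance m n) (p C : ℝ) (x : Fin m → Fin n → ℝ),
        0 < m → 2 ≤ p →
        I.IsLPSolution Malleable.realSpeeds p C x →
        c.Schedules I p
          (Malleable.inputStore I x [p, C] (I.critSpeed Malleable.realSpeeds C))
          (P.eval I.size) ((p / (p - Real.log p) + (p / Real.log p) ^ (1 / p)) * C)) ∧
    -- The linear program is feasible for every target that is at least the optimum.
    (∀ (m n : ℕ) (I : Malleable.Instance m n) (p C : ℝ),
      0 < m → 1 ≤ p → I.opt p ≤ C →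
      ∃ x : Fin m → Fin n → ℝ, I.IsLPSolution Malleable.realSpeeds p C x) := by
  -- The placeholders for program and polynomial are determined by unification. They stand outside
  -- the binders of the instance, so the algorithm is uniform.
  refine ⟨⟨_, _, fun m n I p C β x hm hp hβ0 hβ1 hx =>
      (Malleable.runs_round_integral hm hp hβ0 hβ1 hx).schedules⟩,
    ⟨_, _, fun m n I p C β x hm hp hβ0 hβ1 hx =>
      (Malleable.runs_round_real hm hp hβ0 hβ1 hx).schedules⟩,
    ⟨_, _, fun m n I p C x hm hp hx =>
      (Malleable.runs_round_threshold_integral hm hp hx).schedules⟩,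
    ⟨_, _, fun m n I p C x hm hp hx =>
      (Malleable.runs_round_threshold_real hm hp hx).schedules⟩,
    fun m n I p C hm hp hC => Malleable.exists_isLPSolution I hm hp hC⟩
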